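/- Let $(M,g,J)$ be an almost complex Hermitian manifold of real dimension $6$ (smooth, $g$ a $J$-invariant Riemannian metric), with Hermitian form $\omega(X,Y)=g(JX,Y)$. Assume that $M$ is nearly Kähler: there are a smooth $(3,0)$-form $\Omega$ and a real constant $\lambda\neq 0$ with $$d\omega=3\lambda\,\mathrm{Re}\,\Omega,\qquad d\,\mathrm{Im}\,\Omega=-2\lambda\,\omega\wedge\omega .$$ (Here $\omega$ is given by $\omega=\tfrac{i}{2}\sum_j\xi_j\wedge\bar\xi_j$ in a suitable local coframe $\xi_1,\xi_2,\xi_3$ of $(1,0)$-forms; the two equations force $\tfrac16\omega^3=\tfrac14\mathrm{Re}\,\Omega\wedge\mathrm{Im}\,\Omega$, so that the coframe can be chosen with $\Omega=\xi_1\wedge\xi_2\wedge\xi_3$.) Let $\Lambda^*(M)=\bigoplus_{p,q}\Lambda^{p,q}(M)$ be the smooth complex-valued differential forms on $M$, and let $$d=N+\partial+\bar\partial+\bar N,\qquad N=d^{2,-1},\quad \partial=d^{1,0},\quad \bar\partial=d^{0,1},\quad \bar N=d^{-1,2},$$ be the Hodge decomposition of the de Rham differential, where $d^{i,j}$ maps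 $\Lambda^{p,q}(M)$ to $\Lambda^{p+i,q+j}(M)$. For an operator $D$ among $N,\partial,\bar\partial,\bar N$ let $D^*=-{\star}\,D\,{\star}$ be its formal Hermitian adjoint, where $\star$ is the conjugate-linear Hodge star, $\alpha\wedge\star\beta=\langle\alpha,\beta\rangle\,\omega^3/6$. For operators $A,B$ of odd degree write $\{A,B\}=AB+BA$. Then, as operators on $\Lambda^*(M)$, $$\{N^*,\bar\partial\}=\{\bar N^*,\partial\}=\{N,\bar\partial^*\}=\{\bar N,\partial^*\}=0,$$ $$\{\bar\partial^*,\partial\}=-\{N,\partial^*\}=-\{\bar N^*,\bar\partial\},$$ $$\{\partial^*,\bar\partial\}=-\{\bar N,\bar\partial^*\}=-\{N^*,\partial\}.$$ -/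

import Mathlib

open scoped Manifold ContDiff

noncomputable section

namespace NK

/-! ### Linear algebra of complex-valued forms on a real vector space -/

section Algebra

variable {V : Type*} [AddCommGroup V] [Module ℝ V] [TopologicalSpace V]
  [IsTopologicalAddGroup V] [ContinuousSMul ℝ V]

/-- Complex-valued (real-multilinear, alternating) `k`-forms on a real vector space. -/
abbrev CForm (V : Type*) [AddCommGroup V] [Module ℝ V] [TopologicalSpace V] (k : ℕ) : Type _ :=
  V [⋀^Fin k]→L[ℝ] ℂ

/-- Complex conjugation of forms. -/
def conjForm {k : ℕ} (α : CForm V k) : CForm V k :=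
  (Complex.conjCLE : ℂ →L[ℝ] ℂ).compContinuousAlternatingMap α

/-- Real part of a form (again regarded as a complex-valued form). -/
def reForm {k : ℕ} (α : CForm V k) : CForm V k := (1 / 2 : ℂ) • (α + conjForm α)

/-- Imaginary part of a form (again regarded as a complex-valued form). -/
def imForm {k : ℕ} (α : CForm V k) : CForm V k :=
  (1 / (2 * Complex.I) : ℂ) • (α - conjForm α)

/-- The multilinear map `(v₁, …, v_{k+l}) ↦ α (v₁, …, v_k) * β (v_{k+1}, …, v_{k+l})`. -/
def tensorForm {k l : ℕ} (α : CForm V k) (β : CForm V l) :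
    ContinuousMultilinearMap ℝ (fun _ : Fin (k + l) => V) ℂ where
  toFun v := α (fun i => v (Fin.castAdd l i)) * β (fun j => v (Fin.natAdd k j))
  map_update_add' := by
    intro dec v i x y
    refine Fin.addCases (fun i => ?_) (fun j => ?_) i
    · have h1 : ∀ z, (fun a => Function.update v (Fin.castAdd l i) z (Fin.castAdd l a))
          = Function.update (fun a => v (Fin.castAdd l a)) i z := fun z =>
        Function.update_comp_eq_of_injective v (Fin.castAdd_injective k l) i z
      have h2 : ∀ z, (fun b => Function.update v (Fin.castAdd l i) z (Fin.natAdd k b))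
          = fun b => v (Fin.natAdd k b) := fun z => by
        funext b
        exact Function.update_of_ne (by simp [Fin.ext_iff]; omega) _ _
      simp only [h1, h2, ContinuousAlternatingMap.map_update_add, add_mul]
    · have h1 : ∀ z, (fun b => Function.update v (Fin.natAdd k j) z (Fin.natAdd k b))
          = Function.update (fun b => v (Fin.natAdd k b)) j z := fun z =>
        Function.update_comp_eq_of_injective v (Fin.natAdd_injective l k) j z
      have h2 : ∀ z, (fun a => Function.update v (Fin.natAdd k j) z (Fin.castAdd l a))
          = fun a => v (Fin.castAdd l a) := fun z => by
        funext a
        exact Function.update_of_ne (by simp [Fin.ext_iff]; omega) _ _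
      simp only [h1, h2, ContinuousAlternatingMap.map_update_add, mul_add]
  map_update_smul' := by
    intro dec v i c x
    refine Fin.addCases (fun i => ?_) (fun j => ?_) i
    · have h1 : ∀ z, (fun a => Function.update v (Fin.castAdd l i) z (Fin.castAdd l a))
          = Function.update (fun a => v (Fin.castAdd l a)) i z := fun z =>
        Function.update_comp_eq_of_injective v (Fin.castAdd_injective k l) i z
      have h2 : ∀ z, (fun b => Function.update v (Fin.castAdd l i) z (Fin.natAdd k b))
          = fun b => v (Fin.natAdd k b) := fun z => by
        funext b
        exact Function.update_of_ne (by simp [Fin.ext_iff]; omega) _ _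
      simp only [h1, h2, ContinuousAlternatingMap.map_update_smul, smul_mul_assoc]
    · have h1 : ∀ z, (fun b => Function.update v (Fin.natAdd k j) z (Fin.natAdd k b))
          = Function.update (fun b => v (Fin.natAdd k b)) j z := fun z =>
        Function.update_comp_eq_of_injective v (Fin.natAdd_injective l k) j z
      have h2 : ∀ z, (fun a => Function.update v (Fin.natAdd k j) z (Fin.castAdd l a))
          = fun a => v (Fin.castAdd l a) := fun z => by
        funext a
        exact Function.update_of_ne (by simp [Fin.ext_iff]; omega) _ _
      simp only [h1, h2, ContinuousAlternatingMap.map_update_smul, mul_smul_comm]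
  cont := by
    refine Continuous.mul (α.cont.comp ?_) (β.cont.comp ?_)
    · exact continuous_pi fun i => continuous_apply _
    · exact continuous_pi fun i => continuous_apply _

/-- The wedge product, normalised so that `α ∧ β` is the sum over `(k,l)`-shuffles
(`(a ∧ b)(v, w) = a v * b w - a w * b v` for one-forms). -/
def wedge {k l : ℕ} (α : CForm V k) (β : CForm V l) : CForm V (k + l) :=
  (1 / ((k.factorial : ℂ) * (l.factorial : ℂ))) •
    ContinuousMultilinearMap.alternatization (tensorForm α β)

/-- Multiplication of vectors by the complex number `z`, where `J` plays the role of `i`. -/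
def cmul (J : V →L[ℝ] V) (z : ℂ) : V →L[ℝ] V :=
  z.re • ContinuousLinearMap.id ℝ V + z.im • J

/-- `α` is of Hodge type `(p,q)` with respect to the complex structure `J`:
`α (z v₁, …, z v_k) = z ^ p * conj z ^ q * α (v₁, …, v_k)` for all complex `z`.
(For `α ≠ 0` this forces `p + q = k`; for `k = 1` it says `α ∘ J = i α`, resp. `α ∘ J = - i α`.) -/
def IsOfType (J : V →L[ℝ] V) {k : ℕ} (p q : ℕ) (α : CForm V k) : Prop :=
  ∀ z : ℂ, α.compContinuousLinearMap (cmul J z) = (z ^ p * (starRingEnd ℂ z) ^ q) • α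

/-- A primitive `(2k+1)`-st root of unity. -/
def rootOfUnity (k : ℕ) : ℂ := Complex.exp (2 * Real.pi * Complex.I / ((2 * k + 1 : ℕ) : ℂ))

/-- The `(r, k - r)`-component of a `k`-form `α` (zero unless `0 ≤ r ≤ k`): the isotypic
projection for the action of the `(2k+1)`-st roots of unity `ζ ^ j` on forms, which acts on
`(r, k - r)`-forms through `ζ ^ (j * (2 * r - k))`. That these components have the right types and
add up to `α` is `isOfType_typePart` and `sum_typePart` below. -/
def typePart (J : V →L[ℝ] V) {k : ℕ} (r : ℤ) (α : CForm V k) : CForm V k :=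
  if 0 ≤ r ∧ r ≤ k then
    (1 / ((2 * k + 1 : ℕ) : ℂ)) • ∑ j ∈ Finset.range (2 * k + 1),
      (rootOfUnity k ^ (-(j : ℤ) * (2 * r - k))) •
        α.compContinuousLinearMap (cmul J (rootOfUnity k ^ j))
  else 0

/-- `f` is a homogeneous polynomial of degree `k` in `z` and `conj z`. -/
def IsHomPoly (k : ℕ) (f : ℂ → ℂ) : Prop :=
  ∃ c : ℕ → ℂ, ∀ z, f z = ∑ p ∈ Finset.range (k + 1), c p * (z ^ p * (starRingEnd ℂ z) ^ (k - p))

theorem IsHomPoly.add {k : ℕ} {f g : ℂ → ℂ} (hf : IsHomPoly k f) (hg : IsHomPoly k g) :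
    IsHomPoly k (fun z => f z + g z) := by
  obtain ⟨c, hc⟩ := hf
  obtain ⟨d, hd⟩ := hg
  refine ⟨fun p => c p + d p, fun z => ?_⟩
  simp only [hc, hd, add_mul, Finset.sum_add_distrib]

theorem IsHomPoly.const_mul {k : ℕ} {f : ℂ → ℂ} (hf : IsHomPoly k f) (a : ℂ) :
    IsHomPoly k (fun z => a * f z) := by
  obtain ⟨c, hc⟩ := hf
  refine ⟨fun p => a * c p, fun z => ?_⟩
  simp only [hc, Finset.mul_sum, mul_assoc]

theorem IsHomPoly.sum {ι : Type*} {k : ℕ} (s : Finset ι) {f : ι → ℂ → ℂ}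
    (hf : ∀ i ∈ s, IsHomPoly k (f i)) : IsHomPoly k (fun z => ∑ i ∈ s, f i z) := by
  classical
  induction s using Finset.induction_on with
  | empty => exact ⟨0, fun z => by simp⟩
  | insert a s ha ih =>
    simp only [Finset.sum_insert ha]
    exact (hf a (Finset.mem_insert_self a s)).add
      (ih fun i hi => hf i (Finset.mem_insert_of_mem hi))

theorem IsHomPoly.id_mul {k : ℕ} {f : ℂ → ℂ} (hf : IsHomPoly k f) :
    IsHomPoly (k + 1) (fun z => z * f z) := by
  obtain ⟨c, hc⟩ := hf
  refine ⟨fun p => if p = 0 then 0 else c (p - 1), fun z => ?_⟩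
  beta_reduce
  rw [Finset.sum_range_succ', hc, Finset.mul_sum]
  simp only [Nat.add_sub_add_right, Nat.add_sub_cancel, if_neg (Nat.succ_ne_zero _), if_true,
    zero_mul, add_zero]
  exact Finset.sum_congr rfl fun p _ => by ring

theorem IsHomPoly.conj_mul {k : ℕ} {f : ℂ → ℂ} (hf : IsHomPoly k f) :
    IsHomPoly (k + 1) (fun z => starRingEnd ℂ z * f z) := by
  obtain ⟨c, hc⟩ := hf
  refine ⟨fun p => if p = k + 1 then 0 else c p, fun z => ?_⟩
  beta_reduce
  rw [Finset.sum_range_succ, hc, Finset.mul_sum]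
  simp only [if_true, zero_mul, add_zero]
  refine Finset.sum_congr rfl fun p hp => ?_
  have hp' : p < k + 1 := Finset.mem_range.1 hp
  rw [if_neg hp'.ne, show k + 1 - p = (k - p) + 1 by omega]
  ring

theorem isHomPoly_re_im (a b : ℕ) :
    IsHomPoly (a + b) (fun z => (z.re : ℂ) ^ a * (z.im : ℂ) ^ b) := by
  induction a with
  | zero =>
    induction b with
    | zero => exact ⟨fun _ => 1, fun z => by simp⟩
    | succ b ih =>
      have h := (ih.id_mul.add (ih.conj_mul.const_mul (-1))).const_mul (1 / (2 * Complex.I))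
      obtain ⟨c, hc⟩ := h
      refine ⟨c, fun z => ?_⟩
      rw [show 0 + (b + 1) = 0 + b + 1 by omega, ← hc]
      beta_reduce
      have e : (z.im : ℂ) = (z - starRingEnd ℂ z) / (2 * Complex.I) := Complex.im_eq_sub_conj z
      rw [pow_succ, e]
      field_simp
      ring
  | succ a ih =>
    have h := (ih.id_mul.add ih.conj_mul).const_mul (1 / 2)
    obtain ⟨c, hc⟩ := h
    refine ⟨c, fun z => ?_⟩
    rw [show a + 1 + b = a + b + 1 by omega, ← hc]
    beta_reduce
    have e : (z.re : ℂ) = (z + starRingEnd ℂ z) / 2 := Complex.re_eq_add_conj z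
    rw [pow_succ, e]
    ring

theorem isHomPoly_cmul (J : V →L[ℝ] V) {k : ℕ} (α : CForm V k) (v : Fin k → V) :
    IsHomPoly k (fun z => α (fun i => cmul J z (v i))) := by
  classical
  have h : ∀ z : ℂ, α (fun i => cmul J z (v i)) = ∑ s : Finset (Fin k),
      α (s.piecewise v fun i => J (v i)) * ((z.re : ℂ) ^ s.card * (z.im : ℂ) ^ (k - s.card)) := by
    intro z
    have h1 : (fun i => cmul J z (v i)) = (fun i => z.re • v i) + fun i => z.im • J (v i) := by
      funext i
      simp [cmul]
    rw [h1, ContinuousAlternatingMap.map_add_univ]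
    refine Finset.sum_congr rfl fun s _ => ?_
    have h2 : s.piecewise (fun i => z.re • v i) (fun i => z.im • J (v i)) =
        fun i => (if i ∈ s then z.re else z.im) • s.piecewise v (fun i => J (v i)) i := by
      funext i
      by_cases hi : i ∈ s <;> simp [hi]
    rw [h2, ContinuousAlternatingMap.map_smul_univ, Finset.prod_ite]
    simp only [Finset.prod_const, Finset.filter_univ_mem, Finset.filter_not,
      ← Finset.compl_eq_univ_sdiff, Finset.card_compl, Fintype.card_fin]
    rw [Complex.real_smul]
    push_cast
    ring
  simp only [h]
  refine IsHomPoly.sum _ fun s _ => IsHomPoly.const_mul ?_ _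
  have hs : s.card ≤ k := by simpa using s.card_le_univ
  simpa [Nat.add_sub_cancel' hs] using isHomPoly_re_im s.card (k - s.card)

theorem coeff_extract {k r : ℕ} (hr : r ≤ k) (F : ℂ → ℂ) (c : ℕ → ℂ)
    (hF : ∀ z, F z = ∑ p ∈ Finset.range (k + 1), c p * (z ^ p * (starRingEnd ℂ z) ^ (k - p))) :
    (1 / ((2 * k + 1 : ℕ) : ℂ)) * ∑ j ∈ Finset.range (2 * k + 1),
      (rootOfUnity k ^ (-(j : ℤ) * (2 * (r : ℤ) - k))) * F (rootOfUnity k ^ j) = c r := by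
  have hn : ((2 * k + 1 : ℕ) : ℂ) ≠ 0 := Nat.cast_ne_zero.2 (by omega)
  have hprim : IsPrimitiveRoot (rootOfUnity k) (2 * k + 1) :=
    Complex.isPrimitiveRoot_exp (2 * k + 1) (by omega)
  set ζ := rootOfUnity k with hζ
  have hζ0 : ζ ≠ 0 := hprim.ne_zero (by omega)
  have hconj : starRingEnd ℂ ζ = ζ⁻¹ :=
    (Complex.inv_eq_conj (hprim.norm'_eq_one (by omega))).symm
  have hterm : ∀ j p : ℕ, p ≤ k → ζ ^ (-(j : ℤ) * (2 * (r : ℤ) - k)) *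
      (c p * ((ζ ^ j) ^ p * (starRingEnd ℂ (ζ ^ j)) ^ (k - p))) =
      c p * (ζ ^ (2 * ((p : ℤ) - r))) ^ j := by
    intro j p hp
    have e : ζ ^ (-(j : ℤ) * (2 * (r : ℤ) - k)) *
        ((ζ ^ j) ^ p * (starRingEnd ℂ (ζ ^ j)) ^ (k - p)) = (ζ ^ (2 * ((p : ℤ) - r))) ^ j := by
      rw [map_pow, hconj, ← zpow_natCast (ζ ^ (2 * ((p : ℤ) - r))) j, ← zpow_mul, inv_pow,
        ← zpow_natCast ζ j, ← zpow_natCast (ζ ^ (j : ℤ)) p, ← zpow_mul, ← zpow_neg,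
        ← zpow_natCast (ζ ^ (-(j : ℤ))) (k - p), ← zpow_mul, ← zpow_add₀ hζ0, ← zpow_add₀ hζ0,
        Nat.cast_sub hp]
      congr 1
      ring
    rw [← e]
    ring
  have horth : ∀ p ∈ Finset.range (k + 1), ∑ j ∈ Finset.range (2 * k + 1),
      c p * (ζ ^ (2 * ((p : ℤ) - r))) ^ j = if p = r then c p * ((2 * k + 1 : ℕ) : ℂ) else 0 := by
    intro p hp
    have hp' : p < k + 1 := Finset.mem_range.1 hp
    split_ifs with h
    · subst h
      simp [mul_comm]
    · rw [← Finset.mul_sum]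
      have hne : ζ ^ (2 * ((p : ℤ) - r)) ≠ 1 := by
        rw [Ne, hprim.zpow_eq_one_iff_dvd]
        rintro ⟨t, ht⟩
        push_cast at ht
        have h1 : t < 1 := by
          by_contra hcon
          nlinarith
        have h2 : -1 < t := by
          by_contra hcon
          nlinarith
        have h3 : t = 0 := by omega
        subst h3
        omega
      have hpow : (ζ ^ (2 * ((p : ℤ) - r))) ^ (2 * k + 1) = 1 := by
        rw [← zpow_natCast, ← zpow_mul, mul_comm, zpow_mul, zpow_natCast, hprim.pow_eq_one,
          one_zpow]
      rw [geom_sum_eq hne, hpow]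
      simp
  have hsum : ∑ j ∈ Finset.range (2 * k + 1),
      (ζ ^ (-(j : ℤ) * (2 * (r : ℤ) - k))) * F (ζ ^ j) = c r * ((2 * k + 1 : ℕ) : ℂ) := by
    simp only [hF, Finset.mul_sum]
    rw [Finset.sum_comm]
    calc _ = ∑ p ∈ Finset.range (k + 1), ∑ j ∈ Finset.range (2 * k + 1),
          c p * (ζ ^ (2 * ((p : ℤ) - r))) ^ j :=
          Finset.sum_congr rfl fun p hp => Finset.sum_congr rfl fun j _ =>
            hterm j p (Nat.lt_succ_iff.1 (Finset.mem_range.1 hp))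
      _ = _ := by
          rw [Finset.sum_congr rfl horth, Finset.sum_ite_eq' (Finset.range (k + 1)) r,
            if_pos (Finset.mem_range.2 (Nat.lt_succ_iff.2 hr))]
  rw [hsum]
  field_simp

theorem typePart_apply (J : V →L[ℝ] V) {k r : ℕ} (hr : r ≤ k) (α : CForm V k) (v : Fin k → V) :
    typePart J (r : ℤ) α v = (1 / ((2 * k + 1 : ℕ) : ℂ)) * ∑ j ∈ Finset.range (2 * k + 1),
      (rootOfUnity k ^ (-(j : ℤ) * (2 * (r : ℤ) - k))) *
        α (fun i => cmul J (rootOfUnity k ^ j) (v i)) := by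
  rw [typePart, if_pos ⟨Int.natCast_nonneg r, by exact_mod_cast hr⟩,
    ContinuousAlternatingMap.smul_apply, ContinuousAlternatingMap.sum_apply]
  rfl

/-- Every form is the sum of its components. -/
theorem sum_typePart (J : V →L[ℝ] V) {k : ℕ} (α : CForm V k) :
    ∑ r ∈ Finset.range (k + 1), typePart J (r : ℤ) α = α := by
  ext v
  obtain ⟨c, hc⟩ := isHomPoly_cmul J α v
  have h1 : α v = α (fun i => cmul J 1 (v i)) := by simp [cmul]
  have h2 := hc 1
  beta_reduce at h2
  rw [h1, h2, ContinuousAlternatingMap.sum_apply]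
  refine Finset.sum_congr rfl fun r hr => ?_
  have hr' : r ≤ k := Nat.lt_succ_iff.1 (Finset.mem_range.1 hr)
  rw [typePart_apply J hr', coeff_extract hr' _ c hc]
  simp

/-- The components of a form have the expected types. -/
theorem isOfType_typePart (J : V →L[ℝ] V) (sq : ∀ v, J (J v) = -v) {k r : ℕ} (hr : r ≤ k)
    (α : CForm V k) : IsOfType J r (k - r) (typePart J (r : ℤ) α) := by
  intro w
  ext v
  obtain ⟨c, hc⟩ := isHomPoly_cmul J α v
  have hmul : ∀ (z : ℂ) (u : V), cmul J z (cmul J w u) = cmul J (z * w) u := by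
    intro z u
    simp only [cmul, add_apply, FunLike.coe_smul, Pi.smul_apply,
      ContinuousLinearMap.coe_id', id_eq, map_add, map_smul, sq, Complex.mul_re, Complex.mul_im]
    module
  rw [ContinuousAlternatingMap.compContinuousLinearMap_apply, ContinuousAlternatingMap.smul_apply,
    typePart_apply J hr, typePart_apply J hr, coeff_extract hr _ c hc,
    coeff_extract hr (fun z => α fun i => cmul J z ((⇑(cmul J w) ∘ v) i))
      (fun p => (w ^ p * (starRingEnd ℂ w) ^ (k - p)) * c p)]
  · rfl
  · intro z
    simp only [Function.comp_apply, hmul]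
    have h2 := hc (z * w)
    beta_reduce at h2
    rw [h2]
    refine Finset.sum_congr rfl fun p _ => ?_
    rw [map_mul, mul_pow, mul_pow]
    ring

/-- A form of pure type is its own component of that type. -/
theorem typePart_of_isOfType (J : V →L[ℝ] V) {k r : ℕ} (hr : r ≤ k) (α : CForm V k)
    (hα : IsOfType J r (k - r) α) : typePart J (r : ℤ) α = α := by
  ext v
  rw [typePart_apply J hr, coeff_extract hr (fun z => α fun i => cmul J z (v i))
    (fun p => if p = r then α v else 0)]
  · simp
  · intro z
    have h := congrArg (fun β : CForm V k => β v) (hα z)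
    simp only [ContinuousAlternatingMap.smul_apply] at h
    have h' : (α fun i => cmul J z (v i)) = (z ^ r * (starRingEnd ℂ z) ^ (k - r)) • α v := h
    rw [h', Finset.sum_eq_single_of_mem r (Finset.mem_range.2 (Nat.lt_succ_iff.2 hr))
      fun p _ hp => by rw [if_neg hp, zero_mul], if_pos rfl, smul_eq_mul, mul_comm]

/-- The fundamental two-form `ω (v, w) = g (J v, w)` of a Hermitian structure `(g, J)`. -/
def hermForm [T2Space V] [FiniteDimensional ℝ V] (g : V →L[ℝ] V →L[ℝ] ℝ) (J : V →L[ℝ] V)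
    (symm : ∀ v w, g v w = g w v) (sq : ∀ v, J (J v) = -v)
    (isom : ∀ v w, g (J v) (J w) = g v w) : CForm V 2 where
  toFun v := ((g (J (v 0)) (v 1) : ℝ) : ℂ)
  map_update_add' := by
    intro dec v i x y
    rw [Subsingleton.elim dec (instDecidableEqFin 2)]
    fin_cases i <;> simp
  map_update_smul' := by
    intro dec v i c x
    rw [Subsingleton.elim dec (instDecidableEqFin 2)]
    fin_cases i <;> simp
  cont := by
    have : Continuous fun v : Fin 2 → V => g (J (v 0)) (v 1) := by
      have hb : ∀ v : Fin 2 → V, g (J (v 0)) (v 1) =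
          ∑ i, (Module.finBasis ℝ V).coord i (v 1) * g (J (v 0)) (Module.finBasis ℝ V i) := by
        intro v
        have h := congrArg (g (J (v 0))) ((Module.finBasis ℝ V).sum_repr (v 1))
        rw [map_sum] at h
        simpa using h.symm
      simp only [hb]
      refine continuous_finsetSum _ fun i _ => Continuous.mul ?_ ?_
      · exact (LinearMap.continuous_of_finiteDimensional _).comp (continuous_apply 1)
      · let f : V →ₗ[ℝ] ℝ :=
          { toFun := fun u => g (J u) (Module.finBasis ℝ V i)
            map_add' := fun u w => by simp
            map_smul' := fun c u => by simp }
        exact (LinearMap.continuous_of_finiteDimensional f).comp (continuous_apply 0)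
    exact Complex.continuous_ofReal.comp this
  map_eq_zero_of_eq' := by
    intro v i j hij hne
    have key : ∀ u, g (J u) u = 0 := fun u => by
      have h1 := isom (J u) u
      rw [sq, map_neg, neg_apply, symm] at h1
      linarith
    have h01 : v 0 = v 1 := by
      fin_cases i <;> fin_cases j <;> simp_all
    simp only [h01, key, Complex.ofReal_zero]

/-- The volume form `w ∧ w ∧ w / 3!` of a Hermitian structure with fundamental form `w` in real
dimension six. -/
def volForm (w : CForm V 2) : CForm V 6 := (1 / 6 : ℂ) • wedge (wedge w w) w

/-- Insertion of `u` into the first `k` slots: `v ↦ τ (u, v)`. -/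
def insertFirst {k l n : ℕ} (h : k + l = n) (τ : CForm V n) (u : Fin k → V) : CForm V l where
  toFun v := τ (fun a => Fin.append u v (Fin.cast h.symm a))
  map_update_add' := by
    subst h
    intro dec v j x y
    have h1 : ∀ z, (fun a => Fin.append u (Function.update v j z) (Fin.cast rfl a))
        = Function.update (Fin.append u v) (Fin.natAdd k j) z := fun z => by
      funext a
      refine Fin.addCases (fun a => ?_) (fun a => ?_) a
      · simp only [Fin.cast_eq_self, Fin.append_left]
        rw [Function.update_of_ne (by simp [Fin.ext_iff]; omega), Fin.append_left]
      · by_cases haj : a = j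
        · subst haj; simp
        · simp [haj]
    simp only [h1, ContinuousAlternatingMap.map_update_add]
  map_update_smul' := by
    subst h
    intro dec v j c x
    have h1 : ∀ z, (fun a => Fin.append u (Function.update v j z) (Fin.cast rfl a))
        = Function.update (Fin.append u v) (Fin.natAdd k j) z := fun z => by
      funext a
      refine Fin.addCases (fun a => ?_) (fun a => ?_) a
      · simp only [Fin.cast_eq_self, Fin.append_left]
        rw [Function.update_of_ne (by simp [Fin.ext_iff]; omega), Fin.append_left]
      · by_cases haj : a = j
        · subst haj; simp
        · simp [haj]
    simp only [h1, ContinuousAlternatingMap.map_update_smul]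
  cont := by
    subst h
    refine τ.cont.comp (continuous_pi fun a => ?_)
    refine Fin.addCases (fun a => ?_) (fun a => ?_) a
    · simpa using continuous_const
    · simpa using continuous_apply a
  map_eq_zero_of_eq' := by
    subst h
    intro v i j hij hne
    refine τ.map_eq_zero_of_eq _ (i := Fin.natAdd k i) (j := Fin.natAdd k j) ?_ ?_
    · simpa using hij
    · simpa using hne

/-- The (conjugate-linear) Hodge star of a `k`-form `β` on an oriented Euclidean six-space with
metric `g` and volume form `vol`, in terms of an arbitrary basis `b` of the space:
`(⋆β)(v) = (1 / k!) ∑ g^{i₁ j₁} ⋯ g^{i_k j_k} conj (β (b_{j₁}, …, b_{j_k})) vol (b_{i₁}, …, b_{i_k}, v)`.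
Equivalently, `α ∧ ⋆β = ⟨α, β⟩ vol` for the induced Hermitian product on `k`-forms. -/
def hodgeStar (b : Module.Basis (Fin 6) ℝ V) (g : V →L[ℝ] V →L[ℝ] ℝ) (vol : CForm V 6)
    {k l : ℕ} (h : k + l = 6) (β : CForm V k) : CForm V l :=
  (1 / (k.factorial : ℂ)) • ∑ i : Fin k → Fin 6, ∑ j : Fin k → Fin 6,
    (((∏ a, (Matrix.of fun r s => g (b r) (b s))⁻¹ (i a) (j a) : ℝ) : ℂ) *
      starRingEnd ℂ (β fun a => b (j a))) • insertFirst h vol (fun a => b (i a))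

end Algebra

/-! ### Forms on six-manifolds and the de Rham differential -/

/-- The model space of six-manifolds. -/
abbrev E6 : Type := EuclideanSpace ℝ (Fin 6)

section Manifold

variable {M : Type*} [TopologicalSpace M] [ChartedSpace E6 M]

/-- Complex differential forms of degree `k` on `M` (smoothness is `IsSmoothForm`). -/
abbrev DForm (M : Type*) [TopologicalSpace M] [ChartedSpace E6 M] (k : ℕ) : Type _ :=
  ∀ x : M, CForm (TangentSpace (𝓡 6) x) k

/-- Elements of the graded space of complex differential forms: one form in each degree. -/
abbrev MForm (M : Type*) [TopologicalSpace M] [ChartedSpace E6 M] : Type _ :=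
  ∀ k : ℕ, DForm M k

/-- The expression of a form in the chart around `x₀`: its pullback under the inverse chart. -/
def inChart {k : ℕ} (η : DForm M k) (x₀ : M) : E6 → E6 [⋀^Fin k]→L[ℝ] ℂ := fun y =>
  (η ((extChartAt (𝓡 6) x₀).symm y)).compContinuousLinearMap
    (mfderiv 𝓘(ℝ, E6) (𝓡 6) (extChartAt (𝓡 6) x₀).symm y)

/-- A differential form is smooth if it is smooth in every chart. -/
def IsSmoothForm {k : ℕ} (η : DForm M k) : Prop :=
  ∀ x₀ : M, ContDiffOn ℝ ∞ (inChart η x₀) (extChartAt (𝓡 6) x₀).target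

/-- The de Rham differential, computed at `x` in the chart around `x`. -/
def deRham {k : ℕ} (η : DForm M k) : DForm M (k + 1) := fun x =>
  (extDeriv (inChart η x) (extChartAt (𝓡 6) x x)).compContinuousLinearMap
    (mfderiv (𝓡 6) 𝓘(ℝ, E6) (extChartAt (𝓡 6) x) x)

/-- The supercommutator of two operators of odd degree on differential forms. -/
def anticomm (A B : MForm M → MForm M) : MForm M → MForm M := fun η => A (B η) + B (A η)

variable [IsManifold (𝓡 6) ∞ M]

/-- An almost complex Hermitian structure on a six-manifold. -/
structure AlmostHermitian (M : Type*) [TopologicalSpace M] [ChartedSpace E6 M]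
    [IsManifold (𝓡 6) ∞ M] where
  /-- the Riemannian metric -/
  g : Bundle.ContMDiffRiemannianMetric (𝓡 6) ∞ E6 (fun x : M => TangentSpace (𝓡 6) x)
  /-- the almost complex structure -/
  J : ∀ x : M, TangentSpace (𝓡 6) x →L[ℝ] TangentSpace (𝓡 6) x
  J_smooth : ContMDiff (𝓡 6) ((𝓡 6).prod 𝓘(ℝ, E6 →L[ℝ] E6)) ∞
    (fun x => Bundle.TotalSpace.mk' (E6 →L[ℝ] E6)
      (E := fun x : M => TangentSpace (𝓡 6) x →L[ℝ] TangentSpace (𝓡 6) x) x (J x))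
  J_sq : ∀ x v, J x (J x v) = -v
  J_isometry : ∀ x v w, g.inner x (J x v) (J x w) = g.inner x v w

namespace AlmostHermitian

variable (H : AlmostHermitian M)

/-- The Hermitian form `ω (v, w) = g (J v, w)`. -/
def omega : DForm M 2 := fun x =>
  haveI : T2Space (TangentSpace (𝓡 6) x) := inferInstanceAs (T2Space E6)
  haveI : FiniteDimensional ℝ (TangentSpace (𝓡 6) x) := inferInstanceAs (FiniteDimensional ℝ E6)
  hermForm (H.g.inner x) (H.J x) (H.g.symm x) (H.J_sq x) (H.J_isometry x)

/-- The conjugate-linear Hodge star operator on differential forms. -/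
def star (η : MForm M) : MForm M := fun l x =>
  if h : l ≤ 6 then
    hodgeStar (V := TangentSpace (𝓡 6) x) (EuclideanSpace.basisFun (Fin 6) ℝ).toBasis
      (H.g.inner x) (volForm (H.omega x)) (Nat.sub_add_cancel h) (η (6 - l) x)
  else 0

/-- The component `d^{i, 1 - i}` of the de Rham differential, i.e. the operator mapping
`(p, q)`-forms `η` to the `(p + i, q + 1 - i)`-component of `d η`. -/
def dPart (i : ℤ) (η : MForm M) : MForm M
  | 0 => 0
  | k + 1 => fun x => ∑ p ∈ Finset.range (k + 1),
      typePart (H.J x) (p + i) (deRham (fun y => typePart (H.J y) (p : ℤ) (η k y)) x)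

/-- `N = d^{2,-1}` -/
def N : MForm M → MForm M := H.dPart 2

/-- `∂ = d^{1,0}` -/
def del : MForm M → MForm M := H.dPart 1

/-- `∂̄ = d^{0,1}` -/
def delbar : MForm M → MForm M := H.dPart 0

/-- `N̄ = d^{-1,2}` -/
def Nbar : MForm M → MForm M := H.dPart (-1)

/-- The (formal) Hermitian adjoint `D* = - ⋆ D ⋆` of an operator `D` of degree one, with `⋆` the
conjugate-linear Hodge star. -/
def adj (D : MForm M → MForm M) : MForm M → MForm M := fun η => -H.star (D (H.star η))

/-- The nearly Kähler condition for the Hermitian structure `H`, the `(3,0)`-form `Ω` and the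
constant `lam`: `d ω = 3 lam Re Ω` and `d Im Ω = - 2 lam ω ∧ ω`.
Differentiating `ω ∧ Im Ω = 0` shows that the two equations force
`ω³ / 6 = Re Ω ∧ Im Ω / 4`; so `Ω` is nowhere zero, and at each point there are `(1,0)`-forms
`ξ₁, ξ₂, ξ₃` with `ω = (i/2) ∑ ξ_j ∧ conj ξ_j` and `Ω = ξ₁ ∧ ξ₂ ∧ ξ₃`. -/
structure IsNearlyKahler (Ω : DForm M 3) (lam : ℝ) : Prop where
  lam_ne_zero : lam ≠ 0
  smooth : IsSmoothForm Ω
  type : ∀ x, IsOfType (H.J x) 3 0 (Ω x)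
  d_omega : ∀ x, deRham H.omega x = (3 * lam : ℂ) • reForm (Ω x)
  d_im : ∀ x, deRham (fun y => imForm (Ω y)) x =
    (-2 * lam : ℂ) • wedge (H.omega x) (H.omega x)

end AlmostHermitian

end Manifold

end NK

end

open scoped Manifold ContDiff
open NK

/-!
The proof compares the contraction `T` with the Kähler form to the components of `d`.

Near a point, a smooth unitary frame of the tangent bundle (`nonempty_localFrame`) identifies
forms with functions into the exterior algebra of the model space `V0 = ℂ ^ 3`. With `ε_b` and
`ι_b` the exterior and interior multiplications by the complex coframe and frame, the de Rham
differential reads `d f = ∑ ε_b ∂_b f + ∑ Γ_{bca} ε_b ε_c ι_a f` (`extDeriv_frame`), and its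
component of bidegree `(m, 1 - m)` consists of the terms of weight `m`, namely `symb m` and
`conn Γ m` (`LocalFrame.val_dPart`). Operators such as `T`, the Hodge star operator `⋆` and complex
conjugation have constant coefficients in such frames.

The nearly Kähler equations enter only through the coefficients `Γ` at one point. The equation
`dω = 3λ Re Ω` has no component of type `(2, 1)`, so `conn Γ 1` annihilates `ω`
(`LocalFrame.conn_one_kahler`). The equations give `dΩ = -2iλ ω ∧ ω`, whose component of type
`(2, 2)` is `N̄ Ω`; hence the coefficients of `N̄` form a multiple of the totally skew tensor of
`ℂ ^ 3` (`LocalFrame.exists_torsion`). Exterior algebra over the model then yields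
`[T, ∂] = ∂̄*` and `[T, N] = 2 N̄*` (`lam0_bidegree_one`, `lam0_bidegree_two`), and complex
conjugation gives `[T, ∂̄] = -∂*` and `[T, N̄] = -2 N*`.

What remains is algebra in the ring of additive operators on smooth forms (`acE_identities`).
The components of `d ^ 2 = 0` give `{N, ∂} = 0`, `{N̄, ∂̄} = 0` and `{N, ∂̄} + ∂ ^ 2 = 0`.
The commutators of `T` with these are linear relations among the anticommutators in question, and
conjugating with `⋆` and with complex conjugation gives further ones, because `⋆ {A*, B} ⋆`
equals `{A, B*}` up to the sign `⋆ ^ 2` (`star_acE_star`). The first two components give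
`2 {N̄*, ∂} + {N, ∂̄*} = 0` and `2 {N*, ∂̄} + {N̄, ∂*} = 0`. Conjugation with `⋆` turns the former
into `2 {N̄, ∂*} + {N*, ∂̄} = 0`; together with the latter this makes all four terms vanish. The
third component gives `{∂̄*, ∂} + 2 {N̄*, ∂̄} - {N, ∂*} = 0`, and conjugation gives the same
relation with `{N̄*, ∂̄}` and `{N, ∂*}` exchanged.
-/


open scoped Manifold ContDiff
open NK

noncomputable section

namespace NK

/-! ### Exterior and interior multiplication -/

section Clifford

variable {E : Type*} [NormedAddCommGroup E] [NormedSpace ℝ E]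

/-- Exterior multiplication `α ∧ ·` by a complex covector, from `k`-forms to `(k+1)`-forms. -/
def epsForm {k : ℕ} (α : E →L[ℝ] ℂ) : CForm E k →ₗ[ℂ] CForm E (k + 1) where
  toFun f := ContinuousAlternatingMap.alternatizeUncurryFin (α.smulRight f)
  map_add' f g := by
    rw [← ContinuousAlternatingMap.alternatizeUncurryFin_add]; congr 1; ext; simp
  map_smul' c f := by
    rw [RingHom.id_apply, ← ContinuousAlternatingMap.alternatizeUncurryFin_smul]
    congr 1; ext; simp [mul_left_comm]

theorem epsForm_apply {k : ℕ} (α : E →L[ℝ] ℂ) (f : CForm E k) (v : Fin (k + 1) → E) :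
    epsForm α f v = ∑ i : Fin (k + 1), (-1) ^ (i : ℕ) * (α (v i) * f (i.removeNth v)) := by
  simp [epsForm, ContinuousAlternatingMap.alternatizeUncurryFin_apply]

/-- Interior multiplication by a vector, inserted into the first slot. -/
def iotaForm {k : ℕ} (x : E) : CForm E (k + 1) →ₗ[ℂ] CForm E k where
  toFun f := f.curryLeft x
  map_add' f g := by ext; simp
  map_smul' c f := by ext; simp

@[simp]
theorem iotaForm_apply {k : ℕ} (x : E) (f : CForm E (k + 1)) (v : Fin k → E) :
    iotaForm x f v = f (Matrix.vecCons x v) := rfl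

theorem removeNth_succ_vecCons {E : Type*} {k : ℕ} (x : E) (v : Fin (k + 1) → E) (i : Fin (k + 1)) :
    i.succ.removeNth (Matrix.vecCons x v : Fin (k + 2) → E) =
      Matrix.vecCons x (i.removeNth v) := by
  funext j
  refine Fin.cases ?_ (fun j => ?_) j <;> simp [Fin.removeNth]

theorem iotaForm_epsForm {k : ℕ} (x : E) (α : E →L[ℝ] ℂ) (f : CForm E (k + 1)) :
    iotaForm x (epsForm α f) + epsForm α (iotaForm x f) = α x • f := by
  ext v
  simp only [ContinuousAlternatingMap.add_apply, iotaForm_apply, epsForm_apply,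
    ContinuousAlternatingMap.smul_apply]
  rw [Fin.sum_univ_succ]
  simp only [removeNth_succ_vecCons, Matrix.cons_val_zero, Matrix.cons_val_succ, Fin.val_succ,
    Fin.val_zero, pow_zero, one_mul, pow_succ]
  have : (Fin.removeNth 0 (Matrix.vecCons x v : Fin (k + 2) → E)) = v := by
    funext j; simp [Fin.removeNth]
  rw [this, add_assoc, ← Finset.sum_add_distrib, smul_eq_mul]
  simp

theorem iotaForm_epsForm_zero (x : E) (α : E →L[ℝ] ℂ) (f : CForm E 0) :
    iotaForm x (epsForm α f) = α x • f := by
  ext v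
  simp [epsForm_apply, Subsingleton.elim _ v]

theorem eq_zero_of_iotaForm {k : ℕ} {f : CForm E (k + 1)} (h : ∀ x, iotaForm x f = 0) :
    f = 0 := by
  ext v
  have := congrArg (fun g : CForm E k => g (Fin.tail v)) (h (v 0))
  simp only [iotaForm_apply] at this
  have e : v = Matrix.vecCons (v 0) (Fin.tail v) := (Fin.cons_self_tail v).symm
  rw [e, this]
  rfl

theorem cform_smul_zero {k : ℕ} (c : ℂ) : c • (0 : CForm E k) = 0 := by ext v; simp

theorem cform_zero_smul {k : ℕ} (f : CForm E k) : (0 : ℂ) • f = 0 := by ext v; simp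

theorem cform_neg_smul {k : ℕ} (c : ℂ) (f : CForm E k) : (-c) • f = -(c • f) := by ext v; simp

theorem cform_add_smul {k : ℕ} (c d : ℂ) (f : CForm E k) : (c + d) • f = c • f + d • f := by
  ext v; simp [add_mul]

variable (E) in
/-- The graded space of complex-valued alternating forms: one form in each degree. -/
def Forms : Type _ := ∀ k : ℕ, CForm E k

instance : AddCommGroup (Forms E) := inferInstanceAs (AddCommGroup (∀ k : ℕ, CForm E k))

instance : Module ℂ (Forms E) := inferInstanceAs (Module ℂ (∀ k : ℕ, CForm E k))

namespace Forms

@[ext] theorem ext {f g : Forms E} (h : ∀ k, f k = g k) : f = g := funext h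

@[simp] theorem zero_deg (k : ℕ) : (0 : Forms E) k = 0 := rfl

@[simp] theorem add_deg (f g : Forms E) (k : ℕ) : (f + g) k = f k + g k := rfl

@[simp] theorem sub_deg (f g : Forms E) (k : ℕ) : (f - g) k = f k - g k := rfl

@[simp] theorem neg_deg (f : Forms E) (k : ℕ) : (-f) k = -f k := rfl

@[simp] theorem smul_deg (c : ℂ) (f : Forms E) (k : ℕ) : (c • f) k = c • f k := rfl

theorem sum_deg {ι : Type*} (s : Finset ι) (f : ι → Forms E) (k : ℕ) :
    (∑ i ∈ s, f i) k = ∑ i ∈ s, f i k := by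
  classical
  induction s using Finset.induction_on with
  | empty => rfl
  | insert a s ha ih => rw [Finset.sum_insert ha, Finset.sum_insert ha, add_deg, ih]

end Forms

/-- Exterior multiplication by a complex covector on the graded space of forms. -/
def eps (α : E →L[ℝ] ℂ) : Module.End ℂ (Forms E) where
  toFun f
    | 0 => (0 : CForm E 0)
    | k + 1 => epsForm α (f k)
  map_add' f g := by
    ext1 k
    cases k
    · exact (add_zero (0 : CForm E 0)).symm
    · exact map_add (epsForm α) _ _
  map_smul' c f := by
    ext1 k
    cases k
    · exact (smul_zero (A := CForm E 0) c).symm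
    · exact map_smul (epsForm α) _ _

/-- Interior multiplication by a vector on the graded space of forms. -/
def iota (x : E) : Module.End ℂ (Forms E) where
  toFun f k := iotaForm x (f (k + 1))
  map_add' f g := by ext1 k; exact map_add (iotaForm x) _ _
  map_smul' c f := by ext1 k; exact map_smul (iotaForm x) _ _

@[simp] theorem eps_zero_deg (α : E →L[ℝ] ℂ) (f : Forms E) : eps α f 0 = 0 := rfl

@[simp] theorem eps_succ (α : E →L[ℝ] ℂ) (f : Forms E) (k : ℕ) :
    eps α f (k + 1) = epsForm α (f k) := rfl

@[simp] theorem iota_deg (x : E) (f : Forms E) (k : ℕ) : iota x f k = iotaForm x (f (k + 1)) := rfl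

theorem iota_eps (x : E) (α : E →L[ℝ] ℂ) :
    iota x * eps α + eps α * iota x = α x • (1 : Module.End ℂ (Forms E)) := by
  ext1 f
  ext1 k
  cases k with
  | zero => simpa using iotaForm_epsForm_zero x α (f 0)
  | succ k => simpa using iotaForm_epsForm x α (f (k + 1))

theorem iota_mul_eps (x : E) (α : E →L[ℝ] ℂ) :
    iota x * eps α = α x • (1 : Module.End ℂ (Forms E)) - eps α * iota x := by
  rw [← iota_eps x α, add_sub_cancel_right]

theorem iotaForm_swap {k : ℕ} (x y : E) (f : CForm E (k + 1 + 1)) :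
    iotaForm x (iotaForm y f) = -iotaForm y (iotaForm x f) := by
  ext v
  simp only [ContinuousAlternatingMap.neg_apply, iotaForm_apply]
  have := f.toAlternatingMap.map_swap (Matrix.vecCons x (Matrix.vecCons y v))
    (i := 0) (j := 1) (by simp)
  have e : (Matrix.vecCons x (Matrix.vecCons y v) : Fin (k + 2) → E) ∘ ⇑(Equiv.swap 0 1) =
      Matrix.vecCons y (Matrix.vecCons x v) := by
    funext j
    refine Fin.cases ?_ (fun j => Fin.cases ?_ (fun j => ?_) j) j
    · simp
    · simp
    · have h2 : Equiv.swap (0 : Fin (k + 2)) 1 j.succ.succ = j.succ.succ :=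
        Equiv.swap_apply_of_ne_of_ne (by simp [Fin.ext_iff]) (by simp [Fin.ext_iff])
      simp [h2]
  rw [e] at this
  exact this

theorem iota_iota (x y : E) : iota x * iota y + iota y * iota x = 0 := by
  ext1 f
  ext1 k
  simp only [LinearMap.add_apply, Module.End.mul_apply, Forms.add_deg, iota_deg]
  rw [iotaForm_swap]
  exact neg_add_cancel _

/-- An endomorphism commuting with all interior multiplications and vanishing in degree zero
vanishes. -/
theorem eq_zero_of_commute_iota {X : Module.End ℂ (Forms E)}
    (h : ∀ x, iota x * X = X * iota x) (h0 : ∀ f, X f 0 = 0) : X = 0 := by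
  have : ∀ k f, X f k = 0 := by
    intro k
    induction k with
    | zero => exact h0
    | succ k ih =>
      intro f
      refine eq_zero_of_iotaForm fun x => ?_
      have := congrArg (fun g : Forms E => g k) (LinearMap.congr_fun (h x) f)
      simpa [ih] using this
  ext1 f
  ext1 k
  exact this k f

theorem eps_eps (α β : E →L[ℝ] ℂ) : eps α * eps β + eps β * eps α = 0 := by
  refine eq_zero_of_commute_iota (fun x => ?_) fun f => by simp
  have ha := iota_mul_eps x α
  have hb := iota_mul_eps x β
  calc iota x * (eps α * eps β + eps β * eps α)
      = (iota x * eps α) * eps β + (iota x * eps β) * eps α := by noncomm_ring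
    _ = α x • eps β - eps α * (iota x * eps β) + (β x • eps α - eps β * (iota x * eps α)) := by
        rw [ha, hb]; simp only [sub_mul, smul_mul_assoc, one_mul, mul_assoc, ha, hb]
    _ = (eps α * eps β + eps β * eps α) * iota x := by
        rw [ha, hb]; simp only [mul_sub, mul_smul_comm, mul_one, add_mul, mul_assoc]; abel

theorem iota_add (x y : E) : iota (x + y) = iota x + iota y := by
  ext1 f
  ext1 k
  ext v
  simpa using (f (k + 1)).vecCons_add v x y

theorem iota_smul (c : ℝ) (x : E) : iota (c • x) = (c : ℂ) • iota x := by
  ext1 f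
  ext1 k
  ext v
  rw [LinearMap.smul_apply, Forms.smul_deg]
  simpa using (f (k + 1)).vecCons_smul v c x

end Clifford

/-! ### The model Hermitian space -/

/-- The model Hermitian space `ℂ³`. -/
abbrev V0 : Type := Fin 3 → ℂ

/-- Indices of the complex coframe of the model: `(j, false)` stands for the `(1,0)`-form `dz_j`
and `(j, true)` for its conjugate. The same type indexes the real orthonormal basis
`e_j, i e_j`. -/
abbrev Idx : Type := Fin 3 × Bool

/-- The index of the complex conjugate covector. -/
def bar (b : Idx) : Idx := (b.1, !b.2)

@[simp] theorem bar_false (j : Fin 3) : bar (j, false) = (j, true) := rfl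
@[simp] theorem bar_true (j : Fin 3) : bar (j, true) = (j, false) := rfl
@[simp] theorem bar_bar (b : Idx) : bar (bar b) = b := by simp [bar]

/-- The complex coframe `dz_j, conj dz_j`. -/
def theta : Idx → (V0 →L[ℝ] ℂ)
  | (j, false) => ContinuousLinearMap.proj j
  | (j, true) => (Complex.conjCLE : ℂ →L[ℝ] ℂ).comp (ContinuousLinearMap.proj j)

@[simp] theorem theta_false (j : Fin 3) (v : V0) : theta (j, false) v = v j := rfl
@[simp] theorem theta_true (j : Fin 3) (v : V0) :
    theta (j, true) v = starRingEnd ℂ (v j) := rfl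

theorem theta_bar (b : Idx) (v : V0) : theta (bar b) v = starRingEnd ℂ (theta b v) := by
  obtain ⟨j, _ | _⟩ := b <;> simp

/-- The real orthonormal basis `e_j = rb (j, false)`, `i e_j = rb (j, true)` of the model. -/
def rb : Idx → V0
  | (j, false) => Pi.single j 1
  | (j, true) => Pi.single j Complex.I

/-- The sign with which `i • Φ (i e_j)` enters the value of `Φ` on the dual vector of `theta b`. -/
def sgnI : Idx → ℂ
  | (_, false) => -Complex.I
  | (_, true) => Complex.I

/-- The complex-linear extension of `Φ`, evaluated at the vector `½ (e_j ∓ i · i e_j)` of the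
complex frame dual to `theta`. -/
def cval {F : Type*} [AddCommGroup F] [Module ℂ F] (Φ : V0 → F) (b : Idx) : F :=
  (1 / 2 : ℂ) • (Φ (rb (b.1, false)) + sgnI b • Φ (rb (b.1, true)))

/-- A real-linear map is recovered from its values on the complex frame. -/
theorem sum_theta_cval {F : Type*} [AddCommGroup F] [Module ℂ F] (Φ : V0 →+ F)
    (hΦ : ∀ (c : ℝ) v, Φ (c • v) = (c : ℂ) • Φ v) (v : V0) :
    ∑ b, theta b v • cval Φ b = Φ v := by
  have hv : v = ∑ j, ((v j).re • rb (j, false) + (v j).im • rb (j, true)) := by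
    funext k
    simp only [rb, Finset.sum_apply, Pi.add_apply, Pi.smul_apply, Pi.single_apply, smul_ite,
      smul_zero, Finset.sum_add_distrib, Finset.sum_ite_eq, Finset.mem_univ, if_true]
    simp [Complex.re_add_im]
  conv_rhs => rw [hv, map_sum]
  rw [Fintype.sum_prod_type]
  refine Finset.sum_congr rfl fun j _ => ?_
  have hre : (((v j).re : ℝ) : ℂ) = (1 / 2 : ℂ) * (v j + starRingEnd ℂ (v j)) := by
    rw [Complex.re_eq_add_conj]; ring
  have him : (((v j).im : ℝ) : ℂ) = (1 / 2 : ℂ) * (-Complex.I * (v j - starRingEnd ℂ (v j))) := by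
    rw [Complex.im_eq_sub_conj]; field_simp; rw [Complex.I_sq]; ring
  rw [map_add, hΦ, hΦ, hre, him]
  simp only [Fintype.sum_bool, theta_false, theta_true, cval, sgnI]
  module

/-- Exterior multiplication by `theta b`. -/
def εc (b : Idx) : Module.End ℂ (Forms V0) := eps (theta b)

/-- Interior multiplication by the complex frame vector dual to `theta b`. -/
def ιc (b : Idx) : Module.End ℂ (Forms V0) := cval iota b

theorem ιc_εc (a b : Idx) (f : Forms V0) :
    ιc a (εc b f) = (if a = b then f else 0) - εc b (ιc a f) := by
  have h : ιc a * εc b + εc b * ιc a = (if a = b then (1 : ℂ) else 0) • 1 := by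
    have h1 : ιc a * εc b + εc b * ιc a =
        (cval (fun x => theta b x) a) • (1 : Module.End ℂ (Forms V0)) := by
      simp only [ιc, cval, εc]
      have := iota_eps (rb (a.1, false)) (theta b)
      have := iota_eps (rb (a.1, true)) (theta b)
      simp only [smul_mul_assoc, add_mul, mul_smul_comm, mul_add, iota_mul_eps]
      module
    rw [h1]
    congr 1
    obtain ⟨j, _ | _⟩ := a <;> obtain ⟨k, _ | _⟩ := b <;> rcases eq_or_ne j k with rfl | hjk
    all_goals first
      | simp [cval, sgnI, rb, hjk, hjk.symm]
      | (simp [cval, sgnI, rb]; done)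
      | (simp [cval, sgnI, rb]; norm_num)
  have h2 := LinearMap.congr_fun h f
  simp only [LinearMap.add_apply, Module.End.mul_apply, LinearMap.smul_apply,
    Module.End.one_apply] at h2
  rw [eq_sub_iff_add_eq, h2]
  split_ifs <;> simp

theorem εc_εc (a b : Idx) (f : Forms V0) : εc a (εc b f) = -εc b (εc a f) := by
  have h := LinearMap.congr_fun (eps_eps (theta a) (theta b)) f
  exact eq_neg_of_add_eq_zero_left h

theorem ιc_ιc (a b : Idx) (f : Forms V0) : ιc a (ιc b f) = -ιc b (ιc a f) := by
  have h : ιc a * ιc b + ιc b * ιc a = 0 := by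
    have h' : ∀ x y : V0, iota x * iota y = -(iota y * iota x) := fun x y => by
      rw [← add_zero (-(iota y * iota x)), ← iota_iota y x, neg_add_cancel_left]
    simp only [ιc, cval, smul_mul_assoc, add_mul, mul_smul_comm, mul_add]
    rw [h' (rb (b.1, false)) (rb (a.1, false)), h' (rb (b.1, true)) (rb (a.1, true)),
      h' (rb (b.1, false)) (rb (a.1, true)), h' (rb (b.1, true)) (rb (a.1, false))]
    module
  exact eq_neg_of_add_eq_zero_left (LinearMap.congr_fun h f)

theorem eq_zero_of_eq_neg_self {f : Forms V0} (h : f = -f) : f = 0 := by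
  have h2 : (2 : ℂ) • f = 0 := by rw [two_smul]; nth_rewrite 2 [h]; exact add_neg_cancel f
  exact (smul_eq_zero.1 h2).resolve_left two_ne_zero

theorem ιc_self (a : Idx) (f : Forms V0) : ιc a (ιc a f) = 0 := by
  have := ιc_ιc a a f
  exact eq_zero_of_eq_neg_self this

@[simp] theorem εc_deg_zero (b : Idx) (f : Forms V0) : εc b f 0 = 0 := rfl

@[simp] theorem εc_deg_succ (b : Idx) (f : Forms V0) (k : ℕ) :
    εc b f (k + 1) = epsForm (theta b) (f k) := rfl

theorem ιc_deg (b : Idx) (f : Forms V0) (k : ℕ) :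
    ιc b f k = cval (fun x => iotaForm x (f (k + 1))) b := by
  simp [ιc, cval]

/-- Alternation of a form-valued real-linear map, in terms of the complex frame. -/
theorem alternatizeUncurryFin_eq_sum {k : ℕ} (Φ : V0 →L[ℝ] CForm V0 k) :
    ContinuousAlternatingMap.alternatizeUncurryFin Φ = ∑ b, epsForm (theta b) (cval Φ b) := by
  ext v
  simp only [ContinuousAlternatingMap.alternatizeUncurryFin_apply,
    ContinuousAlternatingMap.sum_apply, epsForm_apply]
  rw [Finset.sum_comm]
  refine Finset.sum_congr rfl fun m _ => ?_
  have h := sum_theta_cval (Φ : V0 →+ CForm V0 k) (fun c v => by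
    ext w; simp) (v m)
  have h' := congrArg (fun f : CForm V0 k => f (m.removeNth v)) h
  simp only [ContinuousAlternatingMap.sum_apply, ContinuousAlternatingMap.smul_apply,
    smul_eq_mul] at h'
  rw [← Finset.mul_sum, zsmul_eq_mul]
  push_cast
  exact congrArg _ h'.symm

/-- The number operator `∑ e_b i_b` multiplies a form by its degree. -/
theorem sum_εc_ιc_deg (f : Forms V0) (k : ℕ) : (∑ b, εc b (ιc b f)) k = (k : ℂ) • f k := by
  cases k with
  | zero =>
    simp only [Forms.sum_deg, εc_deg_zero, Finset.sum_const_zero, Nat.cast_zero]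
    exact (zero_smul ℂ (f 0)).symm
  | succ k =>
    have h := alternatizeUncurryFin_eq_sum (f (k + 1)).curryLeft
    rw [ContinuousAlternatingMap.alternatizeUncurryFin_curryLeft] at h
    rw [Forms.sum_deg]
    simp only [εc_deg_succ, ιc_deg]
    refine (h.symm.trans ?_)
    rw [← Nat.cast_smul_eq_nsmul ℂ]

theorem cform_eq_zero {k : ℕ} (hk : 6 < k) (f : CForm V0 k) : f = 0 := by
  ext v
  refine f.toAlternatingMap.map_linearDependent v fun h => ?_
  have := h.fintype_card_le_finrank
  simp [Module.finrank_pi_fintype] at this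
  omega

/-- The constant function `1` as a form of degree zero. -/
def oneForm : Forms V0 := fun k =>
  match k with
  | 0 => ContinuousAlternatingMap.constOfIsEmpty ℝ V0 (Fin 0) (1 : ℂ)
  | _ + 1 => 0

@[simp] theorem oneForm_zero (v : Fin 0 → V0) : oneForm 0 v = 1 := rfl
@[simp] theorem oneForm_succ (k : ℕ) : oneForm (k + 1) = 0 := rfl

/-- The forms are generated from the constants by the exterior multiplications. -/
theorem forms_induction {P : Forms V0 → Prop} (h0 : ∀ c : ℂ, P (c • oneForm))
    (hadd : ∀ f g, P f → P g → P (f + g)) (he : ∀ b f, P f → P (εc b f)) (f : Forms V0) :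
    P f := by
  have hz : P 0 := by simpa using h0 0
  have hsum : ∀ {ι : Type} (s : Finset ι) (F : ι → Forms V0), (∀ a ∈ s, P (F a)) →
      P (∑ a ∈ s, F a) := fun s F hF => Finset.sum_induction F P hadd hz hF
  let of : ∀ k, CForm V0 k → Forms V0 := fun k g l => if h : k = l then h ▸ g else 0
  have ofself : ∀ k g, of k g k = g := fun k g => by simp [of]
  have ofne : ∀ k l g, k ≠ l → of k g l = 0 := fun k l g h => by simp [of, h]
  have key : ∀ k (g : CForm V0 k), P (of k g) := by
    intro k
    induction k with
    | zero =>
      intro g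
      convert h0 (g 0) using 1
      ext l v
      cases l with
      | zero => simp [ofself, Subsingleton.elim v 0]
      | succ l => simp [ofne]
    | succ k ih =>
      intro g
      have hg : of (k + 1) g =
          ∑ b, εc b (of k ((1 / ((k : ℂ) + 1)) • ιc b (of (k + 1) g) k)) := by
        ext1 l
        have h := sum_εc_ιc_deg (of (k + 1) g) (k + 1)
        rw [Forms.sum_deg] at h ⊢
        by_cases hl : l = k + 1
        · subst hl
          simp only [εc_deg_succ, ofself, map_smul, ← Finset.smul_sum] at h ⊢
          rw [h, smul_smul]
          have : ((k : ℂ) + 1) ≠ 0 := Nat.cast_add_one_ne_zero k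
          push_cast
          rw [one_div_mul_cancel this, one_smul]
        · rw [ofne _ _ _ (Ne.symm hl)]
          symm
          refine Finset.sum_eq_zero fun b _ => ?_
          cases l with
          | zero => simp
          | succ l => rw [εc_deg_succ, ofne _ _ _ (by omega), map_zero]
      rw [hg]
      exact hsum _ _ fun b _ => he b _ (ih _)
  have hf : f = ∑ k ∈ Finset.range 7, of k (f k) := by
    ext1 l
    rw [Forms.sum_deg]
    by_cases hl : l < 7
    · exact ((Finset.sum_eq_single_of_mem l (Finset.mem_range.2 hl)
        fun k _ hk => ofne _ _ _ hk).trans (ofself l (f l))).symm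
    · rw [cform_eq_zero (by omega) (f l)]
      exact (Finset.sum_eq_zero fun k hk => ofne _ _ _ (by
        have := Finset.mem_range.1 hk; omega)).symm
  rw [hf]
  exact hsum _ _ fun k _ => key k _

/-! ### Parity, conjugation and Hodge types on the model -/

/-- The parity operator, `(-1) ^ k` on `k`-forms. -/
def parity : Module.End ℂ (Forms V0) where
  toFun f k := ((-1 : ℂ) ^ k) • f k
  map_add' f g := by ext1 k; exact smul_add _ (f k) (g k)
  map_smul' c f := by ext1 k; exact smul_comm _ c (f k)

@[simp] theorem parity_deg (f : Forms V0) (k : ℕ) : parity f k = ((-1 : ℂ) ^ k) • f k := rfl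

theorem parity_parity (f : Forms V0) : parity (parity f) = f := by
  ext k v
  simp only [parity_deg, ContinuousAlternatingMap.smul_apply, smul_eq_mul]
  rw [← mul_assoc, ← mul_pow]; simp

theorem parity_εc (b : Idx) (f : Forms V0) : parity (εc b f) = -εc b (parity f) := by
  ext1 k
  cases k with
  | zero => simp
  | succ k =>
    simp only [parity_deg, Forms.neg_deg, εc_deg_succ, map_smul, pow_succ]
    ext v; simp

theorem parity_ιc (b : Idx) (f : Forms V0) : parity (ιc b f) = -ιc b (parity f) := by
  ext k v
  simp only [parity_deg, Forms.neg_deg, ιc_deg, cval, map_smul, pow_succ]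
  simp
  ring

theorem parity_oneForm : parity oneForm = oneForm := by
  ext k v
  cases k <;> simp

section Conj

variable {V : Type*} [AddCommGroup V] [Module ℝ V] [TopologicalSpace V]

@[simp] theorem conjForm_apply {k : ℕ} (α : CForm V k) (v : Fin k → V) :
    conjForm α v = starRingEnd ℂ (α v) := rfl

@[simp] theorem conjForm_conjForm {k : ℕ} (α : CForm V k) : conjForm (conjForm α) = α := by
  ext v; simp

theorem conjForm_add {k : ℕ} (α β : CForm V k) :
    conjForm (α + β) = conjForm α + conjForm β := by
  ext v; simp

theorem conjForm_smul {k : ℕ} (c : ℂ) (α : CForm V k) :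
    conjForm (c • α) = starRingEnd ℂ c • conjForm α := by
  ext v; simp

end Conj

/-- Complex conjugation on the graded space of forms. -/
def conjF : Forms V0 →+ Forms V0 where
  toFun f k := conjForm (f k)
  map_zero' := by ext k v; simp
  map_add' f g := by ext1 k; exact conjForm_add _ _

@[simp] theorem conjF_deg (f : Forms V0) (k : ℕ) : conjF f k = conjForm (f k) := rfl

theorem conjF_smul (c : ℂ) (f : Forms V0) : conjF (c • f) = starRingEnd ℂ c • conjF f := by
  ext1 k; exact conjForm_smul _ _

@[simp] theorem conjF_conjF (f : Forms V0) : conjF (conjF f) = f := by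
  ext1 k; exact conjForm_conjForm _

theorem conjF_εc (b : Idx) (f : Forms V0) : conjF (εc b f) = εc (bar b) (conjF f) := by
  ext k v
  cases k with
  | zero => simp
  | succ k => simp [epsForm_apply, theta_bar]

theorem conjF_ιc (b : Idx) (f : Forms V0) : conjF (ιc b f) = ιc (bar b) (conjF f) := by
  ext k v
  have h2 : starRingEnd ℂ 2 = 2 := Complex.conj_ofNat 2
  obtain ⟨j, _ | _⟩ := b <;> simp [ιc_deg, cval, sgnI, h2]

theorem conjF_parity (f : Forms V0) : conjF (parity f) = parity (conjF f) := by
  ext k v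
  simp

theorem conjF_oneForm : conjF oneForm = oneForm := by
  ext k v
  cases k <;> simp

/-! #### Hodge types -/

section TypePart

variable {V : Type*} [AddCommGroup V] [Module ℝ V] [TopologicalSpace V]
  [IsTopologicalAddGroup V] [ContinuousSMul ℝ V]

theorem typePart_add (J : V →L[ℝ] V) {k : ℕ} (r : ℤ) (α β : CForm V k) :
    typePart J r (α + β) = typePart J r α + typePart J r β := by
  unfold typePart
  split_ifs
  · ext v
    simp [Finset.mul_sum, mul_add, Finset.sum_add_distrib]
  · simp

theorem typePart_smul (J : V →L[ℝ] V) {k : ℕ} (r : ℤ) (c : ℂ) (α : CForm V k) :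
    typePart J r (c • α) = c • typePart J r α := by
  unfold typePart
  split_ifs
  · ext v
    simp only [ContinuousAlternatingMap.smul_apply, ContinuousAlternatingMap.sum_apply,
      ContinuousAlternatingMap.compContinuousLinearMap_apply, smul_eq_mul, Finset.mul_sum]
    exact Finset.sum_congr rfl fun j _ => by ring
  · ext v; simp

/-- `typePart` as a linear map. -/
def typePartL (J : V →L[ℝ] V) {k : ℕ} (r : ℤ) : CForm V k →ₗ[ℂ] CForm V k where
  toFun := typePart J r
  map_add' := typePart_add J r
  map_smul' := typePart_smul J r

@[simp] theorem typePartL_apply (J : V →L[ℝ] V) {k : ℕ} (r : ℤ) (α : CForm V k) :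
    typePartL J r α = typePart J r α := rfl

/-- The component of a form of pure type. -/
theorem typePart_of_isOfType' (J : V →L[ℝ] V) {k p : ℕ} (hp : p ≤ k) (r : ℤ) (α : CForm V k)
    (hα : IsOfType J p (k - p) α) : typePart J r α = if r = p then α else 0 := by
  split_ifs with hr
  · rw [hr]; exact typePart_of_isOfType J hp α hα
  · by_cases h : 0 ≤ r ∧ r ≤ k
    · obtain ⟨r, rfl⟩ := Int.eq_ofNat_of_zero_le h.1
      have hrk : r ≤ k := by exact_mod_cast h.2
      ext v
      rw [typePart_apply J hrk, coeff_extract hrk (fun z => α fun i => cmul J z (v i))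
        (fun q => if q = p then α v else 0)]
      · rw [if_neg (by exact_mod_cast hr)]; simp
      · intro z
        have h := congrArg (fun β : CForm V k => β v) (hα z)
        simp only [ContinuousAlternatingMap.smul_apply] at h
        have h' : (α fun i => cmul J z (v i)) = (z ^ p * (starRingEnd ℂ z) ^ (k - p)) • α v := h
        rw [h', Finset.sum_eq_single_of_mem p (Finset.mem_range.2 (Nat.lt_succ_iff.2 hp))
          fun q _ hq => by rw [if_neg hq, zero_mul], if_pos rfl, smul_eq_mul, mul_comm]
    · rw [typePart, if_neg h]

theorem typePart_typePart (J : V →L[ℝ] V) (sq : ∀ v, J (J v) = -v) {k : ℕ} (r s : ℤ)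
    (α : CForm V k) : typePart J r (typePart J s α) = if r = s then typePart J s α else 0 := by
  by_cases h : 0 ≤ s ∧ s ≤ k
  · obtain ⟨s, rfl⟩ := Int.eq_ofNat_of_zero_le h.1
    have hs : s ≤ k := by exact_mod_cast h.2
    exact typePart_of_isOfType' J hs r _ (isOfType_typePart J sq hs α)
  · rw [typePart, typePart, if_neg h]
    split_ifs <;> first | rfl | (ext v; simp)

theorem typePart_of_not (J : V →L[ℝ] V) {k : ℕ} {r : ℤ} (h : ¬ (0 ≤ r ∧ r ≤ k)) (α : CForm V k) :
    typePart J r α = 0 := by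
  rw [typePart, if_neg h]

end TypePart

/-- Multiplication by `i` on the model, as a real-linear map. -/
def J0 : V0 →L[ℝ] V0 := Complex.I • ContinuousLinearMap.id ℝ V0

@[simp] theorem J0_apply (v : V0) : J0 v = Complex.I • v := rfl

theorem J0_sq (v : V0) : J0 (J0 v) = -v := by
  simp [smul_smul]

theorem cmul_J0 (z : ℂ) (v : V0) : cmul J0 z v = z • v := by
  funext j
  simp only [cmul, add_apply, FunLike.coe_smul, Pi.smul_apply, ContinuousLinearMap.coe_id', id_eq,
    J0_apply, Pi.add_apply, smul_eq_mul, Complex.real_smul]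
  conv_rhs => rw [← Complex.re_add_im z]
  ring

/-- The projection onto the forms with exactly `r` factors of type `(1,0)`. -/
def proj (r : ℤ) : Module.End ℂ (Forms V0) where
  toFun f k := typePart J0 r (f k)
  map_add' f g := by ext1 k; exact typePart_add _ _ _ _
  map_smul' c f := by ext1 k; exact typePart_smul _ _ _ _

@[simp] theorem proj_deg (r : ℤ) (f : Forms V0) (k : ℕ) : proj r f k = typePart J0 r (f k) := rfl

/-- The contribution of `theta b` to the holomorphic degree. -/
def wt : Idx → ℤ
  | (_, false) => 1
  | (_, true) => 0

@[simp] theorem wt_false (j : Fin 3) : wt (j, false) = 1 := rfl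
@[simp] theorem wt_true (j : Fin 3) : wt (j, true) = 0 := rfl

theorem proj_proj (r s : ℤ) (f : Forms V0) :
    proj r (proj s f) = if r = s then proj s f else 0 := by
  ext1 k
  rw [proj_deg, proj_deg, typePart_typePart J0 J0_sq]
  split_ifs <;> rfl

theorem proj_sum (f : Forms V0) (k : ℕ) :
    ∑ r ∈ Finset.range (k + 1), proj (r : ℤ) f k = f k :=
  sum_typePart J0 (f k)

theorem theta_smul (b : Idx) (z : ℂ) (v : V0) :
    theta b (z • v) = (if wt b = 1 then z else starRingEnd ℂ z) * theta b v := by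
  obtain ⟨j, _ | _⟩ := b <;> simp

/-- Exterior multiplication by `theta b` shifts the holomorphic degree by `wt b`. -/
theorem proj_εc (r : ℤ) (b : Idx) (f : Forms V0) :
    proj r (εc b f) = εc b (proj (r - wt b) f) := by
  ext1 k
  cases k with
  | zero => simp only [proj_deg, εc_deg_zero]; exact map_zero (typePartL J0 r)
  | succ k =>
    simp only [proj_deg, εc_deg_succ]
    rw [← sum_typePart J0 (f k), map_sum, ← typePartL_apply, ← typePartL_apply, map_sum, map_sum,
      map_sum]
    refine Finset.sum_congr rfl fun p hp => ?_
    have hp' : p ≤ k := Nat.lt_succ_iff.1 (Finset.mem_range.1 hp)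
    have ht := isOfType_typePart J0 J0_sq hp' (f k)
    set g := typePart J0 (p : ℤ) (f k)
    have key : ∀ z : ℂ, (epsForm (theta b) g).compContinuousLinearMap (cmul J0 z) =
        ((if wt b = 1 then z else starRingEnd ℂ z) * (z ^ p * (starRingEnd ℂ z) ^ (k - p))) •
          epsForm (theta b) g := by
      intro z
      ext v
      simp only [ContinuousAlternatingMap.compContinuousLinearMap_apply, epsForm_apply,
        Function.comp_apply, cmul_J0, theta_smul, ContinuousAlternatingMap.smul_apply, smul_eq_mul,
        Finset.mul_sum]
      refine Finset.sum_congr rfl fun m _ => ?_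
      have h1 := congrArg (fun β : CForm V0 k => β (m.removeNth v)) (ht z)
      simp only [ContinuousAlternatingMap.compContinuousLinearMap_apply,
        ContinuousAlternatingMap.smul_apply, smul_eq_mul] at h1
      have h2 : (m.removeNth (⇑(cmul J0 z) ∘ v)) = ⇑(cmul J0 z) ∘ (m.removeNth v) := rfl
      rw [h2, h1]
      ring
    simp only [typePartL_apply]
    rw [typePart_of_isOfType' J0 hp' _ g ht]
    obtain ⟨j, _ | _⟩ := b
    · rw [typePart_of_isOfType' J0 (p := p + 1) (by omega)]
      · simp only [wt_false, Nat.cast_add, Nat.cast_one, sub_eq_iff_eq_add]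
        split_ifs <;> simp
      · intro z
        rw [key, if_pos (wt_false j), show k + 1 - (p + 1) = k - p by omega]
        ring_nf
    · rw [typePart_of_isOfType' J0 (p := p) (by omega)]
      · simp only [wt_true, sub_zero]
        split_ifs <;> simp
      · intro z
        rw [key, if_neg (by simp), show k + 1 - p = k - p + 1 by omega]
        ring_nf

theorem ιc_oneForm (b : Idx) : ιc b oneForm = 0 := by
  ext k v
  simp [ιc_deg, cval]

theorem proj_oneForm (r : ℤ) : proj r oneForm = if r = 0 then oneForm else 0 := by
  ext1 k
  cases k with
  | zero =>
    rw [proj_deg, typePart_of_isOfType' J0 (le_refl 0)]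
    · simp only [Nat.cast_zero]; split_ifs <;> rfl
    · intro z
      ext v
      simp
  | succ k =>
    rw [proj_deg, oneForm_succ]
    refine (map_zero (typePartL J0 r)).trans ?_
    split_ifs <;> rfl

theorem proj_ιc (r : ℤ) (a : Idx) (f : Forms V0) :
    proj r (ιc a f) = ιc a (proj (r + wt a) f) := by
  induction f using forms_induction generalizing r with
  | h0 c =>
    rw [map_smul, map_smul, map_smul, map_smul, ιc_oneForm, proj_oneForm]
    split_ifs <;> simp [ιc_oneForm]
  | hadd f g hf hg => simp only [map_add, hf, hg]
  | he b f ih =>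
    rw [ιc_εc, proj_εc, ιc_εc, map_sub, proj_εc, ih]
    rw [show r + wt a - wt b = r - wt b + wt a by ring]
    congr 1
    split_ifs with h
    · subst h; simp
    · simp

/-! ### The Hodge star of the model -/

/-- The conjugate-linear Hodge star of the model, in terms of the standard orthonormal basis,
for an arbitrary volume form. -/
def starForm (vol : CForm V0 6) {k l : ℕ} (h : k + l = 6) (β : CForm V0 k) : CForm V0 l :=
  (1 / (k.factorial : ℂ)) • ∑ c : Fin k → Idx,
    starRingEnd ℂ (β fun a => rb (c a)) • insertFirst h vol (fun a => rb (c a))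

theorem starForm_apply (vol : CForm V0 6) {k l : ℕ} (h : k + l = 6) (β : CForm V0 k)
    (v : Fin l → V0) : starForm vol h β v = (1 / (k.factorial : ℂ)) * ∑ c : Fin k → Idx,
    starRingEnd ℂ (β fun a => rb (c a)) *
      vol (fun a => Fin.append (fun a => rb (c a)) v (Fin.cast h.symm a)) := by
  simp only [starForm, ContinuousAlternatingMap.smul_apply, ContinuousAlternatingMap.sum_apply,
    smul_eq_mul]
  rfl

theorem starForm_add (vol : CForm V0 6) {k l : ℕ} (h : k + l = 6) (α β : CForm V0 k) :
    starForm vol h (α + β) = starForm vol h α + starForm vol h β := by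
  ext v
  simp only [starForm_apply, ContinuousAlternatingMap.add_apply, map_add, add_mul,
    Finset.sum_add_distrib, mul_add]

theorem starForm_smul (vol : CForm V0 6) {k l : ℕ} (h : k + l = 6) (c : ℂ) (α : CForm V0 k) :
    starForm vol h (c • α) = starRingEnd ℂ c • starForm vol h α := by
  ext v
  simp only [starForm_apply, ContinuousAlternatingMap.smul_apply, smul_eq_mul, map_mul,
    Finset.mul_sum]
  exact Finset.sum_congr rfl fun _ _ => by ring

theorem starForm_zero (vol : CForm V0 6) {k l : ℕ} (h : k + l = 6) :
    starForm vol h 0 = 0 := by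
  ext v
  simp [starForm_apply]

/-- The Hodge star, computed by inserting the last vector separately. -/
theorem starForm_succ (vol : CForm V0 6) {k l : ℕ} (h : k + 1 + l = 6) (h' : k + (l + 1) = 6)
    (β : CForm V0 (k + 1)) : starForm vol h β = ((-1 : ℂ) ^ k * (1 / ((k : ℂ) + 1))) •
      ∑ a, iotaForm (rb a) (starForm vol h' (iotaForm (rb a) β)) := by
  ext v
  rw [starForm_apply, ContinuousAlternatingMap.smul_apply, ContinuousAlternatingMap.sum_apply]
  simp only [iotaForm_apply, starForm_apply, smul_eq_mul]
  rw [← (Fin.snocEquiv (fun _ : Fin (k + 1) => Idx)).sum_comp, Fintype.sum_prod_type,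
    Finset.mul_sum, Finset.mul_sum]
  refine Finset.sum_congr rfl fun a _ => ?_
  rw [Finset.mul_sum, Finset.mul_sum, Finset.mul_sum]
  refine Finset.sum_congr rfl fun c _ => ?_
  have h1 : (fun m => rb ((Fin.snocEquiv (fun _ : Fin (k + 1) => Idx)) (a, c) m)) =
      (Fin.last k).insertNth (rb a) (fun m => rb (c m)) := by
    rw [Fin.insertNth_last']
    funext m
    refine Fin.lastCases ?_ (fun m => ?_) m <;> simp [Fin.snocEquiv]
  have h2 : (fun m => Fin.append
        (fun m => rb ((Fin.snocEquiv (fun _ : Fin (k + 1) => Idx)) (a, c) m)) v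
          (Fin.cast h.symm m)) =
      fun m => Fin.append (fun m => rb (c m)) (Matrix.vecCons (rb a) v) (Fin.cast h'.symm m) := by
    rw [h1, Fin.insertNth_last']
    funext m
    have := congrFun (Fin.append_right_cons (fun m => rb (c m)) (rb a) v) (Fin.cast h'.symm m)
    exact this.symm
  rw [h2, h1, ContinuousAlternatingMap.map_insertNth, Nat.factorial_succ]
  have hk : ((k : ℂ) + 1) ≠ 0 := Nat.cast_add_one_ne_zero k
  have hf : ((k.factorial : ℕ) : ℂ) ≠ 0 := Nat.cast_ne_zero.2 (Nat.factorial_ne_zero k)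
  have hs : starRingEnd ℂ ((-1 : ℤ) ^ ((Fin.last k : Fin (k + 1)) : ℕ) •
      β (Matrix.vecCons (rb a) fun m => rb (c m))) =
      (-1 : ℂ) ^ k * starRingEnd ℂ (β (Matrix.vecCons (rb a) fun m => rb (c m))) := by
    rw [zsmul_eq_mul, map_mul]
    simp
  rw [hs]
  push_cast
  field_simp

/-- The Hodge star turns exterior multiplication by a covector into interior multiplication by its
metric dual. The proof recurses on the degree by peeling off one vector (`starForm_succ`). -/
theorem starForm_eps (vol : CForm V0 6) (α : V0 →L[ℝ] ℂ) {k l : ℕ} (h : k + 1 + l = 6)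
    (h' : k + (l + 1) = 6) (β : CForm V0 k) : starForm vol h (epsForm α β) =
      ((-1 : ℂ) ^ k) • ∑ a, starRingEnd ℂ (α (rb a)) • iotaForm (rb a) (starForm vol h' β) := by
  induction k generalizing l with
  | zero =>
    rw [starForm_succ vol h h']
    simp only [iotaForm_epsForm_zero, starForm_smul, map_smul]
    simp
  | succ k ih =>
    rw [starForm_succ vol h h']
    have h1 : ∀ a, iotaForm (rb a) (epsForm α β) =
        α (rb a) • β - epsForm α (iotaForm (rb a) β) := fun a => by
      rw [← iotaForm_epsForm, add_sub_cancel_right]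
    have hsub : ∀ x y : CForm V0 (k + 1), starForm vol h' (x - y) =
        starForm vol h' x - starForm vol h' y := fun x y => by
      rw [sub_eq_add_neg, ← neg_one_smul ℂ y, starForm_add, starForm_smul]
      rw [map_neg, map_one, cform_neg_smul, one_smul, ← sub_eq_add_neg]
    have h'' : k + (l + 1 + 1) = 6 := by omega
    simp only [h1, hsub, starForm_smul, map_sub, map_smul, Finset.sum_sub_distrib,
      ih h' h'' , map_sum]
    have h2 : ∑ a, ((-1 : ℂ) ^ k) • ∑ b, starRingEnd ℂ (α (rb b)) •
        iotaForm (rb a) (iotaForm (rb b) (starForm vol h'' (iotaForm (rb a) β))) =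
        -(((k : ℂ) + 1) • ∑ b, starRingEnd ℂ (α (rb b)) •
          iotaForm (rb b) (starForm vol h' β)) := by
      rw [starForm_succ vol h' h'']
      simp only [map_smul, map_sum, Finset.smul_sum]
      rw [Finset.sum_comm, ← Finset.sum_neg_distrib]
      refine Finset.sum_congr rfl fun b _ => ?_
      rw [← Finset.sum_neg_distrib]
      refine Finset.sum_congr rfl fun a _ => ?_
      rw [iotaForm_swap]
      have hk : ((k : ℂ) + 1) ≠ 0 := Nat.cast_add_one_ne_zero k
      simp only [smul_smul, smul_neg]
      congr 2
      field_simp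
    rw [h2, sub_neg_eq_add]
    have hk : ((k : ℂ) + 1 + 1) ≠ 0 := by
      have := Nat.cast_add_one_ne_zero (R := ℂ) (k + 1)
      push_cast at this
      exact this
    push_cast
    rw [← one_smul ℂ (∑ a, starRingEnd ℂ (α (rb a)) • iotaForm (rb a) (starForm vol h' β)),
      smul_smul, ← cform_add_smul, smul_smul, smul_smul]
    congr 1
    field_simp
    ring

/-- The function underlying `starF`. -/
def starFun (vol : CForm V0 6) (f : Forms V0) : Forms V0 := fun l =>
  if h : l ≤ 6 then starForm vol (Nat.sub_add_cancel h) (f (6 - l)) else 0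

theorem starFun_of_le (vol : CForm V0 6) (f : Forms V0) {l : ℕ} (h : l ≤ 6) :
    starFun vol f l = starForm vol (Nat.sub_add_cancel h) (f (6 - l)) := dif_pos h

theorem starFun_of_lt (vol : CForm V0 6) (f : Forms V0) {l : ℕ} (h : ¬ l ≤ 6) :
    starFun vol f l = 0 := dif_neg h

/-- The conjugate-linear Hodge star on the graded space of forms. -/
def starF (vol : CForm V0 6) : Forms V0 →+ Forms V0 where
  toFun := starFun vol
  map_zero' := by
    ext1 l
    by_cases h : l ≤ 6
    · rw [starFun_of_le _ _ h]; exact starForm_zero _ _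
    · exact starFun_of_lt _ _ h
  map_add' f g := by
    ext1 l
    rw [Forms.add_deg]
    by_cases h : l ≤ 6
    · simp only [starFun_of_le _ _ h]; exact starForm_add _ _ _ _
    · simp only [starFun_of_lt _ _ h]; exact (add_zero _).symm

theorem starF_deg (vol : CForm V0 6) (f : Forms V0) {k l : ℕ} (h : k + l = 6) :
    starF vol f l = starForm vol h (f k) := by
  obtain rfl : k = 6 - l := by omega
  exact dif_pos (by omega)

theorem starF_deg_of_lt (vol : CForm V0 6) (f : Forms V0) {l : ℕ} (h : 6 < l) :
    starF vol f l = 0 := dif_neg (by omega)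

theorem starF_smul (vol : CForm V0 6) (c : ℂ) (f : Forms V0) :
    starF vol (c • f) = starRingEnd ℂ c • starF vol f := by
  ext1 l
  by_cases h : l ≤ 6
  · rw [starF_deg vol _ (Nat.sub_add_cancel h), Forms.smul_deg, Forms.smul_deg, starForm_smul,
      starF_deg vol _ (Nat.sub_add_cancel h)]
  · rw [Forms.smul_deg, starF_deg_of_lt _ _ (by omega), starF_deg_of_lt _ _ (by omega),
      cform_smul_zero]

/-- The factor `2` is the square of the length of `dz_j`. -/
theorem starF_εc (vol : CForm V0 6) (b : Idx) (f : Forms V0) :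
    starF vol (εc b f) = (2 : ℂ) • ιc b (starF vol (parity f)) := by
  ext1 l
  rw [Forms.smul_deg]
  by_cases hl : l ≤ 5
  · obtain ⟨k, hk⟩ : ∃ k, k + 1 + l = 6 := ⟨5 - l, by omega⟩
    have hk' : k + (l + 1) = 6 := by omega
    rw [starF_deg vol _ hk, εc_deg_succ, starForm_eps vol _ hk hk', ιc_deg, starF_deg vol _ hk',
      parity_deg, starForm_smul]
    have hc : starRingEnd ℂ ((-1 : ℂ) ^ k) = (-1) ^ k := by simp
    rw [hc, Fintype.sum_prod_type]
    simp only [Fintype.sum_bool, cval, map_smul]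
    obtain ⟨j, c⟩ := b
    rw [Fintype.sum_eq_single j]
    · cases c <;> simp only [theta_false, theta_true, rb, Pi.single_eq_same, sgnI, map_one,
        map_neg, Complex.conj_I] <;> module
    · intro m hm
      cases c <;> simp [rb, hm.symm, cform_zero_smul]
  · have h1 : ιc b (starF vol (parity f)) l = 0 := by
      rw [ιc_deg, starF_deg_of_lt vol _ (show 6 < l + 1 by omega)]
      simp [cval]
    rw [h1, cform_smul_zero]
    by_cases h : l = 6
    · subst h
      rw [starF_deg vol _ (show 0 + 6 = 6 from rfl), εc_deg_zero, starForm_zero]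
    · exact starF_deg_of_lt vol _ (by omega)

theorem starF_parity (vol : CForm V0 6) (f : Forms V0) :
    starF vol (parity f) = parity (starF vol f) := by
  ext1 l
  by_cases h : l ≤ 6
  · rw [parity_deg, starF_deg vol _ (Nat.sub_add_cancel h), starF_deg vol _ (Nat.sub_add_cancel h),
      parity_deg, starForm_smul]
    congr 1
    interval_cases l <;> simp <;> norm_num
  · rw [parity_deg, starF_deg_of_lt _ _ (by omega), starF_deg_of_lt _ _ (by omega),
      cform_smul_zero]

theorem starF_ιc (vol : CForm V0 6) (b : Idx) (f : Forms V0) :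
    starF vol (ιc b f) = (-1 / 2 : ℂ) • εc b (starF vol (parity f)) := by
  induction f using forms_induction with
  | h0 c =>
    rw [map_smul, ιc_oneForm, smul_zero, map_zero, map_smul, parity_oneForm, starF_smul, map_smul]
    have : εc b (starF vol oneForm) = 0 := by
      ext1 l
      cases l with
      | zero => simp
      | succ l =>
        rw [εc_deg_succ]
        by_cases h : l = 6
        · subst h
          rw [cform_eq_zero (by norm_num) (epsForm _ _)]; rfl
        · by_cases h6 : 6 < l
          · rw [starF_deg_of_lt _ _ h6, map_zero]; rfl
          · obtain ⟨k, hk⟩ : ∃ k, k + 1 + l = 6 := ⟨5 - l, by omega⟩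
            rw [starF_deg vol _ hk, oneForm_succ, starForm_zero, map_zero]; rfl
    rw [this, smul_zero, smul_zero]
  | hadd f g hf hg => simp only [map_add, hf, hg, smul_add]
  | he a f ih =>
    rw [ιc_εc, map_sub, starF_εc, starF_parity, ih, parity_εc, map_neg, starF_εc, parity_parity,
      map_smul, parity_εc, starF_parity, parity_parity]
    simp only [map_smul, map_neg, ιc_εc, smul_neg, smul_sub, smul_smul, eq_comm (a := a)]
    split_ifs with h
    · module
    · rw [map_zero]; module

/-! ### The fundamental form and the volume form of the model -/

/-- A signed sum over permutations, sorted by the image of `0`. -/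
theorem sum_perm_succ {V : Type*} {n : ℕ} (f : (Fin (n + 1) → V) → ℂ) (v : Fin (n + 1) → V) :
    ∑ σ : Equiv.Perm (Fin (n + 1)), ((Equiv.Perm.sign σ : ℤ) : ℂ) * f (v ∘ σ) =
      ∑ p : Fin (n + 1), (-1) ^ (p : ℕ) * ∑ τ : Equiv.Perm (Fin n),
        ((Equiv.Perm.sign τ : ℤ) : ℂ) * f (Matrix.vecCons (v p) (p.removeNth v ∘ τ)) := by
  let φ : Fin (n + 1) × Equiv.Perm (Fin n) → Equiv.Perm (Fin (n + 1)) := fun x =>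
    (Fin.cycleRange x.1)⁻¹ * Equiv.Perm.decomposeFin.symm (0, x.2)
  have h0 : ∀ x, φ x 0 = x.1 := fun x => by
    simp [φ, Equiv.Perm.inv_def]
  have hs : ∀ x (j : Fin n), φ x j.succ = x.1.succAbove (x.2 j) := fun x j => by
    simp [φ, Equiv.Perm.inv_def]
  have hinj : Function.Injective φ := by
    rintro ⟨p, e⟩ ⟨q, e'⟩ h
    have hpq : p = q := by
      have := h0 (p, e)
      rw [h, h0] at this
      exact this.symm
    subst hpq
    have : e = e' := by
      ext1 j
      have := hs (p, e) j
      rw [h, hs] at this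
      exact (Fin.succAbove_right_injective this).symm
    rw [this]
  have hbij : Function.Bijective φ := by
    rw [Fintype.bijective_iff_injective_and_card]
    refine ⟨hinj, ?_⟩
    simp [Fintype.card_perm, Nat.factorial_succ]
  rw [← (Equiv.ofBijective φ hbij).sum_comp, Fintype.sum_prod_type]
  refine Finset.sum_congr rfl fun p _ => ?_
  rw [Finset.mul_sum]
  refine Finset.sum_congr rfl fun τ _ => ?_
  have hv : v ∘ ⇑(φ (p, τ)) = Matrix.vecCons (v p) (p.removeNth v ∘ τ) := by
    funext j
    refine Fin.cases ?_ (fun j => ?_) j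
    · simp [h0]
    · simp [hs, Fin.removeNth]
  have hsign : ((Equiv.Perm.sign (φ (p, τ)) : ℤ) : ℂ) =
      (-1) ^ (p : ℕ) * ((Equiv.Perm.sign τ : ℤ) : ℂ) := by
    simp [φ, Fin.sign_cycleRange]
  rw [Equiv.ofBijective_apply, hv, hsign, mul_assoc]

/-- Exterior multiplication by the fundamental form `(i / 2) ∑ dz_j ∧ conj dz_j`. -/
def lef : Module.End ℂ (Forms V0) :=
  ∑ j : Fin 3, (Complex.I / 2) • (εc (j, false) * εc (j, true))

theorem lef_apply (f : Forms V0) :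
    lef f = ∑ j : Fin 3, (Complex.I / 2) • εc (j, false) (εc (j, true) f) := by
  simp [lef, LinearMap.sum_apply]

/-- The fundamental form of the model. -/
def omega0 : CForm V0 2 := lef oneForm 2

theorem omega0_apply (v : Fin 2 → V0) : omega0 v = ∑ j : Fin 3, (Complex.I / 2) *
    (v 0 j * starRingEnd ℂ (v 1 j) - starRingEnd ℂ (v 0 j) * v 1 j) := by
  rw [omega0, lef_apply, Forms.sum_deg, ContinuousAlternatingMap.sum_apply]
  refine Finset.sum_congr rfl fun j _ => ?_
  simp [epsForm_apply, Fin.sum_univ_two, Fin.removeNth]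
  ring

/-- Wedging with the fundamental form, as a sum over permutations, is the operator `lef`. -/
theorem sum_perm_omega0 (f : Forms V0) {k : ℕ} (v : Fin (k + 1 + 1) → V0) :
    ∑ σ : Equiv.Perm (Fin (k + 1 + 1)), ((Equiv.Perm.sign σ : ℤ) : ℂ) *
      (omega0 ![(v ∘ σ) 0, (v ∘ σ) 1] * f k (fun j => (v ∘ σ) j.succ.succ)) =
      2 * (k.factorial : ℂ) * lef f (k + 1 + 1) v := by
  rw [sum_perm_succ (fun u => omega0 ![u 0, u 1] * f k (fun j => u j.succ.succ)) v]
  have h1 : ∀ p : Fin (k + 1 + 1), ∑ τ : Equiv.Perm (Fin (k + 1)),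
      ((Equiv.Perm.sign τ : ℤ) : ℂ) *
        (omega0 ![Matrix.vecCons (v p) (p.removeNth v ∘ τ) 0,
          Matrix.vecCons (v p) (p.removeNth v ∘ τ) 1] *
          f k (fun j => Matrix.vecCons (v p) (p.removeNth v ∘ τ) j.succ.succ)) =
      ∑ q : Fin (k + 1), (-1) ^ (q : ℕ) * ((k.factorial : ℂ) *
        (omega0 ![v p, p.removeNth v q] * f k (q.removeNth (p.removeNth v)))) := by
    intro p
    have := sum_perm_succ (fun u => omega0 ![v p, u 0] * f k (fun j => u j.succ)) (p.removeNth v)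
    refine Eq.trans ?_ (this.trans ?_)
    · rfl
    · refine Finset.sum_congr rfl fun q _ => ?_
      congr 1
      have h2 : ∀ τ : Equiv.Perm (Fin k), ((Equiv.Perm.sign τ : ℤ) : ℂ) *
          (omega0 ![v p, p.removeNth v q] *
            f k (q.removeNth (p.removeNth v) ∘ τ)) =
          omega0 ![v p, p.removeNth v q] * f k (q.removeNth (p.removeNth v)) := by
        intro τ
        have h3 := (f k).toAlternatingMap.map_perm (q.removeNth (p.removeNth v)) τ
        simp only [ContinuousAlternatingMap.coe_toAlternatingMap] at h3
        rw [h3, Units.smul_def, zsmul_eq_mul]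
        have h4 : ((Equiv.Perm.sign τ : ℤ) : ℂ) * ((Equiv.Perm.sign τ : ℤ) : ℂ) = 1 := by
          rw [← Int.cast_mul, ← Units.val_mul, Int.units_mul_self]; simp
        linear_combination (omega0 ![v p, p.removeNth v q] *
          f k (q.removeNth (p.removeNth v))) * h4
      calc _ = ∑ τ : Equiv.Perm (Fin k), ((Equiv.Perm.sign τ : ℤ) : ℂ) *
          (omega0 ![v p, p.removeNth v q] *
            f k (q.removeNth (p.removeNth v) ∘ τ)) := rfl
        _ = _ := by
          rw [Finset.sum_congr rfl fun τ _ => h2 τ, Finset.sum_const, Finset.card_univ,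
            Fintype.card_perm, Fintype.card_fin, nsmul_eq_mul]
  rw [Finset.sum_congr rfl fun p _ => congrArg _ (h1 p)]
  have h5 : ∀ a b : Idx, εc a (εc b f) (k + 1 + 1) v = ∑ p : Fin (k + 1 + 1), (-1) ^ (p : ℕ) *
      ∑ q : Fin (k + 1), (-1) ^ (q : ℕ) * (theta a (v p) * theta b (p.removeNth v q) *
        f k (q.removeNth (p.removeNth v))) := by
    intro a b
    rw [εc_deg_succ, epsForm_apply]
    refine Finset.sum_congr rfl fun p _ => ?_
    rw [εc_deg_succ, epsForm_apply, Finset.mul_sum]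
    congr 1
    exact Finset.sum_congr rfl fun q _ => by ring
  have h6 : 2 * (k.factorial : ℂ) * lef f (k + 1 + 1) v = ∑ j : Fin 3, (k.factorial : ℂ) *
      ((Complex.I / 2) * (εc (j, false) (εc (j, true) f) (k + 1 + 1) v -
        εc (j, true) (εc (j, false) f) (k + 1 + 1) v)) := by
    rw [lef_apply, Forms.sum_deg, ContinuousAlternatingMap.sum_apply, Finset.mul_sum]
    refine Finset.sum_congr rfl fun j _ => ?_
    rw [εc_εc (j, true)]
    simp only [Forms.smul_deg, Forms.neg_deg, ContinuousAlternatingMap.smul_apply,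
      ContinuousAlternatingMap.neg_apply, smul_eq_mul]
    ring
  rw [h6]
  simp only [h5, ← Finset.sum_sub_distrib, ← mul_sub, Finset.mul_sum]
  conv_rhs => rw [Finset.sum_comm]
  refine Finset.sum_congr rfl fun p _ => ?_
  conv_rhs => rw [Finset.sum_comm]
  refine Finset.sum_congr rfl fun q _ => ?_
  rw [omega0_apply]
  simp only [Finset.mul_sum, Finset.sum_mul]
  refine Finset.sum_congr rfl fun j _ => ?_
  simp
  ring

theorem wedge_apply {V : Type*} [AddCommGroup V] [Module ℝ V] [TopologicalSpace V]
    [IsTopologicalAddGroup V] [ContinuousSMul ℝ V] {k l : ℕ} (α : CForm V k) (β : CForm V l)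
    (v : Fin (k + l) → V) : wedge α β v = (1 / ((k.factorial : ℂ) * (l.factorial : ℂ))) *
      ∑ σ : Equiv.Perm (Fin (k + l)), ((Equiv.Perm.sign σ : ℤ) : ℂ) *
        (α (fun a => v (σ (Fin.castAdd l a))) * β (fun b => v (σ (Fin.natAdd k b)))) := by
  rw [wedge, ContinuousAlternatingMap.smul_apply, smul_eq_mul,
    ContinuousMultilinearMap.alternatization_apply_apply]
  congr 1
  refine Finset.sum_congr rfl fun σ _ => ?_
  rw [Units.smul_def, zsmul_eq_mul]
  rfl

theorem wedge_omega0 : wedge omega0 omega0 = lef (lef oneForm) 4 := by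
  ext v
  have h := sum_perm_omega0 (lef oneForm) (k := 2) v
  have h2 : wedge omega0 omega0 v = (1 / ((2 : ℕ).factorial * (2 : ℕ).factorial : ℂ)) *
      ∑ σ : Equiv.Perm (Fin 4), ((Equiv.Perm.sign σ : ℤ) : ℂ) *
      (omega0 ![(v ∘ σ) 0, (v ∘ σ) 1] * lef oneForm 2 (fun j => (v ∘ σ) j.succ.succ)) := by
    rw [wedge_apply]
    congr 1
    refine Finset.sum_congr rfl fun σ _ => ?_
    congr 2
    · congr 1
      funext a
      fin_cases a <;> rfl
    · change omega0 _ = omega0 _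
      congr 1
      funext a
      fin_cases a <;> rfl
  rw [h2, h]
  simp [Nat.factorial]
  ring

theorem volForm_omega0 : volForm omega0 = (1 / 6 : ℂ) • lef (lef (lef oneForm)) 6 := by
  rw [volForm]
  congr 1
  ext v
  have h := sum_perm_omega0 (lef (lef oneForm)) (k := 4) v
  have h2 : wedge (wedge omega0 omega0) omega0 v =
      (1 / ((4 : ℕ).factorial * (2 : ℕ).factorial : ℂ)) *
      ∑ σ : Equiv.Perm (Fin 6), ((Equiv.Perm.sign σ : ℤ) : ℂ) *
      (omega0 ![(v ∘ σ) 0, (v ∘ σ) 1] *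
        lef (lef oneForm) 4 (fun j => (v ∘ σ) j.succ.succ)) := by
    rw [wedge_apply]
    congr 1
    rw [← Equiv.sum_comp (Equiv.mulRight (finRotate 6 ^ 2))]
    refine Finset.sum_congr rfl fun σ _ => ?_
    have hsign : Equiv.Perm.sign (σ * finRotate 6 ^ 2) = Equiv.Perm.sign σ := by
      rw [map_mul, map_pow, sq, Int.units_mul_self, mul_one]
    rw [Equiv.coe_mulRight, hsign, wedge_omega0, mul_comm (omega0 _)]
    congr 2
    · congr 1
      funext a
      fin_cases a <;> rfl
    · congr 1
      funext a
      fin_cases a <;> rfl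
  rw [h2, h]
  simp [Nat.factorial]
  ring

/-! ### Lefschetz operators and the Hodge star of the model -/

/-- The contraction `∑ conj(∂_j) ⌟ ∂_j ⌟`, a multiple of the adjoint Lefschetz operator. -/
def lam0 : Module.End ℂ (Forms V0) := ∑ j : Fin 3, ιc (j, true) * ιc (j, false)

theorem lam0_apply (f : Forms V0) : lam0 f = ∑ j : Fin 3, ιc (j, true) (ιc (j, false) f) := by
  simp [lam0, LinearMap.sum_apply]

theorem lam0_ιc (b : Idx) (f : Forms V0) : lam0 (ιc b f) = ιc b (lam0 f) := by
  simp only [lam0_apply, map_sum]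
  refine Finset.sum_congr rfl fun j _ => ?_
  rw [ιc_ιc (j, false) b, map_neg, ιc_ιc (j, true) b, neg_neg]

theorem lam0_εc_false (k : Fin 3) (f : Forms V0) :
    lam0 (εc (k, false) f) = εc (k, false) (lam0 f) + ιc (k, true) f := by
  have h : ∀ j : Fin 3, ιc (j, true) (ιc (j, false) (εc (k, false) f)) =
      εc (k, false) (ιc (j, true) (ιc (j, false) f)) + if j = k then ιc (k, true) f else 0 := by
    intro j
    rw [ιc_εc, map_sub, ιc_εc, if_neg (show ¬(j, true) = (k, false) by simp)]
    by_cases hj : j = k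
    · subst hj; simp [add_comm]
    · simp [hj]
  simp only [lam0_apply, h, Finset.sum_add_distrib, map_sum, Finset.sum_ite_eq', Finset.mem_univ,
    if_true]

theorem lam0_εc_true (k : Fin 3) (f : Forms V0) :
    lam0 (εc (k, true) f) = εc (k, true) (lam0 f) - ιc (k, false) f := by
  have h : ∀ j : Fin 3, ιc (j, true) (ιc (j, false) (εc (k, true) f)) =
      εc (k, true) (ιc (j, true) (ιc (j, false) f)) - if j = k then ιc (k, false) f else 0 := by
    intro j
    rw [ιc_εc, map_sub, ιc_εc, if_neg (by simp)]
    by_cases hj : j = k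
    · subst hj; simp
    · simp [hj]
  simp only [lam0_apply, h, Finset.sum_sub_distrib, map_sum, Finset.sum_ite_eq', Finset.mem_univ,
    if_true]

theorem lef_εc (b : Idx) (f : Forms V0) : lef (εc b f) = εc b (lef f) := by
  simp only [lef_apply, map_sum, map_smul]
  refine Finset.sum_congr rfl fun j _ => ?_
  rw [εc_εc (j, true) b, map_neg, εc_εc (j, false) b, neg_neg]

theorem ιc_false_lef (k : Fin 3) (f : Forms V0) :
    ιc (k, false) (lef f) = lef (ιc (k, false) f) + (Complex.I / 2) • εc (k, true) f := by
  have h : ∀ j : Fin 3, ιc (k, false) (εc (j, false) (εc (j, true) f)) =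
      εc (j, false) (εc (j, true) (ιc (k, false) f)) + if j = k then εc (k, true) f else 0 := by
    intro j
    rw [ιc_εc, ιc_εc, if_neg (show ¬(k, false) = (j, true) by simp)]
    by_cases hj : j = k
    · subst hj; simp [add_comm]
    · simp [hj, Ne.symm hj]
  simp only [lef_apply, map_sum, map_smul, h, smul_add, Finset.sum_add_distrib, smul_ite,
    smul_zero, Finset.sum_ite_eq', Finset.mem_univ, if_true]

theorem ιc_true_lef (k : Fin 3) (f : Forms V0) :
    ιc (k, true) (lef f) = lef (ιc (k, true) f) - (Complex.I / 2) • εc (k, false) f := by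
  have h : ∀ j : Fin 3, ιc (k, true) (εc (j, false) (εc (j, true) f)) =
      εc (j, false) (εc (j, true) (ιc (k, true) f)) - if j = k then εc (k, false) f else 0 := by
    intro j
    rw [ιc_εc, ιc_εc, if_neg (show ¬(k, true) = (j, false) by simp)]
    by_cases hj : j = k
    · subst hj; simp
    · simp [hj, Ne.symm hj]
  simp only [lef_apply, map_sum, map_smul, h, smul_sub, Finset.sum_sub_distrib, smul_ite,
    smul_zero, Finset.sum_ite_eq', Finset.mem_univ, if_true]

theorem lam0_lef (f : Forms V0) :
    lam0 (lef f) = lef (lam0 f) + (Complex.I / 2) • ((3 : ℂ) • f - ∑ b, εc b (ιc b f)) := by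
  have h : ∀ j : Fin 3, ιc (j, true) (ιc (j, false) (lef f)) =
      lef (ιc (j, true) (ιc (j, false) f)) + (Complex.I / 2) • (f - εc (j, true) (ιc (j, true) f) -
        εc (j, false) (ιc (j, false) f)) := by
    intro j
    rw [ιc_false_lef, map_add, map_smul, ιc_true_lef, ιc_εc]
    simp only [if_true]
    module
  rw [lam0_apply, Finset.sum_congr rfl fun j _ => h j, Finset.sum_add_distrib, lam0_apply,
    map_sum, ← Finset.smul_sum, Fintype.sum_prod_type]
  simp only [Fintype.sum_bool, Fin.sum_univ_three]
  module

/-- `∑ ε_b ι_b` multiplies by the degree, which `lef` raises by two. -/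
theorem number_lef (f : Forms V0) :
    ∑ b, εc b (ιc b (lef f)) = lef (∑ b, εc b (ιc b f)) + (2 : ℂ) • lef f := by
  have hf : ∀ k : Fin 3, εc (k, false) (ιc (k, false) (lef f)) =
      lef (εc (k, false) (ιc (k, false) f)) +
        (Complex.I / 2) • εc (k, false) (εc (k, true) f) := by
    intro k
    rw [ιc_false_lef, map_add, map_smul, lef_εc]
  have ht : ∀ k : Fin 3, εc (k, true) (ιc (k, true) (lef f)) =
      lef (εc (k, true) (ιc (k, true) f)) +
        (Complex.I / 2) • εc (k, false) (εc (k, true) f) := by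
    intro k
    rw [ιc_true_lef, map_sub, map_smul, lef_εc, εc_εc (k, true) (k, false), smul_neg,
      sub_neg_eq_add]
  rw [Fintype.sum_prod_type, Fintype.sum_prod_type, map_sum]
  simp only [Fintype.sum_bool, hf, ht, map_add]
  conv_rhs => rw [lef_apply f]
  simp only [Fin.sum_univ_three]
  module

theorem lam0_oneForm : lam0 oneForm = 0 := by
  simp [lam0_apply, ιc_oneForm]

theorem number_oneForm : ∑ b, εc b (ιc b oneForm) = 0 := by
  simp [ιc_oneForm]

/-- The Lefschetz relation `lam0_lef`, iterated; it fixes the norm of the volume form. -/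
theorem lam0_cube_lef_cube :
    lam0 (lam0 (lam0 (lef (lef (lef oneForm))))) = (-36 * Complex.I / 8) • oneForm := by
  have h1 : lam0 (lef oneForm) = (3 * Complex.I / 2) • oneForm := by
    rw [lam0_lef, lam0_oneForm, number_oneForm, map_zero]
    module
  have n1 : ∑ b, εc b (ιc b (lef oneForm)) = (2 : ℂ) • lef oneForm := by
    rw [number_lef, number_oneForm, map_zero, zero_add]
  have h2 : lam0 (lef (lef oneForm)) = (2 * Complex.I) • lef oneForm := by
    rw [lam0_lef, h1, n1, map_smul]
    module
  have n2 : ∑ b, εc b (ιc b (lef (lef oneForm))) = (4 : ℂ) • lef (lef oneForm) := by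
    rw [number_lef, n1, map_smul]
    module
  have h3 : lam0 (lef (lef (lef oneForm))) = (3 * Complex.I / 2) • lef (lef oneForm) := by
    rw [lam0_lef, h2, n2, map_smul]
    module
  rw [h3, map_smul, map_smul, h2, map_smul, h1, smul_smul, smul_smul]
  congr 1
  have : Complex.I ^ 3 = -Complex.I := Complex.I_pow_three
  linear_combination (9 / 2) * this

/-- The volume form of the model. -/
def vol0 : CForm V0 6 := volForm omega0

/-- The Hodge star of the model. -/
def star0 : Forms V0 →+ Forms V0 := starF vol0

theorem star0_smul (c : ℂ) (f : Forms V0) : star0 (c • f) = starRingEnd ℂ c • star0 f :=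
  starF_smul _ _ _

theorem star0_εc (b : Idx) (f : Forms V0) :
    star0 (εc b f) = (2 : ℂ) • ιc b (parity (star0 f)) := by
  rw [star0, starF_εc, starF_parity]

theorem star0_ιc (b : Idx) (f : Forms V0) :
    star0 (ιc b f) = (-1 / 2 : ℂ) • εc b (parity (star0 f)) := by
  rw [star0, starF_ιc, starF_parity]

theorem star0_parity (f : Forms V0) : star0 (parity f) = parity (star0 f) := starF_parity _ _

theorem star0_lef (f : Forms V0) : star0 (lef f) = (-2 * Complex.I) • lam0 (star0 f) := by
  rw [lef_apply, map_sum, lam0_apply, Finset.smul_sum]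
  refine Finset.sum_congr rfl fun j _ => ?_
  rw [star0_smul, star0_εc, star0_εc, map_smul, parity_ιc, parity_parity, ιc_ιc]
  simp only [map_smul, map_neg, smul_neg, smul_smul, map_div₀, Complex.conj_I,
    Complex.conj_ofNat]
  module

theorem starForm_oneForm (vol : CForm V0 6) (h : 0 + 6 = 6) :
    starForm vol h (oneForm 0) = vol := by
  ext v
  rw [starForm_apply]
  simp only [Nat.factorial_zero, Nat.cast_one, div_one, one_mul, Fintype.sum_unique, oneForm_zero,
    map_one]
  congr 1
  funext a
  have := Fin.append_left_nil (fun a => rb ((default : Fin 0 → Idx) a)) v rfl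
  exact (congrFun this _).trans rfl

theorem ιc_deg_congr {f g : Forms V0} (b : Idx) {k : ℕ} (h : f (k + 1) = g (k + 1)) :
    ιc b f k = ιc b g k := by
  rw [ιc_deg, ιc_deg, h]

theorem lam0_deg_congr {f g : Forms V0} {k : ℕ} (h : f (k + 2) = g (k + 2)) :
    lam0 f k = lam0 g k := by
  rw [lam0_apply, lam0_apply, Forms.sum_deg, Forms.sum_deg]
  exact Finset.sum_congr rfl fun j _ => ιc_deg_congr _ (ιc_deg_congr _ h)

theorem star0_oneForm_six : star0 oneForm 6 = vol0 :=
  (starF_deg vol0 oneForm (show 0 + 6 = 6 from rfl)).trans (starForm_oneForm _ _)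

theorem star0_oneForm_of_ne {k : ℕ} (hk : k ≠ 6) : star0 oneForm k = 0 := by
  by_cases h : 6 < k
  · exact starF_deg_of_lt _ _ h
  · obtain ⟨m, hm⟩ : ∃ m, m + 1 + k = 6 := ⟨5 - k, by omega⟩
    exact (starF_deg vol0 oneForm hm).trans (starForm_zero _ _)

/-- `⋆ ⋆ 1 = 1`, where `⋆ 1` is the volume form and `⋆` exchanges `lef` and `lam0`. -/
theorem star0_star0_oneForm : star0 (star0 oneForm) = oneForm := by
  ext1 k
  by_cases hk : k = 0
  · subst hk
    have h1 : star0 (star0 oneForm) 0 =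
        star0 ((1 / 6 : ℂ) • lef (lef (lef oneForm))) 0 := by
      refine (starF_deg vol0 _ (show 6 + 0 = 6 from rfl)).trans
        (Eq.trans ?_ (starF_deg vol0 _ (show 6 + 0 = 6 from rfl)).symm)
      rw [star0_oneForm_six, vol0, volForm_omega0]
      rfl
    have h2 : lam0 (lam0 (lam0 (star0 oneForm))) 0 =
        lam0 (lam0 (lam0 ((1 / 6 : ℂ) • lef (lef (lef oneForm))))) 0 := by
      refine lam0_deg_congr (lam0_deg_congr (lam0_deg_congr ?_))
      rw [star0_oneForm_six, vol0, volForm_omega0]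
      rfl
    rw [h1, star0_smul, star0_lef, star0_lef, star0_lef]
    simp only [map_smul, Forms.smul_deg] at h2 ⊢
    rw [h2, lam0_cube_lef_cube, Forms.smul_deg]
    simp only [smul_smul]
    conv_rhs => rw [← one_smul ℂ (oneForm 0)]
    congr 1
    simp only [map_div₀, map_one, Complex.conj_ofNat]
    have h4 : Complex.I ^ 4 = 1 := Complex.I_pow_four
    linear_combination h4
  · by_cases h : 6 < k
    · obtain ⟨k, rfl⟩ : ∃ m, k = m + 1 := ⟨k - 1, by omega⟩
      exact starF_deg_of_lt _ _ h
    · obtain ⟨k, rfl⟩ : ∃ m, k = m + 1 := ⟨k - 1, by omega⟩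
      obtain ⟨m, hm⟩ : ∃ m, m + (k + 1) = 6 := ⟨5 - k, by omega⟩
      refine (starF_deg vol0 _ hm).trans ?_
      have : star0 oneForm m = 0 := star0_oneForm_of_ne (by omega)
      rw [this, starForm_zero, oneForm_succ]

theorem star0_star0 (f : Forms V0) : star0 (star0 f) = parity f := by
  induction f using forms_induction with
  | h0 c =>
    rw [star0_smul, star0_smul, star0_star0_oneForm, map_smul, parity_oneForm, Complex.conj_conj]
  | hadd f g hf hg => simp only [map_add, hf, hg]
  | he b f ih =>
    rw [star0_εc, star0_smul, star0_ιc, star0_parity, parity_parity, ih, parity_εc, smul_smul]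
    simp only [Complex.conj_ofNat]
    module

theorem conjF_lef (f : Forms V0) : conjF (lef f) = lef (conjF f) := by
  rw [lef_apply, lef_apply, map_sum]
  refine Finset.sum_congr rfl fun j _ => ?_
  rw [conjF_smul, conjF_εc, conjF_εc, bar_false, bar_true, εc_εc]
  simp only [map_div₀, Complex.conj_I, Complex.conj_ofNat]
  module

theorem conjForm_vol0 : conjForm vol0 = vol0 := by
  rw [vol0, volForm_omega0]
  have : conjF ((1 / 6 : ℂ) • lef (lef (lef oneForm))) =
      (1 / 6 : ℂ) • lef (lef (lef oneForm)) := by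
    rw [conjF_smul, conjF_lef, conjF_lef, conjF_lef, conjF_oneForm, map_div₀, map_one,
      Complex.conj_ofNat]
  exact congrArg (fun f : Forms V0 => f 6) this

theorem conjF_star0 (f : Forms V0) : conjF (star0 f) = star0 (conjF f) := by
  ext1 l
  by_cases h : l ≤ 6
  · refine (congrArg conjForm (starF_deg vol0 _ (Nat.sub_add_cancel h))).trans
      (Eq.trans ?_ (starF_deg vol0 _ (Nat.sub_add_cancel h)).symm)
    ext v
    have hv : ∀ w, vol0 w = starRingEnd ℂ (vol0 w) := fun w => by
      conv_lhs => rw [← conjForm_vol0]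
      rfl
    simp only [conjForm_apply, starForm_apply, map_mul, map_sum, map_div₀, map_one,
      Complex.conj_natCast, conjF_deg, ← hv]
  · refine (congrArg conjForm (starF_deg_of_lt vol0 _ (by omega))).trans
      (Eq.trans ?_ (starF_deg_of_lt vol0 _ (by omega)).symm)
    ext v; simp

theorem conjF_lam0 (f : Forms V0) : conjF (lam0 f) = -lam0 (conjF f) := by
  rw [lam0_apply, lam0_apply, map_sum, ← Finset.sum_neg_distrib]
  refine Finset.sum_congr rfl fun j _ => ?_
  rw [conjF_ιc, conjF_ιc, bar_false, bar_true, ιc_ιc]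

theorem proj_lef (r : ℤ) (f : Forms V0) : proj r (lef f) = lef (proj (r - 1) f) := by
  simp only [lef_apply, map_sum, map_smul, proj_εc, wt_false, wt_true, sub_zero]

/-! ### First-order operators on the model -/

/-- The principal part of the component of Hodge bidegree `(m, 1 - m)` of the exterior derivative,
applied to the first derivatives `x b` of a form in the directions of the frame. -/
def symb (m : ℤ) (x : Idx → Forms V0) : Forms V0 :=
  ∑ b, if wt b = m then εc b (x b) else 0

/-- The zeroth order part of the component of Hodge bidegree `(m, 1 - m)` of the exterior
derivative in a moving frame with connection coefficients `Γ`. -/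
def conn (Γ : Idx → Idx → Idx → ℂ) (m : ℤ) : Module.End ℂ (Forms V0) :=
  ∑ b, ∑ c, ∑ a, if wt b + wt c - wt a = m then Γ b c a • (εc b * εc c * ιc a) else 0

theorem conn_apply (Γ : Idx → Idx → Idx → ℂ) (m : ℤ) (f : Forms V0) :
    conn Γ m f = ∑ b, ∑ c, ∑ a,
      if wt b + wt c - wt a = m then Γ b c a • εc b (εc c (ιc a f)) else 0 := by
  simp only [conn, LinearMap.sum_apply]
  refine Finset.sum_congr rfl fun b _ => Finset.sum_congr rfl fun c _ =>
    Finset.sum_congr rfl fun a _ => ?_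
  split_ifs <;> rfl

theorem proj_symb (r m : ℤ) (x : Idx → Forms V0) :
    proj r (symb m x) = symb m (fun b => proj (r - m) (x b)) := by
  simp only [symb, map_sum]
  refine Finset.sum_congr rfl fun b _ => ?_
  split_ifs with h
  · rw [proj_εc, h]
  · exact map_zero _

theorem proj_conn (Γ : Idx → Idx → Idx → ℂ) (r m : ℤ) (f : Forms V0) :
    proj r (conn Γ m f) = conn Γ m (proj (r - m) f) := by
  simp only [conn_apply, map_sum]
  refine Finset.sum_congr rfl fun b _ => Finset.sum_congr rfl fun c _ =>
    Finset.sum_congr rfl fun a _ => ?_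
  split_ifs with h
  · rw [map_smul, proj_εc, proj_εc, proj_ιc, show r - wt b - wt c + wt a = r - m by omega]
  · exact map_zero _

theorem sum_symb (x : Idx → Forms V0) :
    symb (-1) x + symb 0 x + symb 1 x + symb 2 x = ∑ b, εc b (x b) := by
  simp only [symb, ← Finset.sum_add_distrib]
  refine Finset.sum_congr rfl fun b _ => ?_
  rcases b with ⟨j, _ | _⟩ <;> simp

theorem sum_conn (Γ : Idx → Idx → Idx → ℂ) (f : Forms V0) :
    conn Γ (-1) f + conn Γ 0 f + conn Γ 1 f + conn Γ 2 f =
      ∑ b, ∑ c, ∑ a, Γ b c a • εc b (εc c (ιc a f)) := by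
  simp only [conn_apply, ← Finset.sum_add_distrib]
  refine Finset.sum_congr rfl fun b _ => Finset.sum_congr rfl fun c _ =>
    Finset.sum_congr rfl fun a _ => ?_
  rcases b with ⟨j, _ | _⟩ <;> rcases c with ⟨j', _ | _⟩ <;> rcases a with ⟨j'', _ | _⟩ <;> simp

/-- Reality of the connection coefficients. -/
def IsReal (Γ : Idx → Idx → Idx → ℂ) : Prop :=
  ∀ b c a, Γ (bar b) (bar c) (bar a) = starRingEnd ℂ (Γ b c a)

theorem wt_bar (b : Idx) : wt (bar b) = 1 - wt b := by
  rcases b with ⟨j, _ | _⟩ <;> simp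

theorem bar_involutive : Function.Involutive bar := bar_bar

theorem sum_bar {F : Type*} [AddCommMonoid F] (f : Idx → F) : ∑ b, f (bar b) = ∑ b, f b :=
  Function.Bijective.sum_comp bar_involutive.bijective f

theorem conjF_conn {Γ : Idx → Idx → Idx → ℂ} (hΓ : IsReal Γ) (m : ℤ) (f : Forms V0) :
    conjF (conn Γ m f) = conn Γ (1 - m) (conjF f) := by
  simp only [conn_apply, map_sum]
  rw [← sum_bar]
  refine Finset.sum_congr rfl fun b _ => ?_
  rw [← sum_bar]
  refine Finset.sum_congr rfl fun c _ => ?_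
  rw [← sum_bar]
  refine Finset.sum_congr rfl fun a _ => ?_
  have : (wt (bar b) + wt (bar c) - wt (bar a) = m) ↔ (wt b + wt c - wt a = 1 - m) := by
    simp only [wt_bar]; omega
  simp only [this]
  split_ifs with h
  · rw [conjF_smul, conjF_εc, conjF_εc, conjF_ιc, hΓ, bar_bar, bar_bar, bar_bar,
      Complex.conj_conj]
  · exact map_zero _

theorem oneForm_ne_zero : oneForm ≠ 0 := fun h => by
  have := congrArg (fun f : Forms V0 => f 0 0) h
  simp at this

/-- A quadratic expression in exterior multiplications vanishes if it annihilates `1`. -/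
theorem sum_εc_εc_eq_zero (s : Bool) (X : Fin 3 → Fin 3 → ℂ)
    (h : ∑ b, ∑ c, X b c • εc (b, s) (εc (c, s) oneForm) = 0) (g : Forms V0) :
    ∑ b, ∑ c, X b c • εc (b, s) (εc (c, s) g) = 0 := by
  have hX : ∀ p q, X p q = X q p := by
    intro p q
    have h1 := congrArg (fun f => ιc (q, s) (ιc (p, s) f)) h
    simp only [map_sum, map_smul, ιc_εc, map_sub, ιc_oneForm, map_zero, sub_zero, smul_sub,
      Finset.sum_sub_distrib, Prod.mk.injEq, and_true, apply_ite (ιc (q, s)),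
      apply_ite (εc _), smul_ite, smul_zero] at h1
    have h2 : (X p q - X q p) • oneForm = 0 := by
      rw [sub_smul]
      simpa using h1
    rcases smul_eq_zero.1 h2 with h3 | h3
    · exact sub_eq_zero.1 h3
    · exact absurd h3 oneForm_ne_zero
  refine eq_zero_of_eq_neg_self ?_
  conv_lhs => rw [Finset.sum_comm]
  rw [← Finset.sum_neg_distrib]
  refine Finset.sum_congr rfl fun b _ => ?_
  rw [← Finset.sum_neg_distrib]
  refine Finset.sum_congr rfl fun c _ => ?_
  rw [hX, εc_εc, smul_neg]

theorem sum_rotate {F : Type*} [AddCommMonoid F] {ι : Type*} [Fintype ι] (f : ι → ι → ι → F) :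
    ∑ b, ∑ c, ∑ a, f b c a = ∑ a, ∑ b, ∑ c, f b c a :=
  (Finset.sum_congr rfl fun _ _ => Finset.sum_comm).trans Finset.sum_comm

theorem lef_oneForm : lef oneForm = ∑ j : Fin 3, (Complex.I / 2) •
    εc (j, false) (εc (j, true) oneForm) := lef_apply _

theorem ιc_false_lef_oneForm (k : Fin 3) :
    ιc (k, false) (lef oneForm) = (Complex.I / 2) • εc (k, true) oneForm := by
  rw [ιc_false_lef, ιc_oneForm, map_zero, zero_add]

theorem ιc_true_lef_oneForm (k : Fin 3) :
    ιc (k, true) (lef oneForm) = -((Complex.I / 2) • εc (k, false) oneForm) := by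
  rw [ιc_true_lef, ιc_oneForm, map_zero, zero_sub]

/-- The part of `conn Γ 1` that remains when `conn Γ 1` annihilates the Kähler form: it acts on
the forms `θ_a` and their conjugates through a single tensor, as a unitary connection does. -/
def mixed (Γ : Idx → Idx → Idx → ℂ) (b c a : Fin 3) : ℂ :=
  Γ (b, false) (c, true) (a, true) - Γ (c, true) (b, false) (a, true)

theorem conn_one_apply (Γ : Idx → Idx → Idx → ℂ) (f : Forms V0) :
    conn Γ 1 f = ∑ b, ∑ c, ∑ a,
      (Γ (b, false) (c, false) (a, false) • εc (b, false) (εc (c, false) (ιc (a, false) f)) +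
        mixed Γ b c a • εc (b, false) (εc (c, true) (ιc (a, true) f))) := by
  have h3 : ∑ b, ∑ c, ∑ a, Γ (b, true) (c, false) (a, true) •
        εc (b, true) (εc (c, false) (ιc (a, true) f)) =
      ∑ b, ∑ c, ∑ a, -(Γ (c, true) (b, false) (a, true) •
        εc (b, false) (εc (c, true) (ιc (a, true) f))) := by
    conv_lhs => rw [Finset.sum_comm]
    refine Finset.sum_congr rfl fun b _ => Finset.sum_congr rfl fun c _ =>
      Finset.sum_congr rfl fun a _ => ?_
    rw [εc_εc, smul_neg]
  rw [conn_apply]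
  simp only [Fintype.sum_prod_type, Fintype.sum_bool, wt_false, wt_true]
  norm_num only [if_true, if_false]
  simp only [zero_add, add_zero, Finset.sum_add_distrib, mixed, sub_smul, Finset.sum_sub_distrib,
    Finset.sum_const_zero, h3, Finset.sum_neg_distrib]
  abel

/-- If `conn Γ 1` annihilates the Kähler form, then its coefficients on the `θ_a` are, up to a part
symmetric in the two exterior factors, determined by those on the conjugates of the `θ_a`. -/
theorem conn_one_eq_mixed {Γ : Idx → Idx → Idx → ℂ} (h : conn Γ 1 (lef oneForm) = 0)
    (f : Forms V0) :
    conn Γ 1 f = ∑ b, ∑ c, ∑ a, mixed Γ b c a • (εc (b, false) (εc (c, true) (ιc (a, true) f)) -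
      εc (b, false) (εc (a, false) (ιc (c, false) f))) := by
  -- `X a` is symmetric, because contracting the hypothesis with the conjugate direction `a` gives
  -- `∑ X a b c θ_b θ_c = 0`
  set X : Fin 3 → Fin 3 → Fin 3 → ℂ := fun a b c =>
    Γ (b, false) (c, false) (a, false) + mixed Γ b a c with hX
  have hX0 : ∀ d, ∑ b, ∑ c, X d b c • εc (b, false) (εc (c, false) oneForm) = 0 := by
    intro d
    rw [conn_one_apply] at h
    have h1 : ∑ b, ∑ c, ∑ a, X a b c •
        εc (b, false) (εc (c, false) (εc (a, true) oneForm)) = 0 := by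
      have e1 : ∑ b, ∑ c, ∑ a, mixed Γ b c a •
            εc (b, false) (εc (c, true) (ιc (a, true) (lef oneForm))) =
          ∑ b, ∑ c, ∑ a, (Complex.I / 2) • mixed Γ b a c •
            εc (b, false) (εc (c, false) (εc (a, true) oneForm)) := by
        refine Finset.sum_congr rfl fun b _ => ?_
        rw [Finset.sum_comm]
        refine Finset.sum_congr rfl fun c _ => Finset.sum_congr rfl fun a _ => ?_
        simp only [ιc_true_lef_oneForm, map_neg, map_smul]
        rw [εc_εc (a, true), map_neg]
        module
      simp only [Finset.sum_add_distrib, e1, ιc_false_lef_oneForm] at h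
      refine (smul_eq_zero.1 (?_ : (Complex.I / 2) • _ = (0 : Forms V0))).resolve_left (by simp)
      rw [← h]
      simp only [Finset.smul_sum, ← Finset.sum_add_distrib]
      refine Finset.sum_congr rfl fun b _ => Finset.sum_congr rfl fun c _ =>
        Finset.sum_congr rfl fun a _ => ?_
      simp only [hX, map_smul]
      module
    have h2 := congrArg (ιc (d, true)) h1
    simp only [map_sum, map_smul, map_zero, ιc_εc, ιc_oneForm, sub_zero,
      Prod.mk.injEq, and_true, reduceCtorEq, and_false, if_false, zero_sub, neg_neg, map_neg,
      apply_ite (εc _), smul_ite, smul_zero, Finset.sum_ite_eq, Finset.mem_univ, if_true] at h2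
    exact h2
  have h5 : ∑ b, ∑ c, ∑ a, X a b c • εc (b, false) (εc (c, false) (ιc (a, false) f)) = 0 := by
    rw [sum_rotate]
    exact Finset.sum_eq_zero fun a _ => sum_εc_εc_eq_zero false (X a) (hX0 a) _
  have h6 : ∑ b, ∑ c, ∑ a, mixed Γ b a c • εc (b, false) (εc (c, false) (ιc (a, false) f)) =
      ∑ b, ∑ c, ∑ a, mixed Γ b c a • εc (b, false) (εc (a, false) (ιc (c, false) f)) :=
    Finset.sum_congr rfl fun b _ => Finset.sum_comm
  simp only [hX, add_smul, Finset.sum_add_distrib, h6] at h5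
  rw [conn_one_apply]
  simp only [Finset.sum_add_distrib, smul_sub, Finset.sum_sub_distrib]
  rw [← sub_eq_zero, ← h5]
  abel

/-- The commutator of the contraction `lam0` with the component of bidegree `(1, 0)` of the
exterior derivative is the adjoint of the component of bidegree `(0, 1)`. -/
theorem lam0_bidegree_one {Γ : Idx → Idx → Idx → ℂ} (hΓ : IsReal Γ)
    (h : conn Γ 1 (lef oneForm) = 0) (x : Idx → Forms V0) (f : Forms V0) :
    (-2 : ℂ) • lam0 (symb 1 x + conn Γ 1 f) -
      (symb 1 (fun b => (-2 : ℂ) • lam0 (x b)) + conn Γ 1 ((-2 : ℂ) • lam0 f)) =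
    -star0 (symb 0 (fun b => star0 (x (bar b))) + conn Γ 0 (star0 f)) := by
  have hs : (-2 : ℂ) • lam0 (symb 1 x) - symb 1 (fun b => (-2 : ℂ) • lam0 (x b)) =
      -star0 (symb 0 (fun b => star0 (x (bar b)))) := by
    simp only [symb, Fintype.sum_prod_type, Fintype.sum_bool, wt_false, wt_true, if_true,
      zero_ne_one, one_ne_zero, if_false, zero_add, add_zero, map_sum, lam0_εc_false, map_smul,
      star0_εc, star0_star0, parity_parity, bar_true, Finset.smul_sum, ← Finset.sum_neg_distrib,
      ← Finset.sum_sub_distrib]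
    refine Finset.sum_congr rfl fun b _ => ?_
    module
  have hc : (-2 : ℂ) • lam0 (conn Γ 1 f) - conn Γ 1 ((-2 : ℂ) • lam0 f) =
      -star0 (conn Γ 0 (star0 f)) := by
    have h0 : conn Γ 0 (star0 f) = conjF (conn Γ 1 (conjF (star0 f))) := by
      rw [conjF_conn hΓ, conjF_conjF, sub_self]
    rw [h0, conjF_star0, conn_one_eq_mixed h, conn_one_eq_mixed h, conn_one_eq_mixed h]
    simp only [map_sum, Finset.smul_sum, ← Finset.sum_neg_distrib, ← Finset.sum_sub_distrib]
    refine Finset.sum_congr rfl fun b _ => Finset.sum_congr rfl fun c _ =>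
      Finset.sum_congr rfl fun a _ => ?_
    simp only [conjF_smul, map_sub, conjF_εc, conjF_ιc, conjF_star0, conjF_conjF, bar_true,
      bar_false, star0_smul, star0_εc, star0_ιc, star0_star0, parity_parity,
      map_smul, parity_ιc, parity_εc, Complex.conj_conj, lam0_εc_false, lam0_εc_true, lam0_ιc,
      map_neg, ιc_εc, Prod.mk.injEq, and_true, reduceCtorEq, and_false, if_false]
    rw [ιc_ιc (a, true) (c, false)]
    simp only [map_add, map_neg, eq_comm (a := a) (b := c)]
    module
  calc _ = ((-2 : ℂ) • lam0 (symb 1 x) - symb 1 (fun b => (-2 : ℂ) • lam0 (x b))) +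
        ((-2 : ℂ) • lam0 (conn Γ 1 f) - conn Γ 1 ((-2 : ℂ) • lam0 f)) := by
          rw [map_add, smul_add]; abel
    _ = _ := by rw [hs, hc, map_add, neg_add]

theorem symb_two (x : Idx → Forms V0) : symb 2 x = 0 := by
  refine Finset.sum_eq_zero fun b _ => if_neg ?_
  rcases b with ⟨j, _ | _⟩ <;> simp

theorem symb_neg_one (x : Idx → Forms V0) : symb (-1) x = 0 := by
  refine Finset.sum_eq_zero fun b _ => if_neg ?_
  rcases b with ⟨j, _ | _⟩ <;> simp

theorem conn_neg_one_apply (Γ : Idx → Idx → Idx → ℂ) (f : Forms V0) :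
    conn Γ (-1) f = ∑ b, ∑ c, ∑ a,
      Γ (b, true) (c, true) (a, false) • εc (b, true) (εc (c, true) (ιc (a, false) f)) := by
  rw [conn_apply]
  simp only [Fintype.sum_prod_type, Fintype.sum_bool, wt_false, wt_true]
  norm_num only [if_true, if_false]
  simp only [zero_add, add_zero, Finset.sum_const_zero]

theorem eq_smul_oneForm {f : Forms V0} (h : ∀ k, f (k + 1) = 0) : ∃ t : ℂ, f = t • oneForm := by
  refine ⟨f 0 0, ?_⟩
  ext k v
  cases k with
  | zero => simp [Subsingleton.elim v 0]
  | succ k => rw [h]; simp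

theorem ιc_ιc_lef_lef_oneForm (p q : Fin 3) :
    ιc (q, false) (ιc (p, false) (lef (lef oneForm))) =
      (1 / 2 : ℂ) • εc (p, true) (εc (q, true) oneForm) := by
  have h1 : ιc (p, false) (lef (lef oneForm)) = Complex.I • εc (p, true) (lef oneForm) := by
    rw [ιc_false_lef, ιc_false_lef_oneForm, map_smul, lef_εc]
    module
  rw [h1, map_smul, ιc_εc, if_neg (by simp), ιc_false_lef_oneForm, map_smul, zero_sub, smul_neg,
    smul_smul, ← neg_smul]
  congr 1
  linear_combination (-1 / 2) * Complex.I_mul_I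

/-- If the component of bidegree `(-1, 2)` of the exterior derivative maps a three-form to a
nonzero multiple of the square of the Kähler form, then it is the totally skew tensor of a
nearly Kähler structure. -/
theorem conn_neg_one_eq {Γ : Idx → Idx → Idx → ℂ} {ψ : Forms V0} (hψ : ∀ k, k ≠ 3 → ψ k = 0)
    {c : ℂ} (hc : c ≠ 0) (h : conn Γ (-1) ψ = c • lef (lef oneForm)) :
    ∃ μ : ℂ, ∀ g, conn Γ (-1) g =
      ∑ a : Fin 3, μ • εc (a + 1, true) (εc (a + 2, true) (ιc (a, false) g)) := by
  obtain ⟨t, ht⟩ : ∃ t : ℂ, ιc (2, false) (ιc (1, false) (ιc (0, false) ψ)) = t • oneForm := by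
    refine eq_smul_oneForm fun k => ?_
    have : (0 : Forms V0) (k + 1 + 1 + 1 + 1) = 0 := rfl
    rw [ιc_deg_congr _ (ιc_deg_congr _ (ιc_deg_congr _ ((hψ _ (by omega)).trans this.symm)))]
    simp
  have ht' : ∀ a : Fin 3,
      ιc (a + 2, false) (ιc (a + 1, false) (ιc (a, false) ψ)) = t • oneForm := by
    intro a
    fin_cases a
    · exact ht
    · change ιc (0, false) (ιc (2, false) (ιc (1, false) ψ)) = _
      rw [ιc_ιc (0, false), ιc_ιc (0, false), map_neg, neg_neg, ht]
    · change ιc (1, false) (ιc (0, false) (ιc (2, false) ψ)) = _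
      rw [ιc_ιc (0, false), map_neg, ιc_ιc (1, false), neg_neg, ιc_ιc (1, false), map_neg,
        ← map_neg, ← ιc_ιc, ht]
  -- contract the hypothesis with two of the three holomorphic directions
  have key : ∀ a : Fin 3, t • ∑ b, ∑ c, Γ (b, true) (c, true) (a, false) •
      εc (b, true) (εc (c, true) oneForm) =
      (c / 2) • εc (a + 1, true) (εc (a + 2, true) oneForm) := by
    intro a
    have h1 := congrArg (fun f => ιc (a + 2, false) (ιc (a + 1, false) f)) h
    simp only [map_smul, ιc_ιc_lef_lef_oneForm, conn_neg_one_apply, map_sum, ιc_εc,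
      Prod.mk.injEq, reduceCtorEq, and_false, if_false, zero_sub, map_neg, neg_neg] at h1
    have h2 : ∀ a' : Fin 3, ιc (a + 2, false) (ιc (a + 1, false) (ιc (a', false) ψ)) =
        if a' = a then t • oneForm else 0 := by
      intro a'
      split_ifs with haa
      · rw [haa, ht']
      · have : a' = a + 1 ∨ a' = a + 2 := by
          clear * - haa; revert a a'; decide
        rcases this with rfl | rfl
        · rw [ιc_self, map_zero]
        · rw [ιc_ιc (a + 1, false), map_neg, ιc_self, neg_zero]
    simp only [h2, apply_ite (εc _), map_smul, map_zero, smul_ite, smul_zero, Finset.sum_ite_eq',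
      Finset.mem_univ, if_true] at h1
    rw [Finset.smul_sum]
    simp only [Finset.smul_sum]
    rw [show c / 2 = c * (1 / 2) by ring, mul_smul, ← h1]
    simp only [smul_comm t]
  have ht0 : t ≠ 0 := by
    rintro rfl
    have := congrArg (fun f => ιc (2, true) (ιc (1, true) f)) (key 0)
    simp only [map_smul, zero_smul, map_zero, ιc_εc, Prod.mk.injEq] at this
    simp [ιc_oneForm] at this
    rcases smul_eq_zero.1 this.symm with h0 | h0
    · exact hc (by simpa using h0)
    · exact oneForm_ne_zero (by simpa [ιc_εc, ιc_oneForm] using h0)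
  refine ⟨c / 2 / t, fun g => ?_⟩
  rw [conn_neg_one_apply, sum_rotate]
  refine Finset.sum_congr rfl fun a _ => ?_
  have h3 := sum_εc_εc_eq_zero true (fun b d => Γ (b, true) (d, true) (a, false) -
    if b = a + 1 ∧ d = a + 2 then c / 2 / t else 0)
  have h4 : ∀ g : Forms V0, ∑ b, ∑ d, (Γ (b, true) (d, true) (a, false) -
      if b = a + 1 ∧ d = a + 2 then c / 2 / t else 0) • εc (b, true) (εc (d, true) g) =
      ∑ b, ∑ d, Γ (b, true) (d, true) (a, false) • εc (b, true) (εc (d, true) g) -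
        (c / 2 / t) • εc (a + 1, true) (εc (a + 2, true) g) := by
    intro g
    simp only [sub_smul, Finset.sum_sub_distrib, ite_smul, zero_smul, ite_and]
    simp only [Finset.sum_ite_irrel, Finset.sum_ite_eq', Finset.mem_univ, if_true,
      Finset.sum_const_zero]
  simp only [h4] at h3
  refine sub_eq_zero.1 (h3 ?_ _)
  have h5 : ∀ y z : Forms V0, t • y = (c / 2) • z → y - (c / 2 / t) • z = 0 := by
    intro y z hyz
    rw [sub_eq_zero, div_eq_inv_mul (c / 2), mul_smul, ← hyz, smul_smul, inv_mul_cancel₀ ht0,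
      one_smul]
  exact h5 _ _ (key a)

/-- The commutator of the contraction `lam0` with the component of bidegree `(2, -1)` of the
exterior derivative is twice the adjoint of the component of bidegree `(-1, 2)`. -/
theorem lam0_bidegree_two {Γ : Idx → Idx → Idx → ℂ} (hΓ : IsReal Γ) {μ : ℂ}
    (hμ : ∀ g, conn Γ (-1) g =
      ∑ a : Fin 3, μ • εc (a + 1, true) (εc (a + 2, true) (ιc (a, false) g))) (f : Forms V0) :
    (-2 : ℂ) • lam0 (conn Γ 2 f) - conn Γ 2 ((-2 : ℂ) • lam0 f) =
    (2 : ℂ) • -star0 (conn Γ (-1) (star0 f)) := by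
  have h2 : ∀ g, conn Γ 2 g = ∑ a : Fin 3, starRingEnd ℂ μ •
      εc (a + 1, false) (εc (a + 2, false) (ιc (a, true) g)) := by
    intro g
    have : conn Γ 2 g = conjF (conn Γ (-1) (conjF g)) := by
      rw [conjF_conn hΓ, conjF_conjF]; norm_num
    rw [this, hμ, map_sum]
    refine Finset.sum_congr rfl fun a _ => ?_
    rw [conjF_smul, conjF_εc, conjF_εc, conjF_ιc, conjF_conjF, bar_true, bar_true, bar_false]
  rw [h2, h2, hμ]
  simp only [Fin.sum_univ_three, map_add, map_smul, star0_smul, star0_εc, star0_ιc, star0_star0,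
    parity_parity, parity_ιc, lam0_εc_false, lam0_ιc, map_neg]
  simp only [zero_add, ιc_εc, Prod.mk.injEq, reduceCtorEq, and_false, if_false, zero_sub, map_neg,
    show (1 : Fin 3) + 1 = 2 from rfl, show (1 : Fin 3) + 2 = 0 from rfl,
    show (2 : Fin 3) + 1 = 0 from rfl, show (2 : Fin 3) + 2 = 1 from rfl,
    ιc_ιc (2, true) (0, true), ιc_ιc (1, true) (0, true), ιc_ιc (2, true) (1, true)]
  module

/-! ### Transfer from the model to a Hermitian vector space -/

section Transfer

variable {V : Type*} [AddCommGroup V] [Module ℝ V] [TopologicalSpace V]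
  [IsTopologicalAddGroup V] [ContinuousSMul ℝ V]

/-- The standard inner product of the model. -/
def inner0 (v w : V0) : ℝ := (∑ j, v j * starRingEnd ℂ (w j)).re

theorem inner0_rb (a b : Idx) : inner0 (rb a) (rb b) = if a = b then 1 else 0 := by
  rcases a with ⟨j, _ | _⟩ <;> rcases b with ⟨k, _ | _⟩ <;>
    by_cases h : j = k <;>
    simp [inner0, rb, Pi.single_apply, h, eq_comm (a := k) (b := j)]

/-- `P` identifies the model with the Hermitian vector space `(V, g, J)`. -/
structure IsUnitary (g : V →L[ℝ] V →L[ℝ] ℝ) (J : V →L[ℝ] V) (P : V0 →L[ℝ] V) : Prop where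
  isometry : ∀ v w, g (P v) (P w) = inner0 v w
  comm : ∀ v, J (P v) = P (J0 v)

/-- Pullback of an inhomogeneous form to the model. -/
def pb (P : V0 →L[ℝ] V) (η : ∀ k, CForm V k) : Forms V0 := fun k =>
  (η k).compContinuousLinearMap P

omit [IsTopologicalAddGroup V] [ContinuousSMul ℝ V] in
@[simp] theorem pb_deg (P : V0 →L[ℝ] V) (η : ∀ k, CForm V k) (k : ℕ) :
    pb P η k = (η k).compContinuousLinearMap P := rfl

theorem wedge_comp (P : V0 →L[ℝ] V) {k l : ℕ} (α : CForm V k) (β : CForm V l) :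
    (wedge α β).compContinuousLinearMap P =
      wedge (α.compContinuousLinearMap P) (β.compContinuousLinearMap P) := by
  ext v
  rw [ContinuousAlternatingMap.compContinuousLinearMap_apply, wedge_apply, wedge_apply]
  rfl

theorem wedge_map (P : V0 →L[ℝ] V) {k l : ℕ} (α : CForm V k) (β : CForm V l)
    (v : Fin (k + l) → V0) : wedge α β (P ∘ v) =
      wedge (α.compContinuousLinearMap P) (β.compContinuousLinearMap P) v := by
  rw [← wedge_comp]
  rfl

theorem wedge_wedge_map (P : V0 →L[ℝ] V) {k l m : ℕ} (α : CForm V k) (β : CForm V l)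
    (γ : CForm V m) (v : Fin (k + l + m) → V0) : wedge (wedge α β) γ (P ∘ v) =
      wedge (wedge (α.compContinuousLinearMap P) (β.compContinuousLinearMap P))
        (γ.compContinuousLinearMap P) v := by
  rw [wedge_map, wedge_comp]

theorem volForm_comp (P : V0 →L[ℝ] V) (α : CForm V 2) :
    (volForm α).compContinuousLinearMap P = volForm (α.compContinuousLinearMap P) := by
  ext v
  have h := wedge_wedge_map P α α α
  rw [ContinuousAlternatingMap.compContinuousLinearMap_apply, volForm, volForm,
    ContinuousAlternatingMap.smul_apply, ContinuousAlternatingMap.smul_apply]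
  generalize α.compContinuousLinearMap P = β at *
  generalize wedge (wedge α α) α = A at *
  generalize wedge (wedge β β) β = B at *
  have h2 := h v
  rw [h2]

variable {g : V →L[ℝ] V →L[ℝ] ℝ} {J : V →L[ℝ] V} {P : V0 →L[ℝ] V}

theorem IsUnitary.typePart_comp (hP : IsUnitary g J P) {k : ℕ} (r : ℤ) (α : CForm V k) :
    (typePart J r α).compContinuousLinearMap P = typePart J0 r (α.compContinuousLinearMap P) := by
  by_cases h : 0 ≤ r ∧ r ≤ k
  · ext v
    obtain ⟨m, rfl⟩ : ∃ m : ℕ, r = m := ⟨r.toNat, by omega⟩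
    have hm : m ≤ k := by omega
    rw [ContinuousAlternatingMap.compContinuousLinearMap_apply, typePart_apply J hm,
      typePart_apply J0 hm]
    have hc : ∀ (z : ℂ) (u : V0), cmul J z (P u) = P (cmul J0 z u) := by
      intro z u
      simp [cmul, hP.comm]
    simp only [ContinuousAlternatingMap.compContinuousLinearMap_apply, Function.comp_def, hc]
  · rw [typePart_of_not J h, typePart_of_not J0 h]
    rfl

theorem IsUnitary.hermForm_comp [T2Space V] [FiniteDimensional ℝ V] (hP : IsUnitary g J P)
    (symm : ∀ v w, g v w = g w v) (sq : ∀ v, J (J v) = -v)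
    (isom : ∀ v w, g (J v) (J w) = g v w) :
    (hermForm g J symm sq isom).compContinuousLinearMap P = omega0 := by
  ext v
  rw [omega0_apply]
  change ((g (J (P (v 0))) (P (v 1)) : ℝ) : ℂ) = _
  rw [hP.comm, hP.isometry, inner0, Complex.re_eq_add_conj, map_sum, ← Finset.sum_add_distrib,
    Finset.sum_div]
  refine Finset.sum_congr rfl fun j _ => ?_
  simp
  ring

omit [IsTopologicalAddGroup V] [ContinuousSMul ℝ V] in
theorem IsUnitary.injective (hP : IsUnitary g J P) : Function.Injective P := by
  rw [injective_iff_map_eq_zero]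
  intro v hv
  have h := hP.isometry v v
  rw [hv, map_zero, inner0, Complex.re_sum] at h
  funext j
  have h2 := (Finset.sum_eq_zero_iff_of_nonneg (fun i _ => ?_)).1 h.symm j (Finset.mem_univ j)
  · rw [Complex.mul_conj, Complex.ofReal_re, Complex.normSq_eq_zero] at h2
    simpa using h2
  · rw [Complex.mul_conj, Complex.ofReal_re]
    exact Complex.normSq_nonneg _

/-- The coordinates of the unitary frame `P` in the basis `b`. -/
def frameMatrix (b : Module.Basis (Fin 6) ℝ V) (P : V0 →L[ℝ] V) : Matrix Idx (Fin 6) ℝ :=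
  Matrix.of fun a r => b.repr (P (rb a)) r

omit [IsTopologicalAddGroup V] [ContinuousSMul ℝ V] in
theorem frameMatrix_sum (b : Module.Basis (Fin 6) ℝ V) (P : V0 →L[ℝ] V) (a : Idx) :
    ∑ r, frameMatrix b P a r • b r = P (rb a) := b.sum_repr _

omit [IsTopologicalAddGroup V] [ContinuousSMul ℝ V] in
open scoped Matrix in
/-- The inverse Gram matrix of a basis in terms of an orthonormal frame. -/
theorem IsUnitary.inv_gram (hP : IsUnitary g J P) (b : Module.Basis (Fin 6) ℝ V) (r s : Fin 6) :
    (Matrix.of fun r s => g (b r) (b s))⁻¹ r s =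
      ∑ a, frameMatrix b P a r * frameMatrix b P a s := by
  set G : Matrix (Fin 6) (Fin 6) ℝ := Matrix.of fun r s => g (b r) (b s) with hG
  set Q := frameMatrix b P with hQ
  have h1 : Q * (G * Qᵀ) = 1 := by
    ext a c
    rw [Matrix.one_apply, ← inner0_rb, ← hP.isometry, ← frameMatrix_sum b P a,
      ← frameMatrix_sum b P c]
    simp only [Matrix.mul_apply, Matrix.transpose_apply, map_sum, map_smul,
      _root_.sum_apply, FunLike.coe_smul, Pi.smul_apply, smul_eq_mul, Finset.mul_sum, hG,
        Matrix.of_apply]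
    rw [Finset.sum_comm]
    exact Finset.sum_congr rfl fun _ _ => Finset.sum_congr rfl fun _ _ => by ring
  have h2 : G * Qᵀ * Q = 1 :=
    (Matrix.mul_eq_one_comm_of_card_eq Idx (Fin 6) ℝ (by simp [Fintype.card_prod])).1 h1
  rw [Matrix.mul_assoc] at h2
  rw [Matrix.inv_eq_right_inv h2, Matrix.mul_apply]
  rfl

omit [IsTopologicalAddGroup V] [ContinuousSMul ℝ V] in
theorem multilinear_frame (b : Module.Basis (Fin 6) ℝ V) (P : V0 →L[ℝ] V) {k : ℕ}
    (m : MultilinearMap ℝ (fun _ : Fin k => V) ℂ) (c : Fin k → Idx) :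
    m (fun a => P (rb (c a))) = ∑ i : Fin k → Fin 6,
      ((∏ a, frameMatrix b P (c a) (i a) : ℝ) : ℂ) * m (fun a => b (i a)) := by
  simp only [← frameMatrix_sum b P]
  rw [m.map_sum]
  refine Finset.sum_congr rfl fun i _ => ?_
  rw [m.map_smul_univ, Complex.real_smul]

omit [IsTopologicalAddGroup V] [ContinuousSMul ℝ V] in
/-- Contraction of two multilinear maps with the inverse metric, in an arbitrary basis and in an
orthonormal frame. -/
theorem IsUnitary.contract (hP : IsUnitary g J P) (b : Module.Basis (Fin 6) ℝ V) {k : ℕ}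
    (m n : MultilinearMap ℝ (fun _ : Fin k => V) ℂ) :
    ∑ i : Fin k → Fin 6, ∑ j : Fin k → Fin 6,
      (((∏ a, (Matrix.of fun r s => g (b r) (b s))⁻¹ (i a) (j a) : ℝ) : ℂ) *
        (m (fun a => b (j a)) * n (fun a => b (i a)))) =
    ∑ c : Fin k → Idx, m (fun a => P (rb (c a))) * n (fun a => P (rb (c a))) := by
  have h : ∀ i j : Fin k → Fin 6,
      ∏ a, (Matrix.of fun r s => g (b r) (b s))⁻¹ (i a) (j a) =
      ∑ c : Fin k → Idx, (∏ a, frameMatrix b P (c a) (i a)) *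
        ∏ a, frameMatrix b P (c a) (j a) := by
    intro i j
    simp only [hP.inv_gram b, ← Finset.prod_mul_distrib]
    rw [Finset.prod_univ_sum, Fintype.piFinset_univ]
  simp only [h, multilinear_frame b P, Complex.ofReal_sum, Finset.sum_mul, Finset.mul_sum]
  rw [Finset.sum_comm, Finset.sum_congr rfl fun j _ => Finset.sum_comm, Finset.sum_comm]
  refine Finset.sum_congr rfl fun c _ => ?_
  rw [Finset.sum_comm]
  refine Finset.sum_congr rfl fun i _ => Finset.sum_congr rfl fun j _ => ?_
  push_cast
  ring

/-- `insertFirst` as a multilinear map of the inserted vectors. -/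
def insertFirstMap {k l n : ℕ} (h : k + l = n) (τ : CForm V n) (v : Fin l → V) :
    MultilinearMap ℝ (fun _ : Fin k => V) ℂ where
  toFun u := τ (fun a => Fin.append u v (Fin.cast h.symm a))
  map_update_add' := by
    subst h
    intro dec u j x y
    have h1 : ∀ z, (fun a => Fin.append (Function.update u j z) v (Fin.cast rfl a))
        = Function.update (Fin.append u v) (Fin.castAdd l j) z := fun z => by
      funext a
      refine Fin.addCases (fun a => ?_) (fun a => ?_) a
      · by_cases haj : a = j
        · subst haj; simp
        · simp [haj]
      · simp only [Fin.cast_eq_self, Fin.append_right]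
        rw [Function.update_of_ne (by simp [Fin.ext_iff]; omega), Fin.append_right]
    simp only [h1, ContinuousAlternatingMap.map_update_add]
  map_update_smul' := by
    subst h
    intro dec u j x y
    have h1 : ∀ z, (fun a => Fin.append (Function.update u j z) v (Fin.cast rfl a))
        = Function.update (Fin.append u v) (Fin.castAdd l j) z := fun z => by
      funext a
      refine Fin.addCases (fun a => ?_) (fun a => ?_) a
      · by_cases haj : a = j
        · subst haj; simp
        · simp [haj]
      · simp only [Fin.cast_eq_self, Fin.append_right]
        rw [Function.update_of_ne (by simp [Fin.ext_iff]; omega), Fin.append_right]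
    simp only [h1, ContinuousAlternatingMap.map_update_smul]

omit [IsTopologicalAddGroup V] [ContinuousSMul ℝ V] in
theorem append_comp (P : V0 →L[ℝ] V) {k l n : ℕ} (h : k + l = n) (u : Fin k → V0) (v : Fin l → V0) :
    (fun a => Fin.append (fun i => P (u i)) (fun j => P (v j)) (Fin.cast h.symm a)) =
      fun a => P (Fin.append u v (Fin.cast h.symm a)) := by
  subst h
  funext a
  refine Fin.addCases (fun a => ?_) (fun a => ?_) a <;> simp

omit [IsTopologicalAddGroup V] [ContinuousSMul ℝ V] in
/-- The Hodge star does not depend on the basis in which it is computed. -/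
theorem IsUnitary.hodgeStar_comp (hP : IsUnitary g J P) (b : Module.Basis (Fin 6) ℝ V)
    (vol : CForm V 6) {k l : ℕ} (h : k + l = 6) (β : CForm V k) :
    (hodgeStar b g vol h β).compContinuousLinearMap P =
      starForm (vol.compContinuousLinearMap P) h (β.compContinuousLinearMap P) := by
  ext v
  have hc := hP.contract b (conjForm β).toMultilinearMap
    (insertFirstMap h vol (fun j => P (v j)))
  rw [starForm_apply, ContinuousAlternatingMap.compContinuousLinearMap_apply, hodgeStar,
    ContinuousAlternatingMap.smul_apply, smul_eq_mul]
  congr 1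
  simp only [ContinuousAlternatingMap.sum_apply, ContinuousAlternatingMap.smul_apply, smul_eq_mul]
  have e1 : ∀ c : Fin k → Idx, vol.compContinuousLinearMap P
      (fun a => Fin.append (fun a => rb (c a)) v (Fin.cast h.symm a)) =
      insertFirstMap h vol (fun j => P (v j)) (fun a => P (rb (c a))) := by
    intro c
    exact (congrArg vol (append_comp P h (fun a => rb (c a)) v)).symm
  simp only [e1]
  refine Eq.trans ?_ hc
  exact Finset.sum_congr rfl fun i _ => Finset.sum_congr rfl fun j _ => mul_assoc _ _ _

/-- The contraction of a form with the Kähler form of `(g, J)`, normalised so that it corresponds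
to `-2 • lam0`. -/
def contractForm (b : Module.Basis (Fin 6) ℝ V) (g : V →L[ℝ] V →L[ℝ] ℝ) (J : V →L[ℝ] V) {k : ℕ}
    (β : CForm V (k + 2)) : CForm V k :=
  (-Complex.I / 2) • ∑ i, ∑ j, (((Matrix.of fun r s => g (b r) (b s))⁻¹ i j : ℝ) : ℂ) •
    insertFirst (Nat.add_comm 2 k) β ![b i, J (b j)]

theorem append_pair {X : Type*} {k : ℕ} (x y : X) (v : Fin k → X) :
    (fun a => Fin.append ![x, y] v (Fin.cast (Nat.add_comm 2 k).symm a)) =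
      Matrix.vecCons x (Matrix.vecCons y v) := by
  funext a
  refine Fin.cases ?_ (fun a => ?_) a
  · exact Fin.append_left ![x, y] v 0
  · refine Fin.cases ?_ (fun a => ?_) a
    · exact Fin.append_left ![x, y] v 1
    · have : Fin.cast (Nat.add_comm 2 k).symm a.succ.succ = Fin.natAdd 2 a := by
        ext; simp; omega
      rw [this, Fin.append_right]
      rfl

/-- The contraction in terms of the real orthonormal basis. -/
theorem lam0_eq_sum_rb (f : Forms V0) :
    lam0 f = (Complex.I / 4) • ∑ a, iota (J0 (rb a)) (iota (rb a) f) := by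
  have hJ : ∀ j, J0 (rb (j, true)) = (-1 : ℝ) • rb (j, false) := by
    intro j
    funext k
    by_cases h : k = j <;> simp [rb, h]
  have hJ' : ∀ j, J0 (rb (j, false)) = rb (j, true) := by
    intro j
    funext k
    by_cases h : k = j <;> simp [rb, h]
  have hsw : ∀ x y, iota x (iota y f) = -iota y (iota x f) := by
    intro x y
    exact eq_neg_of_add_eq_zero_left (LinearMap.congr_fun (iota_iota x y) f)
  have hself : ∀ x, iota x (iota x f) = 0 := fun x => eq_zero_of_eq_neg_self (hsw x x)
  rw [lam0_apply, Fintype.sum_prod_type, Finset.smul_sum]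
  refine Finset.sum_congr rfl fun j _ => ?_
  rw [Fintype.sum_bool, hJ, hJ', iota_smul, LinearMap.smul_apply,
    hsw (rb (j, false)) (rb (j, true))]
  simp only [ιc, cval, sgnI, LinearMap.smul_apply, LinearMap.add_apply, map_add, map_smul, hself,
    hsw (rb (j, false)) (rb (j, true))]
  push_cast
  module

omit [IsTopologicalAddGroup V] [ContinuousSMul ℝ V] in
theorem IsUnitary.contract_bilin (hP : IsUnitary g J P) (b : Module.Basis (Fin 6) ℝ V)
    (Φ : V →ₗ[ℝ] V →ₗ[ℝ] ℂ) :
    ∑ i, ∑ j, (((Matrix.of fun r s => g (b r) (b s))⁻¹ i j : ℝ) : ℂ) * Φ (b i) (b j) =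
      ∑ a, Φ (P (rb a)) (P (rb a)) := by
  simp only [hP.inv_gram b, ← frameMatrix_sum b P, map_sum, map_smul,
    Complex.ofReal_sum, Finset.sum_mul, Complex.real_smul,
    LinearMap.sum_apply, LinearMap.smul_apply, Finset.mul_sum]
  rw [Finset.sum_congr rfl fun i _ => Finset.sum_comm, Finset.sum_comm]
  refine Finset.sum_congr rfl fun a _ => ?_
  rw [Finset.sum_comm]
  refine Finset.sum_congr rfl fun i _ => Finset.sum_congr rfl fun j _ => ?_
  push_cast
  ring

/-- A multilinear map of two variables as a bilinear map. -/
def bilinOfPair (m : MultilinearMap ℝ (fun _ : Fin 2 => V) ℂ) (J : V →L[ℝ] V) :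
    V →ₗ[ℝ] V →ₗ[ℝ] ℂ :=
  have h0 : ∀ x y z : V, ![z, y] = Function.update ![x, y] 0 z := fun x y z => by
    funext i; fin_cases i <;> rfl
  have h1 : ∀ x y z : V, ![x, z] = Function.update ![x, y] 1 z := fun x y z => by
    funext i; fin_cases i <;> rfl
  LinearMap.mk₂ ℝ (fun x y => m ![x, J y])
    (fun x x' y => by
      rw [h0 x _ (x + x'), m.map_update_add, ← h0, ← h0])
    (fun c x y => by
      rw [h0 x _ (c • x), m.map_update_smul, ← h0])
    (fun x y y' => by
      rw [map_add, h1 x (J y) (J y + J y'), m.map_update_add, ← h1, ← h1])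
    (fun c x y => by
      rw [map_smul, h1 x (J y) (c • J y), m.map_update_smul, ← h1])

omit [IsTopologicalAddGroup V] [ContinuousSMul ℝ V] in
theorem IsUnitary.contractForm_comp (hP : IsUnitary g J P) (b : Module.Basis (Fin 6) ℝ V)
    (η : ∀ k, CForm V k) (k : ℕ) :
    (contractForm b g J (η (k + 2))).compContinuousLinearMap P = ((-2 : ℂ) • lam0 (pb P η)) k := by
  ext v
  have hc := hP.contract_bilin b
    (bilinOfPair (insertFirstMap (Nat.add_comm 2 k) (η (k + 2)) (P ∘ v)) J)
  rw [lam0_eq_sum_rb, smul_smul, Forms.smul_deg, Forms.sum_deg,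
    ContinuousAlternatingMap.smul_apply, ContinuousAlternatingMap.sum_apply,
    ContinuousAlternatingMap.compContinuousLinearMap_apply, contractForm,
    ContinuousAlternatingMap.smul_apply]
  have h2 : ∀ a, iota (J0 (rb a)) (iota (rb a) (pb P η)) k v =
      bilinOfPair (insertFirstMap (Nat.add_comm 2 k) (η (k + 2)) (P ∘ v)) J (P (rb a))
        (P (rb a)) := by
    intro a
    rw [iota_deg, iota_deg, iotaForm_apply, iotaForm_apply, pb_deg,
      ContinuousAlternatingMap.compContinuousLinearMap_apply]
    refine Eq.trans ?_ (congrArg (η (k + 2)) (append_pair (P (rb a)) (J (P (rb a))) (P ∘ v))).symm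
    rw [hP.comm]
    congr 1
    funext i
    refine Fin.cases rfl (fun i => Fin.cases rfl (fun i => rfl) i) i
  simp only [h2, ← hc, ContinuousAlternatingMap.sum_apply, ContinuousAlternatingMap.smul_apply,
    smul_eq_mul]
  congr 1
  ring

end Transfer

/-! ### Smooth families of alternating forms -/

section SmoothFamilies

variable {X E : Type*} [NormedAddCommGroup X] [NormedSpace ℝ X] [NormedAddCommGroup E]
  [NormedSpace ℝ E] [FiniteDimensional ℝ E]

/-- Evaluation of forms on all tuples of basis vectors. -/
def evalBasis (E : Type*) [NormedAddCommGroup E] [NormedSpace ℝ E] [FiniteDimensional ℝ E] (k : ℕ) :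
    CForm E k →ₗ[ℝ] ((Fin k → Fin (Module.finrank ℝ E)) → ℂ) where
  toFun f := fun i => f (fun a => Module.finBasis ℝ E (i a))
  map_add' _ _ := rfl
  map_smul' _ _ := rfl

theorem evalBasis_injective (k : ℕ) : Function.Injective (evalBasis E k) := by
  intro f g h
  apply ContinuousAlternatingMap.toAlternatingMap_injective
  refine Module.Basis.ext_alternating (Module.finBasis ℝ E) fun i _ => ?_
  exact congrFun h i

theorem contDiffAt_cform_iff {k : ℕ} {f : X → CForm E k} {x : X} :
    ContDiffAt ℝ ∞ f x ↔ ∀ v, ContDiffAt ℝ ∞ (fun y => f y v) x := by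
  constructor
  · intro h v
    exact ((ContinuousAlternatingMap.apply ℝ E ℂ v).contDiff.contDiffAt.comp x h)
  · intro h
    obtain ⟨L, hL⟩ := (evalBasis E k).exists_leftInverse_of_injective
      (LinearMap.ker_eq_bot.2 (evalBasis_injective k))
    have h1 : ContDiffAt ℝ ∞ (fun y => evalBasis E k (f y)) x := contDiffAt_pi.2 fun i => h _
    have h2 := (LinearMap.toContinuousLinearMap L).contDiff.contDiffAt.comp x h1
    refine h2.congr_of_eventuallyEq (Filter.Eventually.of_forall fun y => ?_)
    exact (LinearMap.congr_fun hL (f y)).symm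

theorem ContDiffAt.cform_apply {k : ℕ} {f : X → CForm E k} {x : X} {v : Fin k → X → E}
    (hf : ContDiffAt ℝ ∞ f x) (hv : ∀ i, ContDiffAt ℝ ∞ (v i) x) :
    ContDiffAt ℝ ∞ (fun y => f y (fun i => v i y)) x := by
  set b := Module.finBasis ℝ E
  have h : ∀ y, f y (fun i => v i y) = ∑ r : Fin k → Fin (Module.finrank ℝ E),
      (∏ i, b.coord (r i) (v i y)) • f y (fun i => b (r i)) := by
    intro y
    have e : (fun i => v i y) = fun i => ∑ j, b.coord j (v i y) • b j := by
      funext i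
      exact (b.sum_repr (v i y)).symm
    rw [e]
    have := (f y).toMultilinearMap.map_sum (fun i j => b.coord j (v i y) • b j)
    refine this.trans (Finset.sum_congr rfl fun r _ => ?_)
    exact (f y).toMultilinearMap.map_smul_univ _ _
  simp only [h]
  refine ContDiffAt.sum fun r _ => ContDiffAt.fun_smul ?_ (contDiffAt_cform_iff.1 hf _)
  refine contDiffAt_prod fun i _ => ?_
  exact (LinearMap.toContinuousLinearMap (b.coord (r i))).contDiff.contDiffAt.comp x (hv i)

theorem ContDiffAt.cform_comp {F : Type*} [NormedAddCommGroup F] [NormedSpace ℝ F]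
    [FiniteDimensional ℝ F] {k : ℕ} {f : X → CForm E k} {A : X → F →L[ℝ] E}
    {x : X} (hf : ContDiffAt ℝ ∞ f x) (hA : ContDiffAt ℝ ∞ A x) :
    ContDiffAt ℝ ∞ (fun y => (f y).compContinuousLinearMap (A y)) x := by
  rw [contDiffAt_cform_iff]
  intro v
  exact ContDiffAt.cform_apply (v := fun i y => A y (v i)) hf
    fun i => hA.clm_apply contDiffAt_const

omit [FiniteDimensional ℝ E] in
theorem ContDiffAt.extDeriv {k : ℕ} {f : E → CForm E k} {x : E} (hf : ContDiffAt ℝ ∞ f x) :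
    ContDiffAt ℝ ∞ (extDeriv f) x :=
  ((ContinuousAlternatingMap.alternatizeUncurryFinCLM ℝ E ℂ).contDiff.contDiffAt.comp x
    (hf.fderiv_right (m := ∞) (by simp)) :)

end SmoothFamilies

theorem two_le_infty : minSmoothness ℝ 2 ≤ ∞ := by
  rw [minSmoothness_of_isRCLikeNormedField]
  exact WithTop.coe_le_coe.2 le_top

/-! ### Differential forms in charts -/

section Charts

variable {M : Type*} [TopologicalSpace M] [ChartedSpace E6 M]

/-- The derivative of the inverse of the chart around `x₀`. -/
def chartDeriv (x₀ : M) (y : E6) : E6 →L[ℝ] E6 :=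
  mfderiv 𝓘(ℝ, E6) (𝓡 6) (extChartAt (𝓡 6) x₀).symm y

/-- The value of a form at `p`, as a form on the model space, with which Mathlib identifies the
tangent space at `p`. -/
def formAt {k : ℕ} (η : DForm M k) (p : M) : CForm E6 k := η p

/-- The derivative of the chart around `z` at `p`. -/
def chartMap (z p : M) : E6 →L[ℝ] E6 := mfderiv (𝓡 6) 𝓘(ℝ, E6) (extChartAt (𝓡 6) z) p

theorem inChart_eq {k : ℕ} (η : DForm M k) (x₀ : M) (y : E6) {p : M}
    (hp : (extChartAt (𝓡 6) x₀).symm y = p) :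
    inChart η x₀ y = (formAt η p).compContinuousLinearMap (chartDeriv x₀ y) := by
  subst hp
  rfl

/-- The transition map from the chart around `x₀` to the chart around `z`. -/
def transition (x₀ z : M) : E6 → E6 := fun y => extChartAt (𝓡 6) z ((extChartAt (𝓡 6) x₀).symm y)

variable [IsManifold (𝓡 6) ∞ M]

theorem mdifferentiableAt_chart_symm {x₀ : M} {y : E6} (hy : y ∈ (extChartAt (𝓡 6) x₀).target) :
    MDifferentiableAt 𝓘(ℝ, E6) (𝓡 6) (extChartAt (𝓡 6) x₀).symm y := by
  have : IsManifold (𝓡 6) 1 M := IsManifold.of_le (n := ∞) (by simp)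
  have h := mdifferentiableWithinAt_extChartAt_symm (I := 𝓡 6) hy
  rwa [ModelWithCorners.range_eq_univ, mdifferentiableWithinAt_univ] at h

theorem mdifferentiableAt_chart {z p : M} (hp : p ∈ (extChartAt (𝓡 6) z).source) :
    MDifferentiableAt (𝓡 6) 𝓘(ℝ, E6) (extChartAt (𝓡 6) z) p := by
  have : IsManifold (𝓡 6) 1 M := IsManifold.of_le (n := ∞) (by simp)
  exact mdifferentiableAt_extChartAt (by rwa [← extChartAt_source (𝓡 6)])

theorem contDiffAt_transition {x₀ z : M} {y : E6} (hy : y ∈ (extChartAt (𝓡 6) x₀).target)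
    (hz : (extChartAt (𝓡 6) x₀).symm y ∈ (extChartAt (𝓡 6) z).source) :
    ContDiffAt ℝ ∞ (transition x₀ z) y := by
  rw [← contMDiffAt_iff_contDiffAt]
  have h1 : ContMDiffAt 𝓘(ℝ, E6) (𝓡 6) ∞ (extChartAt (𝓡 6) x₀).symm y :=
    (contMDiffOn_extChartAt_symm x₀).contMDiffAt ((isOpen_extChartAt_target x₀).mem_nhds hy)
  have h2 : ContMDiffAt (𝓡 6) 𝓘(ℝ, E6) ∞ (extChartAt (𝓡 6) z) ((extChartAt (𝓡 6) x₀).symm y) :=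
    contMDiffAt_extChartAt' (by rwa [← extChartAt_source (𝓡 6)])
  exact h2.comp y h1

theorem eventually_mem_chart {x₀ : M} {y : E6} (hy : y ∈ (extChartAt (𝓡 6) x₀).target) (z : M)
    (hz : (extChartAt (𝓡 6) x₀).symm y ∈ (extChartAt (𝓡 6) z).source) :
    ∀ᶠ y' in nhds y, y' ∈ (extChartAt (𝓡 6) x₀).target ∧
      (extChartAt (𝓡 6) x₀).symm y' ∈ (extChartAt (𝓡 6) z).source := by
  refine Filter.Eventually.and ((isOpen_extChartAt_target x₀).mem_nhds hy) ?_
  exact (mdifferentiableAt_chart_symm hy).continuousAt ((isOpen_extChartAt_source z).mem_nhds hz)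

theorem chartDeriv_transition {x₀ z : M} {y : E6} (hy : y ∈ (extChartAt (𝓡 6) x₀).target)
    (hz : (extChartAt (𝓡 6) x₀).symm y ∈ (extChartAt (𝓡 6) z).source) :
    chartDeriv x₀ y = (chartDeriv z (transition x₀ z y)).comp (fderiv ℝ (transition x₀ z) y) := by
  have hev : (extChartAt (𝓡 6) x₀).symm =ᶠ[nhds y]
      (extChartAt (𝓡 6) z).symm ∘ transition x₀ z := by
    filter_upwards [eventually_mem_chart hy z hz] with y' h
    exact ((extChartAt (𝓡 6) z).left_inv h.2).symm
  have hd : MDifferentiableAt 𝓘(ℝ, E6) 𝓘(ℝ, E6) (transition x₀ z) y :=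
    ((contDiffAt_transition hy hz).differentiableAt (by simp)).mdifferentiableAt
  have h := mfderiv_comp y (mdifferentiableAt_chart_symm (x₀ := z) (y := transition x₀ z y)
    ((extChartAt (𝓡 6) z).map_source hz)) hd
  rw [mfderiv_eq_fderiv] at h
  exact (hev.mfderiv_eq).trans h

theorem mfderiv_chart_comp_chartDeriv {x₀ z : M} {y : E6}
    (hy : y ∈ (extChartAt (𝓡 6) x₀).target)
    (hz : (extChartAt (𝓡 6) x₀).symm y ∈ (extChartAt (𝓡 6) z).source) :
    (chartMap z ((extChartAt (𝓡 6) x₀).symm y)).comp (chartDeriv x₀ y) =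
      fderiv ℝ (transition x₀ z) y := by
  have h := mfderiv_comp y (mdifferentiableAt_chart hz) (mdifferentiableAt_chart_symm hy)
  have h2 : mfderiv 𝓘(ℝ, E6) 𝓘(ℝ, E6) (transition x₀ z) y = fderiv ℝ (transition x₀ z) y :=
    mfderiv_eq_fderiv
  exact h.symm.trans h2

theorem inChart_transition {k : ℕ} (η : DForm M k) {x₀ z : M} {y : E6}
    (hy : y ∈ (extChartAt (𝓡 6) x₀).target)
    (hz : (extChartAt (𝓡 6) x₀).symm y ∈ (extChartAt (𝓡 6) z).source) :
    inChart η x₀ y = (inChart η z (transition x₀ z y)).compContinuousLinearMap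
      (fderiv ℝ (transition x₀ z) y) := by
  rw [inChart_eq η x₀ y rfl, inChart_eq η z (transition x₀ z y)
    ((extChartAt (𝓡 6) z).left_inv hz), chartDeriv_transition hy hz]
  rfl

theorem isSmoothForm_iff {k : ℕ} {η : DForm M k} :
    IsSmoothForm η ↔ ∀ x, ContDiffAt ℝ ∞ (inChart η x) (extChartAt (𝓡 6) x x) := by
  constructor
  · intro h x
    exact (h x).contDiffAt (extChartAt_target_mem_nhds x)
  · intro h x₀ y hy
    refine ContDiffAt.contDiffWithinAt ?_
    set z := (extChartAt (𝓡 6) x₀).symm y with hz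
    have hzs : (extChartAt (𝓡 6) x₀).symm y ∈ (extChartAt (𝓡 6) z).source :=
      mem_extChartAt_source z
    have ht := contDiffAt_transition hy hzs
    have h1 : ContDiffAt ℝ ∞ (fun y => (inChart η z (transition x₀ z y)).compContinuousLinearMap
        (fderiv ℝ (transition x₀ z) y)) y :=
      ContDiffAt.cform_comp (ContDiffAt.comp y
        (show ContDiffAt ℝ ∞ (inChart η z) (transition x₀ z y) from h z) ht)
        (ht.fderiv_right (m := ∞) (by simp))
    refine h1.congr_of_eventuallyEq ?_
    filter_upwards [eventually_mem_chart hy z hzs] with y' h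
    exact inChart_transition η h.1 h.2

omit [IsManifold (𝓡 6) ∞ M] in
theorem IsSmoothForm.contDiffAt {k : ℕ} {η : DForm M k} (h : IsSmoothForm η) (x₀ : M) {y : E6}
    (hy : y ∈ (extChartAt (𝓡 6) x₀).target) : ContDiffAt ℝ ∞ (inChart η x₀) y :=
  (h x₀).contDiffAt ((isOpen_extChartAt_target x₀).mem_nhds hy)

/-- The de Rham differential may be computed in any chart. -/
theorem inChart_deRham {k : ℕ} {η : DForm M k} (h : IsSmoothForm η) (x₀ : M) {y : E6}
    (hy : y ∈ (extChartAt (𝓡 6) x₀).target) :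
    inChart (deRham η) x₀ y = extDeriv (inChart η x₀) y := by
  set z := (extChartAt (𝓡 6) x₀).symm y with hz
  have hzs : (extChartAt (𝓡 6) x₀).symm y ∈ (extChartAt (𝓡 6) z).source :=
    mem_extChartAt_source z
  have hev : inChart η x₀ =ᶠ[nhds y] fun y =>
      (inChart η z (transition x₀ z y)).compContinuousLinearMap (fderiv ℝ (transition x₀ z) y) := by
    filter_upwards [eventually_mem_chart hy z hzs] with y' h
    exact inChart_transition η h.1 h.2
  have hd : DifferentiableAt ℝ (inChart η z) (transition x₀ z y) :=
    (h.contDiffAt z (mem_extChartAt_target z)).differentiableAt (by simp)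
  rw [hev.extDeriv_eq, extDeriv_pullback (f := transition x₀ z) (r := ∞) hd
    (contDiffAt_transition hy hzs) two_le_infty, ← mfderiv_chart_comp_chartDeriv hy hzs]
  rfl

theorem isSmoothForm_deRham {k : ℕ} {η : DForm M k} (h : IsSmoothForm η) :
    IsSmoothForm (deRham η) := by
  intro x₀ y hy
  refine ContDiffAt.contDiffWithinAt ?_
  refine (ContDiffAt.extDeriv (h.contDiffAt x₀ hy)).congr_of_eventuallyEq ?_
  filter_upwards [(isOpen_extChartAt_target x₀).mem_nhds hy] with y' hy'
  exact inChart_deRham h x₀ hy'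

theorem chartDeriv_self (x : M) :
    chartDeriv x (extChartAt (𝓡 6) x x) = ContinuousLinearMap.id ℝ E6 := by
  have : IsManifold (𝓡 6) 1 M := IsManifold.of_le (n := ∞) (by simp)
  have h := mfderivWithin_range_extChartAt_symm (I := 𝓡 6) (x := x)
  rw [ModelWithCorners.range_eq_univ, mfderivWithin_univ] at h
  exact h

theorem inChart_self {k : ℕ} (η : DForm M k) (x : M) :
    inChart η x (extChartAt (𝓡 6) x x) = formAt η x := by
  rw [inChart_eq η x _ (extChartAt_to_inv x), chartDeriv_self]
  ext v
  rfl

theorem deRham_apply_self {k : ℕ} {η : DForm M k} (h : IsSmoothForm η) (x : M) :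
    formAt (deRham η) x = extDeriv (inChart η x) (extChartAt (𝓡 6) x x) :=
  (inChart_self (deRham η) x).symm.trans (inChart_deRham h x (mem_extChartAt_target x))

theorem deRham_deRham {k : ℕ} {η : DForm M k} (h : IsSmoothForm η) : deRham (deRham η) = 0 := by
  funext x
  refine (deRham_apply_self (isSmoothForm_deRham h) x).trans ?_
  have hev : inChart (deRham η) x =ᶠ[nhds (extChartAt (𝓡 6) x x)] extDeriv (inChart η x) := by
    filter_upwards [extChartAt_target_mem_nhds x] with y hy
    exact inChart_deRham h x hy
  rw [hev.extDeriv_eq]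
  exact extDeriv_extDeriv_apply (r := ∞) (h.contDiffAt x (mem_extChartAt_target x)) two_le_infty

end Charts

/-! ### Almost Hermitian structures in charts -/

section ClmSmooth

variable {X F G : Type*} [NormedAddCommGroup X] [NormedSpace ℝ X] [NormedAddCommGroup F]
  [NormedSpace ℝ F] [FiniteDimensional ℝ F] [NormedAddCommGroup G] [NormedSpace ℝ G]

theorem contDiffAt_clm_of_apply {A : X → F →L[ℝ] G} {x : X}
    (h : ∀ v, ContDiffAt ℝ ∞ (fun y => A y v) x) : ContDiffAt ℝ ∞ A x := by
  set b := Module.finBasis ℝ F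
  have e : ∀ y, A y = ∑ i, ContinuousLinearMap.smulRightL ℝ F G
      (LinearMap.toContinuousLinearMap (b.coord i)) (A y (b i)) := by
    intro y
    ext v
    conv_lhs => rw [← b.sum_repr v, map_sum]
    rw [sum_apply]
    refine Finset.sum_congr rfl fun i _ => ?_
    rw [map_smul]
    rfl
  have : A = fun y => ∑ i, ContinuousLinearMap.smulRightL ℝ F G
      (LinearMap.toContinuousLinearMap (b.coord i)) (A y (b i)) := funext e
  rw [this]
  refine ContDiffAt.sum fun i _ => ?_
  exact (ContinuousLinearMap.contDiff _).contDiffAt.comp x (h (b i))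

end ClmSmooth

section LocalGeometry

variable {M : Type*} [TopologicalSpace M] [ChartedSpace E6 M] [IsManifold (𝓡 6) ∞ M]
  (H : AlmostHermitian M)

/-- The metric at `p`, on the model space identified with the tangent space at `p`. -/
def metricForm (p : M) : E6 →L[ℝ] E6 →L[ℝ] ℝ := H.g.inner p

/-- The almost complex structure at `p`, on the model space identified with the tangent space. -/
def acs (p : M) : E6 →L[ℝ] E6 := H.J p

/-- The metric in the chart around `x`. -/
def chartMetric (x : M) (y : E6) : E6 →L[ℝ] E6 →L[ℝ] ℝ :=
  (metricForm H ((extChartAt (𝓡 6) x).symm y)).bilinearComp (chartDeriv x y) (chartDeriv x y)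

/-- The almost complex structure in the chart around `x`. -/
def chartAcs (x : M) (y : E6) : E6 →L[ℝ] E6 :=
  (chartMap x ((extChartAt (𝓡 6) x).symm y)).comp
    ((acs H ((extChartAt (𝓡 6) x).symm y)).comp (chartDeriv x y))

theorem chartMap_chartDeriv {x : M} {y : E6} (hy : y ∈ (extChartAt (𝓡 6) x).target) (v : E6) :
    chartMap x ((extChartAt (𝓡 6) x).symm y) (chartDeriv x y v) = v := by
  have : IsManifold (𝓡 6) 1 M := IsManifold.of_le (n := ∞) (by simp)
  have h := mfderiv_extChartAt_comp_mfderivWithin_extChartAt_symm (I := 𝓡 6) hy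
  rw [ModelWithCorners.range_eq_univ, mfderivWithin_univ] at h
  exact DFunLike.congr_fun h v

theorem chartDeriv_chartMap {x : M} {y : E6} (hy : y ∈ (extChartAt (𝓡 6) x).target) (v : E6) :
    chartDeriv x y (chartMap x ((extChartAt (𝓡 6) x).symm y) v) = v := by
  have : IsManifold (𝓡 6) 1 M := IsManifold.of_le (n := ∞) (by simp)
  have h := mfderivWithin_extChartAt_symm_comp_mfderiv_extChartAt (I := 𝓡 6) hy
  rw [ModelWithCorners.range_eq_univ, mfderivWithin_univ] at h
  exact DFunLike.congr_fun h v

theorem trivializationAt_apply {x p : M} (hp : p ∈ (extChartAt (𝓡 6) x).source)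
    (v : TangentSpace (𝓡 6) p) :
    (trivializationAt E6 (TangentSpace (𝓡 6)) x ⟨p, v⟩).2 = chartMap x p v := by
  have : IsManifold (𝓡 6) 1 M := IsManifold.of_le (n := ∞) (by simp)
  have hp' : p ∈ (chartAt E6 x).source := by rwa [← extChartAt_source (𝓡 6)]
  rw [← Bundle.Trivialization.continuousLinearMapAt_apply_of_mem (R := ℝ)
    (trivializationAt E6 (TangentSpace (𝓡 6)) x) (by simpa using hp'),
    TangentBundle.continuousLinearMapAt_trivializationAt hp']
  rfl

theorem contMDiffAt_chart_symm (x : M) :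
    ContMDiffAt 𝓘(ℝ, E6) (𝓡 6) ∞ (extChartAt (𝓡 6) x).symm (extChartAt (𝓡 6) x x) :=
  (contMDiffOn_extChartAt_symm x).contMDiffAt (extChartAt_target_mem_nhds x)

/-- A vector field along the inverse chart is smooth iff its expression in the chart is. -/
theorem contMDiffAt_section_iff (x : M)
    (V : ∀ y : E6, TangentSpace (𝓡 6) ((extChartAt (𝓡 6) x).symm y)) :
    ContMDiffAt 𝓘(ℝ, E6) ((𝓡 6).prod 𝓘(ℝ, E6)) ∞
      (fun y => (Bundle.TotalSpace.mk' E6 ((extChartAt (𝓡 6) x).symm y) (V y) :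
        TangentBundle (𝓡 6) M)) (extChartAt (𝓡 6) x x) ↔
    ContDiffAt ℝ ∞ (fun y => chartMap x ((extChartAt (𝓡 6) x).symm y) (V y))
      (extChartAt (𝓡 6) x x) := by
  rw [Bundle.contMDiffAt_totalSpace]
  have h1 := contMDiffAt_chart_symm x
  have h2 : (fun y => (trivializationAt E6 (TangentSpace (𝓡 6))
      ((extChartAt (𝓡 6) x).symm (extChartAt (𝓡 6) x x))
        (⟨(extChartAt (𝓡 6) x).symm y, V y⟩ : TangentBundle (𝓡 6) M)).2)
        =ᶠ[nhds (extChartAt (𝓡 6) x x)]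
      fun y => chartMap x ((extChartAt (𝓡 6) x).symm y) (V y) := by
    filter_upwards [extChartAt_target_mem_nhds x] with y hy
    rw [extChartAt_to_inv]
    exact trivializationAt_apply ((extChartAt (𝓡 6) x).map_target hy) _
  constructor
  · intro h
    exact (h.2.contDiffAt).congr_of_eventuallyEq h2.symm
  · intro h
    exact ⟨h1, (h.congr_of_eventuallyEq h2).contMDiffAt⟩

theorem contMDiffAt_coordinate_field (x : M) (v : E6) :
    ContMDiffAt 𝓘(ℝ, E6) ((𝓡 6).prod 𝓘(ℝ, E6)) ∞
      (fun y => (Bundle.TotalSpace.mk' E6 ((extChartAt (𝓡 6) x).symm y) (chartDeriv x y v) :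
        TangentBundle (𝓡 6) M)) (extChartAt (𝓡 6) x x) := by
  refine (contMDiffAt_section_iff x fun y => chartDeriv x y v).2 ?_
  refine (contDiffAt_const (c := v)).congr_of_eventuallyEq ?_
  filter_upwards [extChartAt_target_mem_nhds x] with y hy
  exact chartMap_chartDeriv hy v

theorem contDiffAt_chartMetric (x : M) :
    ContDiffAt ℝ ∞ (chartMetric H x) (extChartAt (𝓡 6) x x) := by
  refine contDiffAt_clm_of_apply fun v => contDiffAt_clm_of_apply fun w => ?_
  have h : ContMDiffAt 𝓘(ℝ, E6) ((𝓡 6).prod 𝓘(ℝ, ℝ)) ∞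
      (fun y => Bundle.TotalSpace.mk' ℝ (E := Bundle.Trivial M ℝ) ((extChartAt (𝓡 6) x).symm y)
        (H.g.inner ((extChartAt (𝓡 6) x).symm y) (chartDeriv x y v) (chartDeriv x y w)))
      (extChartAt (𝓡 6) x x) := by
    apply ContMDiffAt.clm_bundle_apply₂ (F₁ := E6) (F₂ := E6)
      (E₁ := (TangentSpace (𝓡 6) : M → Type)) (E₂ := (TangentSpace (𝓡 6) : M → Type))
    · exact H.g.contMDiff.contMDiffAt.comp _ (contMDiffAt_chart_symm x)
    · exact contMDiffAt_coordinate_field x v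
    · exact contMDiffAt_coordinate_field x w
  rw [Bundle.contMDiffAt_totalSpace] at h
  exact h.2.contDiffAt

theorem contDiffAt_chartAcs (x : M) :
    ContDiffAt ℝ ∞ (chartAcs H x) (extChartAt (𝓡 6) x x) := by
  refine contDiffAt_clm_of_apply fun v => ?_
  refine (contMDiffAt_section_iff x fun y => H.J _ (chartDeriv x y v)).1 ?_
  apply ContMDiffAt.clm_bundle_apply (F₁ := E6) (F₂ := E6)
      (E₁ := (TangentSpace (𝓡 6) : M → Type)) (E₂ := (TangentSpace (𝓡 6) : M → Type))
  · exact H.J_smooth.contMDiffAt.comp _ (contMDiffAt_chart_symm x)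
  · exact contMDiffAt_coordinate_field x v

theorem chartDeriv_chartAcs {x : M} {y : E6} (hy : y ∈ (extChartAt (𝓡 6) x).target) (v : E6) :
    chartDeriv x y (chartAcs H x y v) = acs H ((extChartAt (𝓡 6) x).symm y) (chartDeriv x y v) :=
  chartDeriv_chartMap hy _

theorem chartAcs_sq {x : M} {y : E6} (hy : y ∈ (extChartAt (𝓡 6) x).target) (v : E6) :
    chartAcs H x y (chartAcs H x y v) = -v := by
  have h : chartAcs H x y (chartAcs H x y v) = chartMap x ((extChartAt (𝓡 6) x).symm y)
      (acs H ((extChartAt (𝓡 6) x).symm y) (chartDeriv x y (chartAcs H x y v))) := rfl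
  have hJ : ∀ w, acs H ((extChartAt (𝓡 6) x).symm y) (acs H ((extChartAt (𝓡 6) x).symm y) w) = -w :=
    H.J_sq _
  rw [h, chartDeriv_chartAcs H hy, hJ, map_neg, chartMap_chartDeriv hy]

theorem chartMetric_apply (x : M) (y v w : E6) : chartMetric H x y v w =
    metricForm H ((extChartAt (𝓡 6) x).symm y) (chartDeriv x y v) (chartDeriv x y w) := rfl

theorem chartMetric_symm (x : M) (y v w : E6) : chartMetric H x y v w = chartMetric H x y w v :=
  H.g.symm _ _ _

theorem chartMetric_chartAcs {x : M} {y : E6} (hy : y ∈ (extChartAt (𝓡 6) x).target) (v w : E6) :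
    chartMetric H x y (chartAcs H x y v) (chartAcs H x y w) = chartMetric H x y v w := by
  rw [chartMetric_apply, chartDeriv_chartAcs H hy, chartDeriv_chartAcs H hy]
  exact H.J_isometry _ _ _

theorem chartMetric_pos {x : M} {y : E6} (hy : y ∈ (extChartAt (𝓡 6) x).target) {v : E6}
    (hv : v ≠ 0) : 0 < chartMetric H x y v v := by
  refine H.g.pos _ _ fun h => hv ?_
  have := chartMap_chartDeriv hy v
  rw [show chartDeriv x y v = 0 from h, map_zero] at this
  exact this.symm

end LocalGeometry

/-! ### Smooth unitary frames -/

/-- The axioms of a Hermitian structure on a real vector space. -/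
structure IsHermitianPair (g : E6 →L[ℝ] E6 →L[ℝ] ℝ) (J : E6 →L[ℝ] E6) : Prop where
  symm : ∀ v w, g v w = g w v
  sq : ∀ v, J (J v) = -v
  isom : ∀ v w, g (J v) (J w) = g v w
  pos : ∀ v, v ≠ 0 → 0 < g v v

theorem IsHermitianPair.inner_J {g : E6 →L[ℝ] E6 →L[ℝ] ℝ} {J : E6 →L[ℝ] E6}
    (h : IsHermitianPair g J) (v w : E6) : g (J v) w = -g v (J w) := by
  rw [← h.isom v (J w), h.sq, map_neg, neg_neg]

theorem IsHermitianPair.inner_J_self {g : E6 →L[ℝ] E6 →L[ℝ] ℝ} {J : E6 →L[ℝ] E6}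
    (h : IsHermitianPair g J) (v : E6) : g v (J v) = 0 := by
  have := h.inner_J v v
  rw [h.symm] at this
  linarith

section Frames

variable {g : E6 → E6 →L[ℝ] E6 →L[ℝ] ℝ} {J : E6 → E6 →L[ℝ] E6} {u₀ : E6}

theorem exists_orthogonal (g : E6 →L[ℝ] E6 →L[ℝ] ℝ) {m : ℕ} (hm : m < 3) (u u' : Fin m → E6) :
    ∃ w : E6, w ≠ 0 ∧ (∀ i, g w (u i) = 0) ∧ ∀ i, g w (u' i) = 0 := by
  let f : E6 →ₗ[ℝ] (Fin m → ℝ) × (Fin m → ℝ) :=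
    { toFun := fun w => (fun i => g w (u i), fun i => g w (u' i))
      map_add' := fun a b => by ext <;> simp
      map_smul' := fun c a => by ext <;> simp }
  have hker : LinearMap.ker f ≠ ⊥ := LinearMap.ker_ne_bot_of_finrank_lt (by simp; omega)
  obtain ⟨w, hw, hw0⟩ := Submodule.exists_mem_ne_zero_of_ne_bot hker
  have hf : f w = 0 := hw
  exact ⟨w, hw0, fun i => congrFun (congrArg Prod.fst hf) i,
    fun i => congrFun (congrArg Prod.snd hf) i⟩

/-- Gram–Schmidt orthonormalisation over the complex numbers, with a smooth parameter. -/
theorem exists_unitary_family (hg : ContDiffAt ℝ ∞ g u₀) (hJ : ContDiffAt ℝ ∞ J u₀)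
    (h : ∀ᶠ y in nhds u₀, IsHermitianPair (g y) (J y)) (m : ℕ) (hm : m ≤ 3) :
    ∃ u : Fin m → E6 → E6, (∀ i, ContDiffAt ℝ ∞ (u i) u₀) ∧ ∀ᶠ y in nhds u₀, ∀ i j,
      g y (u i y) (u j y) = (if i = j then 1 else 0) ∧ g y (u i y) (J y (u j y)) = 0 := by
  induction m with
  | zero =>
    exact ⟨fun i => i.elim0, fun i => i.elim0, Filter.Eventually.of_forall fun _ i => i.elim0⟩
  | succ m ih =>
    obtain ⟨u, hu, hon⟩ := ih (by omega)
    obtain ⟨w, hw0, hw1, hw2⟩ := exists_orthogonal (g u₀) (show m < 3 by omega)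
      (fun i => u i u₀) (fun i => J u₀ (u i u₀))
    -- `W` is `w` minus its projection to the span of the previous vectors and of their images
    -- under `J`
    set W : E6 → E6 := fun y => w - ∑ i, (g y w (u i y) • u i y +
      g y w (J y (u i y)) • J y (u i y)) with hW
    have hWs : ContDiffAt ℝ ∞ W u₀ := by
      refine contDiffAt_const.sub (ContDiffAt.sum fun i _ => ContDiffAt.add ?_ ?_)
      · exact ((hg.clm_apply contDiffAt_const).clm_apply (hu i)).fun_smul (hu i)
      · exact ((hg.clm_apply contDiffAt_const).clm_apply (hJ.clm_apply (hu i))).fun_smul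
          (hJ.clm_apply (hu i))
    have hW0 : W u₀ = w := by simp [hW, hw1, hw2]
    set n : E6 → ℝ := fun y => g y (W y) (W y) with hn
    have hns : ContDiffAt ℝ ∞ n u₀ := (hg.clm_apply hWs).clm_apply hWs
    have hn0 : 0 < n u₀ := by
      simp only [hn, hW0]
      exact h.self_of_nhds.pos w hw0
    have hpos : ∀ᶠ y in nhds u₀, 0 < n y := hns.continuousAt.eventually (lt_mem_nhds hn0)
    set v : E6 → E6 := fun y => (Real.sqrt (n y))⁻¹ • W y with hv
    have hvs : ContDiffAt ℝ ∞ v u₀ :=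
      ((hns.sqrt hn0.ne').inv (Real.sqrt_pos.2 hn0).ne').fun_smul hWs
    refine ⟨Fin.cons v u, fun i => Fin.cases hvs hu i, ?_⟩
    filter_upwards [h, hon, hpos] with y hy hon hny
    have hWu : ∀ j, g y (W y) (u j y) = 0 := by
      intro j
      simp [hW, sum_apply, (hon _ _).1, hy.inner_J, (hon _ _).2]
    have hWJ : ∀ j, g y (W y) (J y (u j y)) = 0 := by
      intro j
      simp [hW, sum_apply, (hon _ _).1, hy.isom, (hon _ _).2]
    have hvu : ∀ j, g y (v y) (u j y) = 0 := fun j => by simp [hv, hWu]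
    have hvJ : ∀ j, g y (v y) (J y (u j y)) = 0 := fun j => by simp [hv, hWJ]
    have hvv : g y (v y) (v y) = 1 := by
      have h1 : g y (v y) (v y) = (Real.sqrt (n y))⁻¹ * ((Real.sqrt (n y))⁻¹ * n y) := by
        simp [hv, hn]
      rw [h1]
      have h2 := Real.mul_self_sqrt hny.le
      have h3 := (Real.sqrt_pos.2 hny).ne'
      field_simp
      nlinarith
    intro i j
    refine Fin.cases ?_ (fun i => ?_) i <;> refine Fin.cases ?_ (fun j => ?_) j
    · simp [hvv, hy.inner_J_self]
    · simp [hvu, hvJ, (Fin.succ_ne_zero j).symm]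
    · refine ⟨?_, ?_⟩
      · rw [hy.symm]; simp [hvu]
      · have := hy.inner_J (u i y) (v y)
        simp only [Fin.cons_zero, Fin.cons_succ]
        rw [hy.symm, hvJ] at this
        linarith
    · simpa using hon i j

/-- The linear map from the model with prescribed values on the standard basis. -/
def frameMap (J : E6 →L[ℝ] E6) (u : Fin 3 → E6) : V0 →L[ℝ] E6 :=
  ∑ j, ((Complex.reCLM.comp (ContinuousLinearMap.proj j)).smulRight (u j) +
    (Complex.imCLM.comp (ContinuousLinearMap.proj j)).smulRight (J (u j)))

theorem frameMap_apply (J : E6 →L[ℝ] E6) (u : Fin 3 → E6) (v : V0) :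
    frameMap J u v = ∑ j, ((v j).re • u j + (v j).im • J (u j)) := by
  rw [frameMap, sum_apply]
  rfl

/-- Around every point there is a smooth unitary frame. -/
theorem exists_unitary_frame (hg : ContDiffAt ℝ ∞ g u₀) (hJ : ContDiffAt ℝ ∞ J u₀)
    (h : ∀ᶠ y in nhds u₀, IsHermitianPair (g y) (J y)) :
    ∃ A : E6 → V0 →L[ℝ] E6, ContDiffAt ℝ ∞ A u₀ ∧
      ∀ᶠ y in nhds u₀, IsUnitary (g y) (J y) (A y) := by
  obtain ⟨u, hu, hon⟩ := exists_unitary_family hg hJ h 3 le_rfl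
  refine ⟨fun y => frameMap (J y) (fun j => u j y), ?_, ?_⟩
  · refine contDiffAt_clm_of_apply fun v => ?_
    simp only [frameMap_apply]
    exact ContDiffAt.sum fun j _ => ((hu j).const_smul _).add ((hJ.clm_apply (hu j)).const_smul _)
  · filter_upwards [h, hon] with y hy hon
    refine ⟨fun v w => ?_, fun v => ?_⟩
    · simp only [frameMap_apply, map_sum, map_add, map_smul, sum_apply, add_apply,
        FunLike.coe_smul, Pi.smul_apply, hy.isom, hy.inner_J, (hon _ _).1, (hon _ _).2,
        inner0, Complex.re_sum, Complex.mul_re, Complex.conj_re, Complex.conj_im, smul_eq_mul,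
        mul_ite, mul_one, mul_zero, add_zero, neg_zero, zero_add]
      simp [Finset.sum_add_distrib, mul_comm]
    · simp only [frameMap_apply, map_sum, map_add, map_smul, hy.sq, J0_apply]
      refine Finset.sum_congr rfl fun j _ => ?_
      simp [add_comm]

end Frames

/-! ### The exterior derivative in a moving frame -/

instance (k : ℕ) : FiniteDimensional ℝ (CForm V0 k) :=
  Module.Finite.of_injective (evalBasis V0 k) (evalBasis_injective k)

/-- The components of degree at most six; all others vanish. -/
def lowDegrees : Forms V0 →ₗ[ℝ] (∀ l : Fin 7, CForm V0 l) where
  toFun f := fun l => f l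
  map_add' _ _ := rfl
  map_smul' c f := by
    funext l
    ext v
    simp [← Complex.coe_smul]

theorem lowDegrees_injective : Function.Injective lowDegrees := by
  intro f g h
  ext1 k
  by_cases hk : k < 7
  · exact congrFun h ⟨k, hk⟩
  · rw [cform_eq_zero (by omega) (f k), cform_eq_zero (by omega) (g k)]

instance : NormedAddCommGroup (Forms V0) :=
  NormedAddCommGroup.induced (Forms V0) _ lowDegrees lowDegrees_injective

instance : NormedSpace ℝ (Forms V0) := NormedSpace.induced ℝ (Forms V0) _ lowDegrees

instance : FiniteDimensional ℝ (Forms V0) :=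
  Module.Finite.of_injective lowDegrees lowDegrees_injective

/-- The component of degree `k`. -/
def degL (k : ℕ) : Forms V0 →L[ℝ] CForm V0 k :=
  LinearMap.toContinuousLinearMap
    { toFun := fun f => f k
      map_add' := fun _ _ => rfl
      map_smul' := fun c f => by ext v; simp [← Complex.coe_smul] }

@[simp] theorem degL_apply (k : ℕ) (f : Forms V0) : degL k f = f k := rfl

variable {X : Type*} [NormedAddCommGroup X] [NormedSpace ℝ X]

theorem Forms.contDiffAt_iff {F : X → Forms V0} {u : X} :
    ContDiffAt ℝ ∞ F u ↔ ∀ k, ContDiffAt ℝ ∞ (fun y => F y k) u := by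
  constructor
  · intro h k
    exact (degL k).contDiff.contDiffAt.comp u h
  · intro h
    obtain ⟨L, hL⟩ := lowDegrees.exists_leftInverse_of_injective
      (LinearMap.ker_eq_bot.2 lowDegrees_injective)
    have h1 : ContDiffAt ℝ ∞ (fun y => lowDegrees (F y)) u := contDiffAt_pi.2 fun i => h _
    have h2 := (LinearMap.toContinuousLinearMap L).contDiff.contDiffAt.comp u h1
    refine h2.congr_of_eventuallyEq (Filter.Eventually.of_forall fun y => ?_)
    exact (LinearMap.congr_fun hL (F y)).symm

theorem Forms.fderiv_deg {F : X → Forms V0} {u : X} (h : DifferentiableAt ℝ F u) (w : X) (k : ℕ) :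
    (fderiv ℝ F u w) k = fderiv ℝ (fun y => F y k) u w := by
  have := fderiv_comp u (degL k).differentiableAt h
  rw [(degL k).fderiv] at this
  exact (DFunLike.congr_fun this w).symm

/-- A complex linear operator as a continuous real linear one. -/
def clmOfLinear (T : Module.End ℂ (Forms V0)) : Forms V0 →L[ℝ] Forms V0 :=
  LinearMap.toContinuousLinearMap (T.restrictScalars ℝ)

/-- A conjugate-linear operator as a continuous real linear one. -/
def clmOfConj (T : Forms V0 →+ Forms V0) (hT : ∀ (c : ℂ) f, T (c • f) = starRingEnd ℂ c • T f) :
    Forms V0 →L[ℝ] Forms V0 :=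
  LinearMap.toContinuousLinearMap
    { toFun := T
      map_add' := T.map_add
      map_smul' := fun c f => by
        rw [← Complex.coe_smul, hT, Complex.conj_ofReal, Complex.coe_smul]; rfl }

@[simp] theorem clmOfLinear_apply (T : Module.End ℂ (Forms V0)) (f : Forms V0) :
    clmOfLinear T f = T f := rfl

@[simp] theorem clmOfConj_apply (T : Forms V0 →+ Forms V0)
    (hT : ∀ (c : ℂ) f, T (c • f) = starRingEnd ℂ c • T f) (f : Forms V0) :
    clmOfConj T hT f = T f := rfl

/-- The first derivatives of `F` at `u` in the directions of the complex frame given by `A`. -/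
def jet (F : X → Forms V0) (u : X) (A : V0 →L[ℝ] X) (b : Idx) : Forms V0 :=
  cval (fun v => fderiv ℝ F u (A v)) b

theorem jet_linear (T : Module.End ℂ (Forms V0)) {F : X → Forms V0} {u : X} (A : V0 →L[ℝ] X)
    (hF : DifferentiableAt ℝ F u) (b : Idx) :
    jet (fun y => T (F y)) u A b = T (jet F u A b) := by
  have h : fderiv ℝ (fun y => T (F y)) u = (clmOfLinear T).comp (fderiv ℝ F u) := by
    have := fderiv_comp u (clmOfLinear T).differentiableAt hF
    rwa [(clmOfLinear T).fderiv] at this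
  simp only [jet, cval, h, ContinuousLinearMap.comp_apply, clmOfLinear_apply, map_smul, map_add]

theorem sgnI_bar (b : Idx) : sgnI (bar b) = starRingEnd ℂ (sgnI b) := by
  obtain ⟨j, _ | _⟩ := b <;> simp [sgnI]

theorem jet_conj (T : Forms V0 →+ Forms V0)
    (hT : ∀ (c : ℂ) f, T (c • f) = starRingEnd ℂ c • T f) {F : X → Forms V0} {u : X}
    (A : V0 →L[ℝ] X) (hF : DifferentiableAt ℝ F u) (b : Idx) :
    jet (fun y => T (F y)) u A b = T (jet F u A (bar b)) := by
  have h : fderiv ℝ (fun y => T (F y)) u = (clmOfConj T hT).comp (fderiv ℝ F u) := by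
    have := fderiv_comp u (clmOfConj T hT).differentiableAt hF
    rwa [(clmOfConj T hT).fderiv] at this
  simp only [jet, cval, h, ContinuousLinearMap.comp_apply, clmOfConj_apply, hT, map_add, sgnI_bar,
    Complex.conj_conj, map_div₀, map_one, Complex.conj_ofNat]
  rfl

theorem cval_sum {ι F : Type*} [AddCommGroup F] [Module ℂ F] (s : Finset ι) (Φ : ι → V0 → F)
    (b : Idx) : cval (fun v => ∑ i ∈ s, Φ i v) b = ∑ i ∈ s, cval (Φ i) b := by
  simp only [cval, smul_add, Finset.smul_sum, Finset.sum_add_distrib]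

theorem cval_smul_const {F : Type*} [AddCommGroup F] [Module ℂ F] (φ : V0 → ℂ) (x : F) (b : Idx) :
    cval (fun v => φ v • x) b = cval φ b • x := by
  simp only [cval, smul_eq_mul]
  module

/-- The complex coefficients of an endomorphism of the model in the complex frame. -/
def coeff (C : V0 →L[ℝ] V0) (a c : Idx) : ℂ := cval (fun v => theta c (C v)) a

theorem iotaForm_eq_sum (x : V0) (f : Forms V0) (k : ℕ) :
    iotaForm x (f (k + 1)) = ∑ c, theta c x • ιc c f k := by
  have h := sum_theta_cval (F := Forms V0)
    { toFun := fun v => iota v f, map_zero' := by rw [← zero_smul ℝ (0 : V0), iota_smul]; simp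
      map_add' := fun v w => by rw [iota_add]; rfl } (fun c v => by simp [iota_smul]) x
  have h' := congrArg (fun g : Forms V0 => g k) h
  simp only [Forms.sum_deg, Forms.smul_deg] at h'
  refine h'.symm.trans (Finset.sum_congr rfl fun c _ => ?_)
  congr 1

/-- The derivation of the exterior algebra induced by an endomorphism. -/
theorem fderivComp_eq (f : Forms V0) (C : V0 →L[ℝ] V0) (k : ℕ) :
    (f k).fderivCompContinuousLinearMap (ContinuousLinearMap.id ℝ V0) C =
      (∑ a, ∑ c, coeff C a c • εc a (ιc c f)) k := by
  cases k with
  | zero =>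
    rw [ContinuousAlternatingMap.fderivCompContinuousLinearMap_of_isEmpty]
    rw [Forms.sum_deg]
    refine (Finset.sum_eq_zero fun a _ => ?_).symm
    rw [Forms.sum_deg]
    refine Finset.sum_eq_zero fun c _ => ?_
    rw [Forms.smul_deg, εc_deg_zero, cform_smul_zero]
  | succ k =>
    rw [ContinuousAlternatingMap.fderivCompContinuousLinearMap_eq_alternatizeUncurryFin]
    refine (alternatizeUncurryFin_eq_sum _).trans ?_
    rw [Forms.sum_deg]
    refine Finset.sum_congr rfl fun a _ => ?_
    rw [Forms.sum_deg]
    simp only [Forms.smul_deg, εc_deg_succ, ← map_smul, ← map_sum]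
    congr 1
    have h : ∀ v, ((ContinuousAlternatingMap.compContinuousLinearMapCLM
        (ContinuousLinearMap.id ℝ V0) ∘SL (f (k + 1)).curryLeft).postcomp V0 C) v =
        ∑ c, theta c (C v) • ιc c f k := fun v => iotaForm_eq_sum (C v) f k
    refine (congrArg (fun Φ : V0 → CForm V0 k => cval Φ a) (funext h)).trans ?_
    rw [cval_sum]
    exact Finset.sum_congr rfl fun c _ => cval_smul_const _ _ _

theorem cval_add {F : Type*} [AddCommGroup F] [Module ℂ F] (Φ Ψ : V0 → F) (b : Idx) :
    cval (fun v => Φ v + Ψ v) b = cval Φ b + cval Ψ b := by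
  simp only [cval]
  module

/-- The connection coefficients of a moving frame `A` at `u`, where `B` is the inverse of `A u`. -/
def connCoeff (A : E6 → V0 →L[ℝ] E6) (u : E6) (B : E6 →L[ℝ] V0) (b c a : Idx) : ℂ :=
  -cval (fun v => coeff (B.comp (fderiv ℝ A u (A u v))) c a) b

theorem cval_conj (Φ : V0 → ℂ) (b : Idx) :
    cval (fun v => starRingEnd ℂ (Φ v)) (bar b) = starRingEnd ℂ (cval Φ b) := by
  simp only [cval, sgnI_bar, map_mul, map_add, smul_eq_mul, map_div₀, map_one, Complex.conj_ofNat]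
  rfl

theorem isReal_connCoeff (A : E6 → V0 →L[ℝ] E6) (u : E6) (B : E6 →L[ℝ] V0) :
    IsReal (connCoeff A u B) := by
  intro b c a
  simp only [connCoeff, coeff, theta_bar, map_neg, cval_conj]

/-- The exterior derivative, expressed in a moving frame. -/
theorem extDeriv_frame {f : ∀ k, E6 → CForm E6 k} {A : E6 → V0 →L[ℝ] E6} {u : E6}
    (hf : ∀ k, ContDiffAt ℝ ∞ (f k) u) (hA : ContDiffAt ℝ ∞ A u) {B : E6 →L[ℝ] V0}
    (hAB : ∀ v, A u (B v) = v) (hBA : ∀ v, B (A u v) = v) (k : ℕ) :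
    (extDeriv (f k) u).compContinuousLinearMap (A u) =
      (∑ b, εc b (jet (fun y => pb (A y) (fun k => f k y)) u (A u) b) +
        ∑ b, ∑ c, ∑ a, connCoeff A u B b c a •
          εc b (εc c (ιc a (pb (A u) (fun k => f k u))))) (k + 1) := by
  set F : E6 → Forms V0 := fun y => pb (A y) (fun k => f k y) with hF
  have hFs : ContDiffAt ℝ ∞ F u := Forms.contDiffAt_iff.2 fun k => ContDiffAt.cform_comp (hf k) hA
  have hFd : DifferentiableAt ℝ F u := hFs.differentiableAt (by simp)
  -- the derivative of the pullback of `f` under the constant frame `A u`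
  set fh : E6 → CForm V0 k := fun y => (f k y).compContinuousLinearMap (A u) with hfh
  have hfhd : DifferentiableAt ℝ fh u :=
    (ContDiffAt.cform_comp (hf k) contDiffAt_const).differentiableAt (by simp)
  set S : E6 → V0 →L[ℝ] V0 := fun y => B.comp (A y) with hS
  have hSu : S u = ContinuousLinearMap.id ℝ V0 := ContinuousLinearMap.ext hBA
  have hAd : DifferentiableAt ℝ A u := hA.differentiableAt (by simp)
  have hSd : DifferentiableAt ℝ S u :=
    ((ContinuousLinearMap.compL ℝ V0 E6 V0 B).differentiableAt).comp u hAd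
  have hSf : ∀ w, fderiv ℝ S u w = B.comp (fderiv ℝ A u w) := by
    intro w
    have := fderiv_comp u (ContinuousLinearMap.compL ℝ V0 E6 V0 B).differentiableAt hAd
    rw [ContinuousLinearMap.fderiv] at this
    exact DFunLike.congr_fun this w
  have hFk : (fun y => F y k) = fun y => (fh y).compContinuousLinearMap (S y) := by
    funext y
    ext v
    simp only [hF, hfh, hS, pb_deg, ContinuousAlternatingMap.compContinuousLinearMap_apply]
    congr 1
    funext i
    exact (hAB _).symm
  have hder : ∀ w, fderiv ℝ fh u w = fderiv ℝ F u w k -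
      (∑ a, ∑ c, coeff (B.comp (fderiv ℝ A u w)) a c • εc a (ιc c (F u))) k := by
    intro w
    rw [Forms.fderiv_deg hFd, hFk,
      fderiv_continuousAlternatingMapCompContinuousLinearMap hfhd hSd, ← fderivComp_eq]
    have h1 : fh u = F u k := rfl
    rw [hSu, h1, ← hSf]
    refine eq_sub_of_add_eq ?_
    rfl
  have hcv : ∀ b, cval ((fderiv ℝ fh u).comp (A u)) b = (jet F u (A u) b +
      ∑ c, ∑ a, connCoeff A u B b c a • εc c (ιc a (F u))) k := by
    intro b
    have h1 : cval (fun v => ∑ c, ∑ a, coeff (B.comp (fderiv ℝ A u (A u v))) c a •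
        εc c (ιc a (F u))) b = -∑ c, ∑ a, connCoeff A u B b c a • εc c (ιc a (F u)) := by
      rw [cval_sum, ← Finset.sum_neg_distrib]
      refine Finset.sum_congr rfl fun c _ => ?_
      rw [cval_sum, ← Finset.sum_neg_distrib]
      refine Finset.sum_congr rfl fun a _ => ?_
      rw [cval_smul_const, connCoeff, neg_smul, neg_neg]
    rw [← sub_neg_eq_add, ← h1]
    simp only [cval, jet, ContinuousLinearMap.comp_apply, hder, Forms.smul_deg, Forms.sub_deg,
      Forms.add_deg]
    module
  have hlhs : (extDeriv (f k) u).compContinuousLinearMap (A u) =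
      ContinuousAlternatingMap.alternatizeUncurryFin ((fderiv ℝ fh u).comp (A u)) := by
    have h1 : fderiv ℝ fh u =
        (ContinuousAlternatingMap.compContinuousLinearMapCLM (A u)).comp (fderiv ℝ (f k) u) := by
      let L : CForm E6 k →L[ℝ] CForm V0 k :=
        ContinuousAlternatingMap.compContinuousLinearMapCLM (A u)
      have := fderiv_comp u L.differentiableAt ((hf k).differentiableAt (by simp))
      rwa [L.fderiv] at this
    rw [h1]
    ext v
    rw [ContinuousAlternatingMap.compContinuousLinearMap_apply, extDeriv,
      ContinuousAlternatingMap.alternatizeUncurryFin_apply,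
      ContinuousAlternatingMap.alternatizeUncurryFin_apply]
    rfl
  rw [hlhs, alternatizeUncurryFin_eq_sum, ← Finset.sum_add_distrib, Forms.sum_deg]
  refine Finset.sum_congr rfl fun b _ => ?_
  rw [hcv, ← εc_deg_succ, map_add]
  simp only [map_sum, map_smul]
  rfl

/-! ### Local frames on almost Hermitian six-manifolds -/

section LocalFrames

variable {M : Type*} [TopologicalSpace M] [ChartedSpace E6 M] [IsManifold (𝓡 6) ∞ M]
  (H : AlmostHermitian M)

/-- An inhomogeneous form is smooth if all its components are. -/
def IsSmoothM (η : MForm M) : Prop := ∀ k, IsSmoothForm (η k)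

/-- The pullback to the model of a form at `p` under a linear map `P` into the tangent space. -/
def pullAt (P : V0 →L[ℝ] E6) (p : M) (η : MForm M) : Forms V0 := pb P (fun k => formAt (η k) p)

/-- The operator `O` on forms acts at each point by the operator `T` of the model. -/
def IsPointwise (O : MForm M → MForm M) (T : Forms V0 → Forms V0) : Prop :=
  ∀ (p : M) (P : V0 →L[ℝ] E6), IsUnitary (metricForm H p) (acs H p) P →
    ∀ η, pullAt P p (O η) = T (pullAt P p η)

/-- Contraction with the Kähler form. -/
def lamM (η : MForm M) : MForm M := fun k x =>
  contractForm (V := TangentSpace (𝓡 6) x) (EuclideanSpace.basisFun (Fin 6) ℝ).toBasis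
    (H.g.inner x) (H.J x) (η (k + 2) x)

/-- Complex conjugation of inhomogeneous forms. -/
def conjM (η : MForm M) : MForm M := fun k x => conjForm (η k x)

/-- The components of type `(r, k - r)` of the components of degree `k` of a form. -/
def typeM (r : ℤ) (η : MForm M) : MForm M := fun k x => typePart (H.J x) r (η k x)

/-- The sign `(-1) ^ k` in degree `k`. -/
def parityM (η : MForm M) : MForm M := fun k x => ((-1 : ℂ) ^ k) • η k x

theorem isPointwise_lamM : IsPointwise H (lamM H) fun f => (-2 : ℂ) • lam0 f := by
  intro p P hP η
  ext1 k
  exact hP.contractForm_comp _ (fun k => formAt (η k) p) k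

theorem isPointwise_conjM : IsPointwise H (conjM (M := M)) conjF := fun _ _ _ _ => rfl

theorem isPointwise_parityM : IsPointwise H (parityM (M := M)) parity := fun _ _ _ _ => rfl

theorem isPointwise_typeM (r : ℤ) : IsPointwise H (typeM H r) (proj r) := by
  intro p P hP η
  ext1 k
  exact hP.typePart_comp r (formAt (η k) p)

theorem omega_comp {p : M} {P : V0 →L[ℝ] E6} (hP : IsUnitary (metricForm H p) (acs H p) P) :
    (formAt H.omega p).compContinuousLinearMap P = omega0 :=
  hP.hermForm_comp (H.g.symm p) (H.J_sq p) (H.J_isometry p)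

theorem isPointwise_star : IsPointwise H H.star star0 := by
  intro p P hP η
  ext1 l
  by_cases h : l ≤ 6
  · have h1 : formAt (H.star η l) p = hodgeStar (V := E6)
        (EuclideanSpace.basisFun (Fin 6) ℝ).toBasis (metricForm H p)
        (volForm (formAt H.omega p)) (Nat.sub_add_cancel h) (formAt (η (6 - l)) p) :=
      dif_pos h
    refine Eq.trans ?_ (starF_deg vol0 (pullAt P p η) (Nat.sub_add_cancel h)).symm
    change (formAt (H.star η l) p).compContinuousLinearMap P = _
    rw [h1, hP.hodgeStar_comp, volForm_comp, omega_comp H hP]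
    rfl
  · have h1 : formAt (H.star η l) p = 0 := dif_neg h
    refine Eq.trans ?_ (starF_deg_of_lt vol0 (pullAt P p η) (by omega)).symm
    change (formAt (H.star η l) p).compContinuousLinearMap P = _
    rw [h1]
    rfl

/-- A smooth unitary frame `A` in the chart around `x`, with inverse `B`. -/
structure LocalFrame (x : M) where
  /-- the frame -/
  A : E6 → V0 →L[ℝ] E6
  /-- the inverse of the frame -/
  B : E6 → E6 →L[ℝ] V0
  smooth_A : ContDiffAt ℝ ∞ A (extChartAt (𝓡 6) x x)
  smooth_B : ContDiffAt ℝ ∞ B (extChartAt (𝓡 6) x x)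
  A_B : ∀ᶠ y in nhds (extChartAt (𝓡 6) x x), ∀ v, A y (B y v) = v
  B_A : ∀ᶠ y in nhds (extChartAt (𝓡 6) x x), ∀ v, B y (A y v) = v
  unitary : ∀ᶠ y in nhds (extChartAt (𝓡 6) x x),
    IsUnitary (metricForm H ((extChartAt (𝓡 6) x).symm y))
      (acs H ((extChartAt (𝓡 6) x).symm y)) ((chartDeriv x y).comp (A y))

theorem IsUnitary.exists_equiv {g : E6 →L[ℝ] E6 →L[ℝ] ℝ} {J : E6 →L[ℝ] E6} {P : V0 →L[ℝ] E6}
    (hP : IsUnitary g J P) : ∃ e : V0 ≃L[ℝ] E6, (e : V0 →L[ℝ] E6) = P := by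
  have hfr : Module.finrank ℝ V0 = Module.finrank ℝ E6 := by
    simp [Module.finrank_pi_fintype, Complex.finrank_real_complex]
  let e := LinearEquiv.ofInjectiveOfFinrankEq (P : V0 →ₗ[ℝ] E6) hP.injective hfr
  exact ⟨e.toContinuousLinearEquiv, by ext v; rfl⟩

/-- Every point has a smooth unitary frame around it. -/
theorem nonempty_localFrame (x : M) : Nonempty (LocalFrame H x) := by
  have htarget := extChartAt_target_mem_nhds (I := 𝓡 6) x
  have hpair : ∀ᶠ y in nhds (extChartAt (𝓡 6) x x),
      IsHermitianPair (chartMetric H x y) (chartAcs H x y) := by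
    filter_upwards [htarget] with y hy
    exact ⟨chartMetric_symm H x y, chartAcs_sq H hy, chartMetric_chartAcs H hy,
      fun v hv => chartMetric_pos H hy hv⟩
  obtain ⟨A, hA, hU⟩ := exists_unitary_frame (contDiffAt_chartMetric H x)
    (contDiffAt_chartAcs H x) hpair
  have hinv : ∀ᶠ y in nhds (extChartAt (𝓡 6) x x), (∀ v, A y ((A y).inverse v) = v) ∧
      ∀ v, (A y).inverse (A y v) = v := by
    filter_upwards [hU] with y hy
    obtain ⟨e, he⟩ := hy.exists_equiv
    rw [← he, ContinuousLinearMap.inverse_equiv]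
    exact ⟨fun v => e.apply_symm_apply v, fun v => e.symm_apply_apply v⟩
  refine ⟨⟨A, fun y => (A y).inverse, hA, ?_, hinv.mono fun _ h => h.1, hinv.mono fun _ h => h.2,
    ?_⟩⟩
  · obtain ⟨e, he⟩ := hU.self_of_nhds.exists_equiv
    have h := contDiffAt_map_inverse (𝕜 := ℝ) (n := ∞) e
    rw [he] at h
    exact h.comp _ hA
  · filter_upwards [hU, htarget] with y hy hyt
    refine ⟨fun v w => hy.isometry v w, fun v => ?_⟩
    have := hy.comm v
    rw [ContinuousLinearMap.comp_apply, ContinuousLinearMap.comp_apply, ← this,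
      chartDeriv_chartAcs H hyt]

namespace LocalFrame

variable {H} {x : M} (L : LocalFrame H x)

/-- The expression of a form in the local frame. -/
def loc (η : MForm M) (y : E6) : Forms V0 := pb (L.A y) (fun k => inChart (η k) x y)

theorem loc_eq (η : MForm M) (y : E6) : L.loc η y =
    pullAt ((chartDeriv x y).comp (L.A y)) ((extChartAt (𝓡 6) x).symm y) η := by
  ext1 k
  change (inChart (η k) x y).compContinuousLinearMap (L.A y) = _
  rw [inChart_eq (η k) x y rfl]
  rfl

theorem loc_pointwise {O : MForm M → MForm M} {T : Forms V0 → Forms V0}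
    (hO : IsPointwise H O T) (η : MForm M) :
    L.loc (O η) =ᶠ[nhds (extChartAt (𝓡 6) x x)] fun y => T (L.loc η y) := by
  filter_upwards [L.unitary] with y hy
  rw [loc_eq, loc_eq, hO _ _ hy]

theorem contDiffAt_loc {η : MForm M} (hη : IsSmoothM η) :
    ContDiffAt ℝ ∞ (L.loc η) (extChartAt (𝓡 6) x x) :=
  Forms.contDiffAt_iff.2 fun k => ContDiffAt.cform_comp
    ((hη k).contDiffAt x (mem_extChartAt_target x)) L.smooth_A

theorem contDiffAt_inChart {η : MForm M} (h : ContDiffAt ℝ ∞ (L.loc η) (extChartAt (𝓡 6) x x))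
    (k : ℕ) : ContDiffAt ℝ ∞ (inChart (η k) x) (extChartAt (𝓡 6) x x) := by
  have h1 := ContDiffAt.cform_comp (Forms.contDiffAt_iff.1 h k) L.smooth_B
  refine h1.congr_of_eventuallyEq ?_
  filter_upwards [L.A_B] with y hy
  ext v
  change inChart (η k) x y v = inChart (η k) x y (fun i => L.A y (L.B y (v i)))
  simp only [hy]

/-- The value of a form at `x` in the frame. -/
def val (η : MForm M) : Forms V0 := L.loc η (extChartAt (𝓡 6) x x)

/-- The first derivatives of a form at `x` in the frame. -/
def der (η : MForm M) (b : Idx) : Forms V0 :=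
  jet (L.loc η) (extChartAt (𝓡 6) x x) (L.A (extChartAt (𝓡 6) x x)) b

/-- The connection coefficients of the frame at `x`. -/
def Γ : Idx → Idx → Idx → ℂ :=
  connCoeff L.A (extChartAt (𝓡 6) x x) (L.B (extChartAt (𝓡 6) x x))

theorem isReal_Γ : IsReal L.Γ := isReal_connCoeff _ _ _

theorem val_deg (η : MForm M) (k : ℕ) : L.val η k =
    (formAt (η k) x).compContinuousLinearMap (L.A (extChartAt (𝓡 6) x x)) := by
  rw [← inChart_self]
  rfl

theorem val_pointwise {O : MForm M → MForm M} {T : Forms V0 → Forms V0}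
    (hO : IsPointwise H O T) (η : MForm M) : L.val (O η) = T (L.val η) :=
  (L.loc_pointwise hO η).self_of_nhds

theorem der_congr {η : MForm M} {F : E6 → Forms V0}
    (h : L.loc η =ᶠ[nhds (extChartAt (𝓡 6) x x)] F) (b : Idx) :
    L.der η b = jet F (extChartAt (𝓡 6) x x) (L.A (extChartAt (𝓡 6) x x)) b := by
  simp only [der, jet, h.fderiv_eq]

theorem der_linear {O : MForm M → MForm M} {T : Module.End ℂ (Forms V0)}
    (hO : IsPointwise H O T) {η : MForm M} (hη : IsSmoothM η) (b : Idx) :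
    L.der (O η) b = T (L.der η b) :=
  (L.der_congr (L.loc_pointwise hO η) b).trans
    (jet_linear T _ ((L.contDiffAt_loc hη).differentiableAt (by simp)) b)

theorem der_conj {O : MForm M → MForm M} {T : Forms V0 →+ Forms V0}
    (hO : IsPointwise H O T) (hT : ∀ (c : ℂ) f, T (c • f) = starRingEnd ℂ c • T f)
    {η : MForm M} (hη : IsSmoothM η) (b : Idx) :
    L.der (O η) b = T (L.der η (bar b)) :=
  (L.der_congr (L.loc_pointwise hO η) b).trans
    (jet_conj T hT _ ((L.contDiffAt_loc hη).differentiableAt (by simp)) b)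

theorem eq_zero_of_val {k : ℕ} {η : MForm M} (h : L.val η k = 0) : η k x = 0 := by
  rw [val_deg] at h
  have hAB := L.A_B.self_of_nhds
  have : formAt (η k) x = 0 := by
    ext v
    have h1 := DFunLike.congr_fun h (fun i => L.B (extChartAt (𝓡 6) x x) (v i))
    rw [ContinuousAlternatingMap.compContinuousLinearMap_apply] at h1
    simp only [Function.comp_def, hAB] at h1
    exact h1
  exact this

end LocalFrame

/-- Forms are equal if their values agree in unitary frames at all points. -/
theorem ext_val {η ζ : MForm M} (h : ∀ x (L : LocalFrame H x), L.val η = L.val ζ) : η = ζ := by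
  funext k x
  obtain ⟨L⟩ := nonempty_localFrame H x
  have h1 : L.val (η - ζ) k = 0 := by
    rw [L.val_deg]
    have h2 := congrArg (fun f : Forms V0 => f k) (h x L)
    simp only [L.val_deg] at h2
    ext v
    have h3 := DFunLike.congr_fun h2 v
    exact sub_eq_zero.2 h3
  exact sub_eq_zero.1 (L.eq_zero_of_val h1)

theorem IsPointwise.isSmoothM {O : MForm M → MForm M} {T : Forms V0 → Forms V0}
    (hO : IsPointwise H O T) (T' : Forms V0 →L[ℝ] Forms V0) (hT : ∀ f, T f = T' f)
    {η : MForm M} (hη : IsSmoothM η) : IsSmoothM (O η) := by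
  intro k
  rw [isSmoothForm_iff]
  intro x
  obtain ⟨L⟩ := nonempty_localFrame H x
  refine L.contDiffAt_inChart ?_ k
  refine ContDiffAt.congr_of_eventuallyEq ?_ (L.loc_pointwise hO η)
  simp only [hT]
  exact T'.contDiff.contDiffAt.comp _ (L.contDiffAt_loc hη)

theorem isSmoothM_lamM {η : MForm M} (hη : IsSmoothM η) : IsSmoothM (lamM H η) :=
  (isPointwise_lamM H).isSmoothM H (clmOfLinear ((-2 : ℂ) • lam0)) (fun _ => rfl) hη

theorem isSmoothM_typeM (r : ℤ) {η : MForm M} (hη : IsSmoothM η) : IsSmoothM (typeM H r η) :=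
  (isPointwise_typeM H r).isSmoothM H (clmOfLinear (proj r)) (fun _ => rfl) hη

theorem isSmoothM_parityM (H : AlmostHermitian M) {η : MForm M} (hη : IsSmoothM η) :
    IsSmoothM (parityM η) :=
  (isPointwise_parityM H).isSmoothM H (clmOfLinear parity) (fun _ => rfl) hη

theorem isSmoothM_conjM (H : AlmostHermitian M) {η : MForm M} (hη : IsSmoothM η) :
    IsSmoothM (conjM η) :=
  (isPointwise_conjM H).isSmoothM H (clmOfConj conjF conjF_smul) (fun _ => rfl) hη

theorem isSmoothM_star {η : MForm M} (hη : IsSmoothM η) : IsSmoothM (H.star η) :=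
  (isPointwise_star H).isSmoothM H (clmOfConj star0 star0_smul) (fun _ => rfl) hη

end LocalFrames

/-! ### The components of the de Rham differential -/

theorem symb_deg_zero (m : ℤ) (x : Idx → Forms V0) : symb m x 0 = 0 := by
  rw [symb, Forms.sum_deg]
  refine Finset.sum_eq_zero fun b _ => ?_
  split_ifs
  · exact εc_deg_zero _ _
  · rfl

theorem conn_deg_zero (Γ : Idx → Idx → Idx → ℂ) (m : ℤ) (f : Forms V0) : conn Γ m f 0 = 0 := by
  simp only [conn_apply, Forms.sum_deg]
  refine Finset.sum_eq_zero fun b _ => Finset.sum_eq_zero fun c _ =>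
    Finset.sum_eq_zero fun a _ => ?_
  split_ifs
  · rw [Forms.smul_deg, εc_deg_zero, cform_smul_zero]
  · rfl

theorem symb_deg_congr (m : ℤ) {x y : Idx → Forms V0} {k : ℕ} (h : ∀ b, x b k = y b k) :
    symb m x (k + 1) = symb m y (k + 1) := by
  simp only [symb, Forms.sum_deg]
  refine Finset.sum_congr rfl fun b _ => ?_
  split_ifs
  · rw [εc_deg_succ, εc_deg_succ, h]
  · rfl

theorem conn_deg_congr (Γ : Idx → Idx → Idx → ℂ) (m : ℤ) {f g : Forms V0} {k : ℕ}
    (h : f k = g k) : conn Γ m f (k + 1) = conn Γ m g (k + 1) := by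
  simp only [conn_apply, Forms.sum_deg]
  refine Finset.sum_congr rfl fun b _ => Finset.sum_congr rfl fun c _ =>
    Finset.sum_congr rfl fun a _ => ?_
  split_ifs
  · rw [Forms.smul_deg, Forms.smul_deg, εc_deg_succ, εc_deg_succ]
    cases k with
    | zero => rw [εc_deg_zero, εc_deg_zero]
    | succ k => rw [εc_deg_succ, εc_deg_succ, ιc_deg_congr a h]
  · rfl

theorem symb_eq_zero {m : ℤ} (hm : m ≠ -1 ∧ m ≠ 0 ∧ m ≠ 1 ∧ m ≠ 2) (x : Idx → Forms V0) :
    symb m x = 0 := by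
  refine Finset.sum_eq_zero fun b _ => if_neg ?_
  rcases b with ⟨j, _ | _⟩ <;> simp only [wt_true, wt_false] <;> omega

theorem conn_eq_zero (Γ : Idx → Idx → Idx → ℂ) {m : ℤ}
    (hm : m ≠ -1 ∧ m ≠ 0 ∧ m ≠ 1 ∧ m ≠ 2) (f : Forms V0) : conn Γ m f = 0 := by
  rw [conn_apply]
  refine Finset.sum_eq_zero fun b _ => Finset.sum_eq_zero fun c _ =>
    Finset.sum_eq_zero fun a _ => if_neg ?_
  rcases b with ⟨j, _ | _⟩ <;> rcases c with ⟨j', _ | _⟩ <;> rcases a with ⟨j'', _ | _⟩ <;>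
    simp only [wt_true, wt_false] <;> omega

theorem symb_add (m : ℤ) (x y : Idx → Forms V0) :
    symb m (fun b => x b + y b) = symb m x + symb m y := by
  simp only [symb, ← Finset.sum_add_distrib]
  refine Finset.sum_congr rfl fun b _ => ?_
  split_ifs
  · rw [map_add]
  · rw [add_zero]

theorem symb_sum {ι : Type*} (s : Finset ι) (m : ℤ) (x : ι → Idx → Forms V0) :
    symb m (fun b => ∑ i ∈ s, x i b) = ∑ i ∈ s, symb m (x i) := by
  simp only [symb]
  rw [Finset.sum_comm]
  refine Finset.sum_congr rfl fun b _ => ?_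
  split_ifs
  · rw [map_sum]
  · rw [Finset.sum_const_zero]

theorem conjF_symb (m : ℤ) (x : Idx → Forms V0) :
    conjF (symb m x) = symb (1 - m) (fun b => conjF (x (bar b))) := by
  simp only [symb, map_sum]
  rw [← sum_bar]
  refine Finset.sum_congr rfl fun b _ => ?_
  have : wt (bar b) = m ↔ wt b = 1 - m := by rw [wt_bar]; omega
  simp only [this]
  split_ifs
  · rw [conjF_εc, bar_bar]
  · exact map_zero _

theorem lef_oneForm_deg {k : ℕ} (hk : k ≠ 2) : lef oneForm k = 0 := by
  rw [lef_oneForm, Forms.sum_deg]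
  refine Finset.sum_eq_zero fun j _ => ?_
  rw [Forms.smul_deg]
  rcases k with _ | _ | _ | k
  · rw [εc_deg_zero, cform_smul_zero]
  · rw [εc_deg_succ, εc_deg_zero, map_zero, cform_smul_zero]
  · exact absurd rfl hk
  · have h0 : oneForm (k + 1) = 0 := rfl
    rw [εc_deg_succ, εc_deg_succ, h0, map_zero, map_zero, cform_smul_zero]

theorem lef_lef_oneForm_deg {k : ℕ} (hk : k ≠ 4) : lef (lef oneForm) k = 0 := by
  rw [lef_apply, Forms.sum_deg]
  refine Finset.sum_eq_zero fun j _ => ?_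
  rw [Forms.smul_deg]
  rcases k with _ | _ | k
  · rw [εc_deg_zero, cform_smul_zero]
  · rw [εc_deg_succ, εc_deg_zero, map_zero, cform_smul_zero]
  · rw [εc_deg_succ, εc_deg_succ, lef_oneForm_deg (by omega), map_zero, map_zero, cform_smul_zero]

theorem typePart_reForm_eq_zero {V : Type*} [AddCommGroup V] [Module ℝ V] [TopologicalSpace V]
    [IsTopologicalAddGroup V] [ContinuousSMul ℝ V] (J : V →L[ℝ] V)
    {α : CForm V 3} (h : IsOfType J 3 0 α) : typePart J 2 (reForm α) = 0 := by
  have hc : IsOfType J 0 3 (conjForm α) := by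
    intro z
    have h1 := congrArg conjForm (h z)
    rw [conjForm_smul] at h1
    refine Eq.trans ?_ (h1.trans ?_)
    · rfl
    · simp
  rw [reForm, typePart_smul, typePart_add, typePart_of_isOfType' J (p := 3) (by omega) 2 α h,
    typePart_of_isOfType' J (p := 0) (by omega) 2 _ hc]
  ext v
  simp

section Differential

variable {M : Type*} [TopologicalSpace M] [ChartedSpace E6 M] [IsManifold (𝓡 6) ∞ M]
  (H : AlmostHermitian M)

/-- The de Rham differential on inhomogeneous forms. -/
def dM (η : MForm M) : MForm M
  | 0 => 0
  | k + 1 => deRham (η k)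

omit [IsManifold (𝓡 6) ∞ M] in
theorem isSmoothForm_zero (k : ℕ) : IsSmoothForm (0 : DForm M k) := by
  intro x
  have : inChart (0 : DForm M k) x = fun _ => 0 := by
    funext y
    ext v
    rfl
  rw [this]
  exact contDiffOn_const

omit [IsManifold (𝓡 6) ∞ M] in
theorem IsSmoothForm.add {k : ℕ} {η ζ : DForm M k} (hη : IsSmoothForm η) (hζ : IsSmoothForm ζ) :
    IsSmoothForm (η + ζ) := by
  intro x
  have : inChart (η + ζ) x = fun y => inChart η x y + inChart ζ x y := by
    funext y
    ext v
    rfl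
  rw [this]
  exact (hη x).add (hζ x)

omit [IsManifold (𝓡 6) ∞ M] in
theorem IsSmoothForm.smul {k : ℕ} (c : ℂ) {η : DForm M k} (hη : IsSmoothForm η) :
    IsSmoothForm (c • η) := by
  intro x
  have : inChart (c • η) x = fun y => c • inChart η x y := by
    funext y
    ext v
    rfl
  rw [this]
  exact (hη x).const_smul c

omit [IsManifold (𝓡 6) ∞ M] in
theorem isSmoothM_single (k : ℕ) {α : DForm M k} (h : IsSmoothForm α) :
    IsSmoothM (Pi.single k α : MForm M) := by
  intro l
  by_cases hl : l = k
  · subst hl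
    rwa [Pi.single_eq_same]
  · rw [Pi.single_eq_of_ne hl]
    exact isSmoothForm_zero l

omit [IsManifold (𝓡 6) ∞ M] in
theorem IsSmoothM.add {η ζ : MForm M} (hη : IsSmoothM η) (hζ : IsSmoothM ζ) :
    IsSmoothM (η + ζ) := fun k => (hη k).add (hζ k)

omit [IsManifold (𝓡 6) ∞ M] in
theorem IsSmoothM.smul (c : ℂ) {η : MForm M} (hη : IsSmoothM η) : IsSmoothM (c • η) :=
  fun k => (hη k).smul c

theorem isSmoothM_dM {η : MForm M} (h : IsSmoothM η) : IsSmoothM (dM η)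
  | 0 => isSmoothForm_zero 0
  | k + 1 => isSmoothForm_deRham (h k)

omit [IsManifold (𝓡 6) ∞ M] in
theorem deRham_zero (k : ℕ) : deRham (0 : DForm M k) = 0 := by
  funext x
  have h0 : inChart (0 : DForm M k) x = 0 := by
    funext y
    ext v
    rfl
  have h1 : extDeriv (0 : E6 → E6 [⋀^Fin k]→L[ℝ] ℂ) (extChartAt (𝓡 6) x x) = 0 := by
    ext v
    simp [extDeriv, ContinuousAlternatingMap.alternatizeUncurryFin_apply]
  rw [deRham, h0, h1]
  ext v
  rfl

theorem dM_dM {η : MForm M} (h : IsSmoothM η) : dM (dM η) = 0 := by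
  funext k
  rcases k with _ | _ | k
  · rfl
  · exact deRham_zero 0
  · exact deRham_deRham (h k)

theorem isSmoothM_dPart (i : ℤ) {η : MForm M} (h : IsSmoothM η) : IsSmoothM (H.dPart i η)
  | 0 => isSmoothForm_zero 0
  | k + 1 => by
    have h1 : ∀ s : Finset ℕ, IsSmoothForm (fun x => ∑ p ∈ s,
        (typeM H (p + i) (dM (typeM H p η))) (k + 1) x) := by
      intro s
      induction s using Finset.induction_on with
      | empty => exact isSmoothForm_zero _
      | insert a s ha ih =>
        simp only [Finset.sum_insert ha]
        exact (isSmoothM_typeM H _ (isSmoothM_dM (isSmoothM_typeM H _ h)) _).add ih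
    exact h1 _

namespace LocalFrame

variable {H} {x : M} (L : LocalFrame H x)

theorem val_add (η ζ : MForm M) : L.val (η + ζ) = L.val η + L.val ζ := by
  ext k v
  rfl

theorem val_zero : L.val 0 = 0 := by
  ext k v
  rfl

theorem val_neg (η : MForm M) : L.val (-η) = -L.val η := by
  ext k v
  rfl

theorem val_smul (c : ℂ) (η : MForm M) : L.val (c • η) = c • L.val η := by
  ext k v
  rfl

theorem der_add {η ζ : MForm M} (hη : IsSmoothM η) (hζ : IsSmoothM ζ) (b : Idx) :
    L.der (η + ζ) b = L.der η b + L.der ζ b := by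
  have h : L.loc (η + ζ) = fun y => L.loc η y + L.loc ζ y := by
    funext y
    ext k v
    rfl
  have h1 := (L.contDiffAt_loc hη).differentiableAt (n := ∞) (by simp)
  have h2 := (L.contDiffAt_loc hζ).differentiableAt (n := ∞) (by simp)
  simp only [der, jet, h, fderiv_fun_add h1 h2]
  exact cval_add _ _ b

theorem der_smul (c : ℂ) {η : MForm M} (hη : IsSmoothM η) (b : Idx) :
    L.der (c • η) b = c • L.der η b := by
  have h : IsPointwise H (fun η => c • η) ⇑(c • (1 : Module.End ℂ (Forms V0))) := by
    intro p P _ η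
    ext k v
    rfl
  exact L.der_linear h hη b

/-- The de Rham differential in a unitary frame. -/
theorem val_dM {η : MForm M} (h : IsSmoothM η) : L.val (dM η) = ∑ b, εc b (L.der η b) +
    ∑ b, ∑ c, ∑ a, L.Γ b c a • εc b (εc c (ιc a (L.val η))) := by
  ext1 k
  cases k with
  | zero =>
    rw [← sum_symb, ← sum_conn]
    simp only [Forms.add_deg, symb_deg_zero, conn_deg_zero, add_zero]
    ext v
    rfl
  | succ k =>
    rw [val_deg]
    change (formAt (deRham (η k)) x).compContinuousLinearMap _ = _
    rw [deRham_apply_self (h k)]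
    exact extDeriv_frame (fun k => (h k).contDiffAt x (mem_extChartAt_target x)) L.smooth_A
      L.A_B.self_of_nhds L.B_A.self_of_nhds k

/-- The components of the differential of a form of pure type, in a unitary frame. -/
theorem proj_val_dM {p : ℤ} {η : MForm M} (h : IsSmoothM η) (hp : typeM H p η = η) (i : ℤ) :
    proj (p + i) (L.val (dM η)) = symb i (L.der η) + conn L.Γ i (L.val η) := by
  have hv : L.val η = proj p (L.val η) := by
    conv_lhs => rw [← hp]
    exact L.val_pointwise (isPointwise_typeM H p) η
  have hd : L.der η = fun b => proj p (L.der η b) := by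
    funext b
    conv_lhs => rw [← hp]
    exact L.der_linear (isPointwise_typeM H p) h b
  have hm : ∀ m, proj (p + i) (symb m (L.der η) + conn L.Γ m (L.val η)) =
      if m = i then symb i (L.der η) + conn L.Γ i (L.val η) else 0 := by
    intro m
    rw [map_add, proj_symb, proj_conn, hv, hd]
    simp only [proj_proj]
    split_ifs with h1 h2 h2
    · subst h2
      rfl
    · omega
    · omega
    · simp [symb]
  have hs : L.val (dM η) = (symb (-1) (L.der η) + conn L.Γ (-1) (L.val η)) +
      (symb 0 (L.der η) + conn L.Γ 0 (L.val η)) + (symb 1 (L.der η) + conn L.Γ 1 (L.val η)) +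
      (symb 2 (L.der η) + conn L.Γ 2 (L.val η)) := by
    rw [L.val_dM h, ← sum_symb, ← sum_conn]
    abel
  rw [hs]
  simp only [map_add (proj (p + i)) _ (symb _ _ + conn _ _ _), hm]
  by_cases hi : i ≠ -1 ∧ i ≠ 0 ∧ i ≠ 1 ∧ i ≠ 2
  · rw [symb_eq_zero hi, conn_eq_zero _ hi]
    simp
  · have : i = -1 ∨ i = 0 ∨ i = 1 ∨ i = 2 := by omega
    rcases this with rfl | rfl | rfl | rfl <;> norm_num

/-- The components of the de Rham differential, in a unitary frame. -/
theorem val_dPart {η : MForm M} (h : IsSmoothM η) (i : ℤ) :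
    L.val (H.dPart i η) = symb i (L.der η) + conn L.Γ i (L.val η) := by
  ext1 k
  cases k with
  | zero =>
    rw [Forms.add_deg, symb_deg_zero, conn_deg_zero, add_zero]
    ext v
    rfl
  | succ k =>
    have h1 : L.val (H.dPart i η) (k + 1) = ∑ p ∈ Finset.range (k + 1),
        L.val (typeM H (p + i) (dM (typeM H p η))) (k + 1) := by
      simp only [val_deg]
      ext v
      rw [ContinuousAlternatingMap.sum_apply]
      exact ContinuousAlternatingMap.sum_apply _ _
    have h2 : ∀ p : ℕ, L.val (typeM H (p + i) (dM (typeM H p η))) =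
        symb i (fun b => proj p (L.der η b)) + conn L.Γ i (proj p (L.val η)) := by
      intro p
      rw [L.val_pointwise (isPointwise_typeM H _), L.proj_val_dM (isSmoothM_typeM H _ h),
        L.val_pointwise (isPointwise_typeM H _)]
      · congr 2
        funext b
        exact L.der_linear (isPointwise_typeM H _) h b
      · refine ext_val H fun y L' => ?_
        simp only [L'.val_pointwise (isPointwise_typeM H _), proj_proj, if_true]
    rw [h1]
    simp only [h2]
    rw [← Forms.sum_deg, Finset.sum_add_distrib, ← symb_sum, ← map_sum, Forms.add_deg,
      Forms.add_deg]
    congr 1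
    · refine symb_deg_congr i fun b => ?_
      rw [Forms.sum_deg, proj_sum]
    · refine conn_deg_congr _ i ?_
      rw [Forms.sum_deg, proj_sum]

end LocalFrame

end Differential

/-! ### The algebra of operators -/

section OperatorAlgebra

/-- If `d = ∑ D i` squares to zero and `D i` shifts a grading by `i`, then the homogeneous
components of `d ^ 2` vanish. The grading is given by its projections `t`. -/
theorem sum_mul_eq_zero_of_grading {R : Type*} [Ring R] {t D : ℤ → R}
    (ht : ∀ r s, t r * t s = if r = s then t s else 0)
    (htD : ∀ r i, t r * D i = D i * t (r - i)) (h1 : ∑ r ∈ Finset.range 7, t r = 1)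
    {I : Finset ℤ} (hd : (∑ i ∈ I, D i) * ∑ i ∈ I, D i = 0) (m : ℤ) :
    ∑ i ∈ I, ∑ j ∈ I, (if i + j = m then D i * D j else 0) = 0 := by
  rw [← mul_one (∑ i ∈ I, _), ← h1, Finset.mul_sum]
  refine Finset.sum_eq_zero fun p _ => ?_
  have h2 : t (p + m) * ((∑ i ∈ I, D i) * ∑ i ∈ I, D i) * t p = 0 := by
    rw [hd, mul_zero, zero_mul]
  refine Eq.trans ?_ h2
  rw [Finset.sum_mul_sum]
  simp only [Finset.mul_sum, Finset.sum_mul]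
  refine Finset.sum_congr rfl fun i _ => Finset.sum_congr rfl fun j _ => ?_
  rw [← mul_assoc (t (p + m)), htD, mul_assoc (D i), htD, mul_assoc, mul_assoc, ht]
  by_cases h : i + j = m
  · rw [if_pos h, if_pos (by omega), mul_assoc]
  · rw [if_neg h, if_neg (by omega), zero_mul, mul_zero, mul_zero]

variable {R : Type*} [Ring R] {s w c T : R} {D : ℤ → R}

/-- The adjoint of an operator of degree one with respect to the Hodge star operator `s`. -/
def adjE (s A : R) : R := -(s * A * s)

/-- The anticommutator. -/
def acE (A B : R) : R := A * B + B * A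

theorem acE_comm (A B : R) : acE A B = acE B A := add_comm _ _

/-- The Hodge star operator moves the adjoint in an anticommutator of operators of degree one
to the other factor. -/
theorem star_acE_star (hss : s * s = w) (hws : w * s = s * w) {A B : R} (hA : w * A = -(A * w))
    (hB : w * B = -(B * w)) : s * acE (adjE s A) B * s = w * acE A (adjE s B) := by
  have h1 : s * B * s * A * w = w * (s * B * s * A) :=
    calc s * B * s * A * w = -(s * B * (s * w) * A) := by
          rw [mul_assoc _ A, show A * w = -(w * A) by rw [hA, neg_neg]]; noncomm_ring
      _ = -(s * (B * w) * s * A) := by rw [← hws]; noncomm_ring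
      _ = s * w * B * s * A := by rw [show B * w = -(w * B) by rw [hB, neg_neg]]; noncomm_ring
      _ = _ := by rw [← hws]; noncomm_ring
  calc s * acE (adjE s A) B * s = -(s * s * A * s * B * s) - s * B * s * A * (s * s) := by
        simp only [acE, adjE]; noncomm_ring
    _ = _ := by rw [hss, h1]; simp only [acE, adjE]; noncomm_ring

theorem commutator_acE (T A B : R) : T * acE A B - acE A B * T =
    acE (T * A - A * T) B + acE A (T * B - B * T) := by
  simp only [acE]; noncomm_ring

theorem conj_acE (hcc : c * c = 1) (A B : R) : c * acE A B * c = acE (c * A * c) (c * B * c) := by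
  have h : ∀ A B, c * A * c * (c * B * c) = c * (A * B) * c := fun A B => by
    calc _ = c * A * (c * c) * B * c := by noncomm_ring
      _ = _ := by rw [hcc]; noncomm_ring
  simp only [acE, h]; noncomm_ring

theorem conj_adjE (hcs : c * s = s * c) (A : R) :
    c * adjE s A * c = adjE s (c * A * c) := by
  calc c * adjE s A * c = -(c * s * A * (s * c)) := by simp only [adjE]; noncomm_ring
    _ = -((s * c) * A * (c * s)) := by rw [hcs]
    _ = _ := by simp only [adjE]; noncomm_ring

/-- The algebraic core: the commutators of `T` with the components of `d` and the vanishing of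
the components of `d ^ 2` imply the identities between the components of `d` and their adjoints.
Here `T`, `s`, `c`, `w` stand for the contraction with the Kähler form, the Hodge star operator,
complex conjugation and the parity of the degree. -/
theorem acE_identities (h3 : ∀ x : R, x + x + x = 0 → x = 0) (hss : s * s = w) (hww : w * w = 1)
    (hws : w * s = s * w) (hwD : ∀ i, w * D i = -(D i * w)) (hcc : c * c = 1)
    (hcs : c * s = s * c) (hcw : c * w = w * c) (hcD : ∀ i, c * D i * c = D (1 - i))
    (hcT : c * T * c = -T) (hT1 : T * D 1 - D 1 * T = adjE s (D 0))
    (hT2 : T * D 2 - D 2 * T = adjE s (D (-1)) + adjE s (D (-1)))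
    (hd3 : acE (D 2) (D 1) = 0) (hd : D 2 * D 0 + D 1 * D 1 + D 0 * D 2 = 0) :
    (acE (adjE s (D 2)) (D 0) = 0 ∧ acE (adjE s (D (-1))) (D 1) = 0 ∧
      acE (D 2) (adjE s (D 0)) = 0 ∧ acE (D (-1)) (adjE s (D 1)) = 0) ∧
    (acE (adjE s (D 0)) (D 1) = -acE (D 2) (adjE s (D 1)) ∧
      acE (adjE s (D 0)) (D 1) = -acE (adjE s (D (-1))) (D 0)) ∧
    (acE (adjE s (D 1)) (D 0) = -acE (D (-1)) (adjE s (D 0)) ∧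
      acE (adjE s (D 1)) (D 0) = -acE (adjE s (D 2)) (D 1)) := by
  have c2 : c * D 2 * c = D (-1) := hcD 2
  have c1 : c * D 1 * c = D 0 := hcD 1
  have c0 : c * D 0 * c = D 1 := hcD 0
  have cm : c * D (-1) * c = D 2 := hcD (-1)
  -- conjugating the commutators with `D 1` and `D 2` gives those with `D 0` and `D (-1)`
  have hconj : ∀ A, T * (c * A * c) - c * A * c * T = -(c * (T * A - A * T) * c) := by
    intro A
    have e1 : T = -(c * T * c) := by rw [hcT, neg_neg]
    calc T * (c * A * c) - c * A * c * T
        = -(c * T * c) * (c * A * c) - c * A * c * -(c * T * c) := by rw [← e1]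
      _ = -(c * T * (c * c) * A * c) + c * A * (c * c) * T * c := by noncomm_ring
      _ = _ := by rw [hcc]; noncomm_ring
  have hT0 : T * D 0 - D 0 * T = -adjE s (D 1) := by
    rw [← c1, hconj, hT1, conj_adjE hcs, c0]
  have hTm : T * D (-1) - D (-1) * T = -(adjE s (D 2) + adjE s (D 2)) := by
    rw [← c2, hconj, hT2, mul_add, add_mul, conj_adjE hcs, cm]
  have hmove : ∀ i j, s * acE (adjE s (D i)) (D j) * s = w * acE (D i) (adjE s (D j)) :=
    fun i j => star_acE_star hss hws (hwD i) (hwD j)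
  have hw0 : ∀ x : R, w * x = 0 → x = 0 := fun x hx => by
    rw [← one_mul x, ← hww, mul_assoc, hx, mul_zero]
  have hcj : ∀ i j, c * acE (D i) (adjE s (D j)) * c = acE (D (1 - i)) (adjE s (D (1 - j))) :=
    fun i j => by rw [conj_acE hcc, conj_adjE hcs, hcD, hcD]
  have hcj' : ∀ i j, c * acE (adjE s (D i)) (D j) * c = acE (adjE s (D (1 - i))) (D (1 - j)) :=
    fun i j => by rw [acE_comm, hcj, acE_comm]
  have hdm : acE (D (-1)) (D 0) = 0 := by
    rw [← c2, ← c1, ← conj_acE hcc, hd3, mul_zero, zero_mul]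
  have eA : acE (adjE s (D (-1))) (D 1) + acE (adjE s (D (-1))) (D 1) +
      acE (D 2) (adjE s (D 0)) = 0 := by
    have h := commutator_acE T (D 2) (D 1)
    rw [hd3, hT1, hT2] at h
    calc _ = T * 0 - 0 * T := by rw [h]; simp only [acE]; noncomm_ring
      _ = 0 := by simp
  have eB : acE (adjE s (D 2)) (D 0) + acE (adjE s (D 2)) (D 0) +
      acE (D (-1)) (adjE s (D 1)) = 0 := by
    have h := commutator_acE T (D (-1)) (D 0)
    rw [hdm, hT0, hTm] at h
    calc _ = -(T * 0 - 0 * T) := by rw [h]; simp only [acE]; noncomm_ring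
      _ = 0 := by simp
  have eA' : acE (D (-1)) (adjE s (D 1)) + acE (D (-1)) (adjE s (D 1)) +
      acE (adjE s (D 2)) (D 0) = 0 := by
    have h4 : s * acE (D 2) (adjE s (D 0)) * s = w * acE (adjE s (D 2)) (D 0) := by
      rw [acE_comm, hmove, acE_comm]
    refine hw0 _ ?_
    rw [mul_add, mul_add, ← hmove, ← h4, ← add_mul, ← add_mul, ← mul_add, ← mul_add, eA,
      mul_zero, zero_mul]
  have r4 : acE (D (-1)) (adjE s (D 1)) = 0 := by
    refine h3 _ ?_
    have h : ∀ x y : R, x + x + x = (x + x + y) + (x + x + y) - (y + y + x) :=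
      fun x y => by abel
    rw [h _ (acE (adjE s (D 2)) (D 0)), eA', eB, add_zero, sub_zero]
  have r1 : acE (adjE s (D 2)) (D 0) = 0 := by
    rw [r4, add_zero, zero_add] at eA'
    exact eA'
  have r3 : acE (D 2) (adjE s (D 0)) = 0 := by
    have := hcj (-1) 1
    rw [r4, mul_zero, zero_mul] at this
    exact this.symm
  have r2 : acE (adjE s (D (-1))) (D 1) = 0 := by
    have := hcj' 2 0
    rw [r1, mul_zero, zero_mul] at this
    exact this.symm
  have eX : acE (adjE s (D 0)) (D 1) + (acE (adjE s (D (-1))) (D 0) +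
      acE (adjE s (D (-1))) (D 0)) - acE (D 2) (adjE s (D 1)) = 0 := by
    have h : T * (D 2 * D 0 + D 1 * D 1 + D 0 * D 2) - (D 2 * D 0 + D 1 * D 1 + D 0 * D 2) * T =
        acE (T * D 2 - D 2 * T) (D 0) + acE (D 2) (T * D 0 - D 0 * T) +
        acE (T * D 1 - D 1 * T) (D 1) := by
      simp only [acE]; noncomm_ring
    rw [hd, hT0, hT1, hT2] at h
    calc _ = T * 0 - 0 * T := by rw [h]; simp only [acE]; noncomm_ring
      _ = 0 := by simp
  have hsc : ∀ i j, c * (s * acE (adjE s (D i)) (D j) * s) * c =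
      w * acE (D (1 - i)) (adjE s (D (1 - j))) := by
    intro i j
    rw [hmove, ← hcj, ← mul_assoc c w, hcw]
    noncomm_ring
  have hsc' : ∀ i j, c * (s * acE (D i) (adjE s (D j)) * s) * c =
      w * acE (adjE s (D (1 - i))) (D (1 - j)) := by
    intro i j
    rw [acE_comm, hsc, acE_comm]
  have eX' : acE (adjE s (D 0)) (D 1) + (acE (D 2) (adjE s (D 1)) + acE (D 2) (adjE s (D 1))) -
      acE (adjE s (D (-1))) (D 0) = 0 := by
    refine hw0 _ ?_
    have e1 := hsc 0 1
    have e2 := hsc (-1) 0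
    have e3 := hsc' 2 1
    norm_num at e1 e2 e3
    rw [acE_comm (D 1)] at e1
    rw [mul_sub, mul_add, mul_add, ← e1, ← e2, ← e3]
    calc _ = c * (s * (acE (adjE s (D 0)) (D 1) + (acE (adjE s (D (-1))) (D 0) +
        acE (adjE s (D (-1))) (D 0)) - acE (D 2) (adjE s (D 1))) * s) * c := by noncomm_ring
      _ = 0 := by rw [eX]; simp
  have eYZ : acE (adjE s (D (-1))) (D 0) = acE (D 2) (adjE s (D 1)) := by
    refine sub_eq_zero.1 (h3 _ ?_)
    have h : ∀ x y z : R, (y - z) + (y - z) + (y - z) =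
      (x + (y + y) - z) - (x + (z + z) - y) := fun x y z => by abel
    rw [h (acE (adjE s (D 0)) (D 1)), eX, eX', sub_zero]
  have f1 : acE (adjE s (D 0)) (D 1) = -acE (D 2) (adjE s (D 1)) := by
    rw [eYZ, add_sub_assoc, add_sub_cancel_right] at eX
    exact eq_neg_of_add_eq_zero_left eX
  have f2 := f1.trans (congrArg Neg.neg eYZ.symm)
  have hn : ∀ x : R, c * -x * c = -(c * x * c) := fun x => by noncomm_ring
  refine ⟨⟨r1, r2, r3, r4⟩, ⟨f1, f2⟩, ?_, ?_⟩
  · have e := congrArg (fun x => c * x * c) f1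
    simp only [hn, hcj, hcj'] at e
    exact e
  · have e := congrArg (fun x => c * x * c) f2
    simp only [hn, hcj'] at e
    exact e

end OperatorAlgebra

/-! ### Commutators with the contraction on a nearly Kähler manifold -/

theorem parity_symb (m : ℤ) (x : Idx → Forms V0) :
    parity (symb m x) = -symb m (fun b => parity (x b)) := by
  simp only [symb, map_sum, ← Finset.sum_neg_distrib]
  refine Finset.sum_congr rfl fun b _ => ?_
  split_ifs
  · rw [parity_εc]
  · rw [map_zero, neg_zero]

theorem parity_conn (Γ : Idx → Idx → Idx → ℂ) (m : ℤ) (f : Forms V0) :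
    parity (conn Γ m f) = -conn Γ m (parity f) := by
  simp only [conn_apply, map_sum, ← Finset.sum_neg_distrib]
  refine Finset.sum_congr rfl fun b _ => Finset.sum_congr rfl fun c _ =>
    Finset.sum_congr rfl fun a _ => ?_
  split_ifs
  · rw [map_smul, parity_εc, parity_εc, parity_ιc]
    simp only [map_neg, smul_neg, neg_neg]
  · rw [map_zero, neg_zero]

section NearlyKahler

variable {M : Type*} [TopologicalSpace M] [ChartedSpace E6 M] [IsManifold (𝓡 6) ∞ M]
  {H : AlmostHermitian M}

/-- The Kähler form as an inhomogeneous form. -/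
def omegaM (H : AlmostHermitian M) : MForm M := Pi.single 2 H.omega

/-- In unitary frames the Kähler form is constant. -/
theorem LocalFrame.loc_omegaM {x : M} (L : LocalFrame H x) :
    L.loc (omegaM H) =ᶠ[nhds (extChartAt (𝓡 6) x x)] fun _ => lef oneForm := by
  filter_upwards [L.unitary] with y hy
  rw [L.loc_eq]
  ext1 k
  by_cases hk : k = 2
  · subst hk
    change (formAt ((Pi.single 2 H.omega : MForm M) 2) _).compContinuousLinearMap _ = _
    rw [Pi.single_eq_same]
    exact omega_comp H hy
  · rw [lef_oneForm_deg hk]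
    change (formAt ((Pi.single 2 H.omega : MForm M) k) _).compContinuousLinearMap _ = _
    rw [Pi.single_eq_of_ne hk]
    rfl

theorem isSmoothM_omegaM : IsSmoothM (omegaM H) := by
  intro k
  rw [isSmoothForm_iff]
  intro x
  obtain ⟨L⟩ := nonempty_localFrame H x
  exact L.contDiffAt_inChart (contDiffAt_const.congr_of_eventuallyEq L.loc_omegaM) k

theorem LocalFrame.val_omegaM {x : M} (L : LocalFrame H x) : L.val (omegaM H) = lef oneForm :=
  L.loc_omegaM.self_of_nhds

theorem LocalFrame.der_omegaM {x : M} (L : LocalFrame H x) (b : Idx) : L.der (omegaM H) b = 0 := by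
  rw [L.der_congr L.loc_omegaM]
  simp [jet, cval]

theorem LocalFrame.symb_der_omegaM {x : M} (L : LocalFrame H x) (m : ℤ) :
    symb m (L.der (omegaM H)) = 0 :=
  Finset.sum_eq_zero fun b _ => by rw [L.der_omegaM, map_zero, ite_self]

theorem typeM_omegaM : typeM H 1 (omegaM H) = omegaM H := by
  refine ext_val H fun x L => ?_
  rw [L.val_pointwise (isPointwise_typeM H 1), L.val_omegaM, proj_lef, proj_oneForm]
  simp

omit [IsManifold (𝓡 6) ∞ M] in
theorem dM_single (k : ℕ) (α : DForm M k) :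
    dM (Pi.single k α : MForm M) = Pi.single (k + 1) (deRham α) := by
  funext l
  cases l with
  | zero => rw [Pi.single_eq_of_ne (by omega)]; rfl
  | succ l =>
    change deRham ((Pi.single k α : MForm M) l) = _
    by_cases hl : l = k
    · subst hl
      rw [Pi.single_eq_same, Pi.single_eq_same]
    · rw [Pi.single_eq_of_ne hl, Pi.single_eq_of_ne (by omega), deRham_zero]

theorem dM_add {η ζ : MForm M} (H : AlmostHermitian M) (hη : IsSmoothM η) (hζ : IsSmoothM ζ) :
    dM (η + ζ) = dM η + dM ζ := by
  refine ext_val H fun x L => ?_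
  rw [L.val_add, L.val_dM hη, L.val_dM hζ, L.val_dM (hη.add hζ)]
  simp only [L.val_add, L.der_add hη hζ, map_add, smul_add, Finset.sum_add_distrib]
  abel

theorem dM_smul {η : MForm M} (H : AlmostHermitian M) (c : ℂ) (hη : IsSmoothM η) :
    dM (c • η) = c • dM η := by
  refine ext_val H fun x L => ?_
  rw [L.val_smul, L.val_dM hη, L.val_dM (hη.smul c)]
  simp only [L.val_smul, L.der_smul c hη, map_smul, smul_add, Finset.smul_sum, smul_comm c]

variable {Ω : DForm M 3} {lam : ℝ}

/-- Since `d ω` has types `(3, 0)` and `(0, 3)` only, `∂ ω` vanishes; as `ω` is constant in unitary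
frames, this is a condition on the connection coefficients. -/
theorem LocalFrame.conn_one_kahler (hNK : H.IsNearlyKahler Ω lam) {x : M} (L : LocalFrame H x) :
    conn L.Γ 1 (lef oneForm) = 0 := by
  have h := L.proj_val_dM isSmoothM_omegaM typeM_omegaM 1
  rw [L.symb_der_omegaM, zero_add, L.val_omegaM,
    ← L.val_pointwise (isPointwise_typeM H (1 + 1))] at h
  rw [← h, ← L.val_zero]
  congr 1
  funext k y
  change typePart (H.J y) (1 + 1) (dM (omegaM H) k y) = 0
  rw [omegaM, dM_single]
  by_cases hk : k = 3
  · subst hk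
    rw [Pi.single_eq_same, hNK.d_omega, typePart_smul]
    refine Eq.trans (congrArg _ (typePart_reForm_eq_zero (H.J y) (hNK.type y))) ?_
    ext v
    simp
  · rw [Pi.single_eq_of_ne hk]
    exact (typePartL (H.J y) (1 + 1)).map_zero

/-- `d Ω = -2iλ ω ∧ ω`, because `Re Ω` is closed. -/
theorem dM_Omega (hNK : H.IsNearlyKahler Ω lam) : dM (Pi.single 3 Ω : MForm M) =
    (-2 * lam * Complex.I : ℂ) • (Pi.single 4 (fun x => wedge (H.omega x) (H.omega x)) :
      MForm M) := by
  set O : MForm M := Pi.single 3 Ω with hO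
  have hOs : IsSmoothM O := isSmoothM_single 3 hNK.smooth
  set re : MForm M := Pi.single 3 (fun x => reForm (Ω x)) with hre
  set im : MForm M := Pi.single 3 (fun x => imForm (Ω x)) with him
  have hcs : IsSmoothM (conjM O) := isSmoothM_conjM H hOs
  have hcv : conjM O 3 = fun x => conjForm (Ω x) := by
    funext x
    change conjForm ((Pi.single 3 Ω : MForm M) 3 x) = _
    rw [Pi.single_eq_same]
  have hcΩ : IsSmoothForm (fun x => conjForm (Ω x)) := by
    rw [← hcv]
    exact hcs 3
  have hres : IsSmoothM re := isSmoothM_single 3 ((hNK.smooth.add hcΩ).smul (1 / 2 : ℂ))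
  have hims : IsSmoothM im := by
    refine isSmoothM_single 3 ?_
    have := (hNK.smooth.add (hcΩ.smul (-1))).smul (1 / (2 * Complex.I) : ℂ)
    convert this using 1
    funext x
    ext v
    simp [imForm, sub_eq_add_neg]
  have hsum : O = re + Complex.I • im := by
    funext k x
    by_cases hk : k = 3
    · subst hk
      simp only [hO, hre, him, Pi.add_apply, Pi.smul_apply, Pi.single_eq_same]
      ext v
      change Ω x v = (1 / 2 : ℂ) * (Ω x v + conjForm (Ω x) v) +
        Complex.I * ((1 / (2 * Complex.I)) * (Ω x v - conjForm (Ω x) v))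
      field_simp
      ring
    · simp only [hO, hre, him, Pi.add_apply, Pi.smul_apply, Pi.single_eq_of_ne hk]
      ext v
      simp
  -- `Re Ω` is closed because it is a multiple of `d ω`
  have hdre : dM re = 0 := by
    have h1 : dM (omegaM H) = (3 * lam : ℂ) • re := by
      rw [omegaM, dM_single]
      funext k x
      by_cases hk : k = 3
      · subst hk
        simp only [hre, Pi.smul_apply, Pi.single_eq_same]
        exact hNK.d_omega x
      · simp only [hre, Pi.smul_apply, Pi.single_eq_of_ne hk]
        ext v
        simp
    have h2 := dM_dM (isSmoothM_omegaM (H := H))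
    rw [h1, dM_smul H _ hres] at h2
    have h3 : (3 * lam : ℂ) ≠ 0 := by
      simpa using hNK.lam_ne_zero
    refine ext_val H fun x L => ?_
    have h4 := congrArg L.val h2
    rw [L.val_smul, L.val_zero] at h4
    rw [L.val_zero]
    exact (smul_eq_zero.1 h4).resolve_left h3
  have hdim : dM im = (-2 * lam : ℂ) • (Pi.single 4 (fun x => wedge (H.omega x) (H.omega x)) :
      MForm M) := by
    rw [him, dM_single]
    funext k x
    by_cases hk : k = 4
    · subst hk
      simp only [Pi.smul_apply, Pi.single_eq_same]
      exact hNK.d_im x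
    · simp only [Pi.smul_apply, Pi.single_eq_of_ne hk]
      ext v
      simp
  rw [hsum, dM_add H hres (hims.smul _), dM_smul H _ hims, hdre, hdim, zero_add]
  refine ext_val H fun x L => ?_
  simp only [L.val_smul, smul_smul]
  congr 1
  ring

theorem LocalFrame.val_omega_sq {x : M} (L : LocalFrame H x) :
    L.val (Pi.single 4 (fun x => wedge (H.omega x) (H.omega x)) : MForm M) =
      lef (lef oneForm) := by
  rw [val, L.loc_eq]
  have hu := L.unitary.self_of_nhds
  ext1 k
  by_cases hk : k = 4
  · subst hk
    change (formAt ((Pi.single 4 _ : MForm M) 4) _).compContinuousLinearMap _ = _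
    rw [Pi.single_eq_same, ← wedge_omega0, ← omega_comp H hu]
    exact wedge_comp _ _ _
  · rw [lef_lef_oneForm_deg hk]
    change (formAt ((Pi.single 4 _ : MForm M) k) _).compContinuousLinearMap _ = _
    rw [Pi.single_eq_of_ne hk]
    rfl

/-- The component of type `(2, 2)` of `d Ω` is `N̄ Ω`, which involves no derivatives of `Ω`; that it
is a nonzero multiple of `ω ∧ ω` determines `N̄` up to a factor. -/
theorem LocalFrame.exists_torsion (hNK : H.IsNearlyKahler Ω lam) {x : M} (L : LocalFrame H x) :
    ∃ μ : ℂ, ∀ g, conn L.Γ (-1) g =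
      ∑ a : Fin 3, μ • εc (a + 1, true) (εc (a + 2, true) (ιc (a, false) g)) := by
  have hOs : IsSmoothM (Pi.single 3 Ω : MForm M) := isSmoothM_single 3 hNK.smooth
  have ht : typeM H 3 (Pi.single 3 Ω : MForm M) = Pi.single 3 Ω := by
    funext k y
    change typePart (H.J y) 3 ((Pi.single 3 Ω : MForm M) k y) = _
    by_cases hk : k = 3
    · subst hk
      rw [Pi.single_eq_same]
      exact typePart_of_isOfType (H.J y) (r := 3) le_rfl _ (hNK.type y)
    · rw [Pi.single_eq_of_ne hk]
      exact (typePartL (H.J y) 3).map_zero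
  have h := L.proj_val_dM hOs ht (-1)
  rw [symb_neg_one, zero_add, dM_Omega hNK, L.val_smul, L.val_omega_sq, map_smul, proj_lef,
    proj_lef, proj_oneForm] at h
  norm_num only [if_true] at h
  refine conn_neg_one_eq (ψ := L.val (Pi.single 3 Ω : MForm M)) ?_ ?_ h.symm
  · intro k hk
    rw [L.val_deg, Pi.single_eq_of_ne hk]
    rfl
  · simpa using hNK.lam_ne_zero

end NearlyKahler

/-! ### The operators on the group of smooth forms -/

section Operators

variable {M : Type*} [TopologicalSpace M] [ChartedSpace E6 M] [IsManifold (𝓡 6) ∞ M]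
  (H : AlmostHermitian M)

variable (M) in
/-- The group of smooth inhomogeneous forms. -/
def smoothForms : AddSubgroup (MForm M) where
  carrier := {η | IsSmoothM η}
  zero_mem' := fun k => isSmoothForm_zero k
  add_mem' := fun h h' => h.add h'
  neg_mem' := fun {η} h => by
    have h1 : (-1 : ℂ) • η = -η := by
      funext k x
      ext v
      exact neg_one_mul _
    exact h1 ▸ IsSmoothM.smul (-1) h

variable (M) in
/-- The ring of additive operators on smooth forms. -/
def SmoothOp : Type _ := AddMonoid.End (smoothForms M)

instance : Ring (SmoothOp M) := inferInstanceAs (Ring (AddMonoid.End (smoothForms M)))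

instance : FunLike (SmoothOp M) (smoothForms M) (smoothForms M) :=
  inferInstanceAs (FunLike (AddMonoid.End (smoothForms M)) (smoothForms M) (smoothForms M))

/-- The additive operator on smooth forms given by an operator that preserves smoothness. -/
def smoothEnd (O : MForm M → MForm M) (hs : ∀ η, IsSmoothM η → IsSmoothM (O η))
    (ha : ∀ η ζ, IsSmoothM η → IsSmoothM ζ → O (η + ζ) = O η + O ζ) :
    SmoothOp M :=
  AddMonoidHom.mk' (fun η => ⟨O η.1, hs _ η.2⟩) fun η ζ => Subtype.ext (ha _ _ η.2 ζ.2)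

/-- An additive operator on smooth forms that acts pointwise. -/
def pointwiseEnd {O : MForm M → MForm M} {T : Forms V0 →+ Forms V0} (hO : IsPointwise H O T)
    (hs : ∀ η, IsSmoothM η → IsSmoothM (O η)) : SmoothOp M :=
  smoothEnd O hs fun η ζ _ _ => ext_val H fun x L => by
    rw [L.val_add, L.val_pointwise hO, L.val_pointwise hO, L.val_pointwise hO, L.val_add, map_add]

/-- The contraction with the Kähler form as an operator on smooth forms. -/
def lamE : SmoothOp M :=
  pointwiseEnd H (T := ((-2 : ℂ) • lam0).toAddMonoidHom) (isPointwise_lamM H)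
    fun _ => isSmoothM_lamM H

/-- The Hodge star operator on smooth forms. -/
def starE : SmoothOp M :=
  pointwiseEnd H (isPointwise_star H) fun _ => isSmoothM_star H

/-- Complex conjugation on smooth forms. -/
def conjE : SmoothOp M :=
  pointwiseEnd H (isPointwise_conjM H) fun _ => isSmoothM_conjM H

/-- The parity of the degree as an operator on smooth forms. -/
def parityE : SmoothOp M :=
  pointwiseEnd H (T := parity.toAddMonoidHom) (isPointwise_parityM H) fun _ => isSmoothM_parityM H

/-- The projections to forms of given type, as operators on smooth forms. -/
def typeE (r : ℤ) : SmoothOp M :=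
  pointwiseEnd H (T := (proj r).toAddMonoidHom) (isPointwise_typeM H r) fun _ => isSmoothM_typeM H r

/-- The components of the de Rham differential as operators on smooth forms. -/
def dE (i : ℤ) : SmoothOp M :=
  smoothEnd (H.dPart i) (fun _ => isSmoothM_dPart H i) fun η ζ hη hζ => ext_val H fun x L => by
    have h : L.der (η + ζ) = fun b => L.der η b + L.der ζ b := funext (L.der_add hη hζ)
    rw [L.val_add, L.val_dPart hη, L.val_dPart hζ, L.val_dPart (hη.add hζ), L.val_add, h, symb_add,
      map_add]
    abel

variable {H}

/-- Operators agree if they agree in unitary frames at all points. -/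
theorem end_ext {A B : SmoothOp M}
    (h : ∀ (η : smoothForms M) x (L : LocalFrame H x), L.val (A η).1 = L.val (B η).1) : A = B :=
  AddMonoidHom.ext fun η => Subtype.ext (ext_val H (h η))

namespace LocalFrame

variable {x : M} (L : LocalFrame H x) (η : smoothForms M)

theorem val_lamE : L.val (lamE H η).1 = (-2 : ℂ) • lam0 (L.val η.1) :=
  L.val_pointwise (isPointwise_lamM H) η.1

theorem val_starE : L.val (starE H η).1 = star0 (L.val η.1) :=
  L.val_pointwise (isPointwise_star H) η.1

theorem val_conjE : L.val (conjE H η).1 = conjF (L.val η.1) :=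
  L.val_pointwise (isPointwise_conjM H) η.1

theorem val_parityE : L.val (parityE H η).1 = parity (L.val η.1) :=
  L.val_pointwise (isPointwise_parityM H) η.1

theorem val_typeE (r : ℤ) : L.val (typeE H r η).1 = proj r (L.val η.1) :=
  L.val_pointwise (isPointwise_typeM H r) η.1

theorem val_dE (i : ℤ) : L.val (dE H i η).1 = symb i (L.der η.1) + conn L.Γ i (L.val η.1) :=
  L.val_dPart η.2 i

theorem der_lamE : L.der (lamE H η).1 = fun b => (-2 : ℂ) • lam0 (L.der η.1 b) :=
  funext fun b => L.der_linear (T := (-2 : ℂ) • lam0) (isPointwise_lamM H) η.2 b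

theorem der_starE : L.der (starE H η).1 = fun b => star0 (L.der η.1 (bar b)) :=
  funext fun b => L.der_conj (isPointwise_star H) star0_smul η.2 b

theorem der_conjE : L.der (conjE H η).1 = fun b => conjF (L.der η.1 (bar b)) :=
  funext fun b => L.der_conj (isPointwise_conjM H) conjF_smul η.2 b

theorem der_parityE : L.der (parityE H η).1 = fun b => parity (L.der η.1 b) :=
  funext fun b => L.der_linear (isPointwise_parityM H) η.2 b

theorem der_typeE (r : ℤ) : L.der (typeE H r η).1 = fun b => proj r (L.der η.1 b) :=
  funext fun b => L.der_linear (isPointwise_typeM H r) η.2 b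

theorem val_mul (A B : SmoothOp M) :
    L.val ((A * B) η).1 = L.val (A (B η)).1 := rfl

theorem val_end_add (A B : SmoothOp M) :
    L.val ((A + B) η).1 = L.val (A η).1 + L.val (B η).1 := L.val_add _ _

theorem val_end_neg (A : SmoothOp M) :
    L.val ((-A) η).1 = -L.val (A η).1 := L.val_neg _

theorem val_end_sub (A B : SmoothOp M) :
    L.val ((A - B) η).1 = L.val (A η).1 - L.val (B η).1 := by
  rw [sub_eq_add_neg, val_end_add, val_end_neg, sub_eq_add_neg]

theorem val_end_zero : L.val ((0 : SmoothOp M) η).1 = 0 := L.val_zero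

theorem val_end_one : L.val ((1 : SmoothOp M) η).1 = L.val η.1 := rfl

theorem val_end_sum {ι : Type*} (s : Finset ι) (A : ι → SmoothOp M) :
    L.val ((∑ i ∈ s, A i) η).1 = ∑ i ∈ s, L.val (A i η).1 := by
  classical
  induction s using Finset.induction_on with
  | empty => exact L.val_zero
  | insert a s ha ih => rw [Finset.sum_insert ha, Finset.sum_insert ha, val_end_add, ih]

end LocalFrame

theorem starE_starE : starE H * starE H = parityE H := end_ext (H := H) fun η x L => by
  rw [L.val_mul, L.val_starE, L.val_starE, star0_star0, L.val_parityE]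

theorem parityE_parityE : parityE H * parityE H = 1 := end_ext (H := H) fun η x L => by
  rw [L.val_mul, L.val_parityE, L.val_parityE, parity_parity, L.val_end_one]

theorem parityE_starE : parityE H * starE H = starE H * parityE H :=
  end_ext (H := H) fun η x L => by
    rw [L.val_mul, L.val_mul, L.val_parityE, L.val_starE, L.val_starE, L.val_parityE, star0_parity]

theorem parityE_dE (i : ℤ) : parityE H * dE H i = -(dE H i * parityE H) :=
  end_ext (H := H) fun η x L => by
    rw [L.val_end_neg, L.val_mul, L.val_mul, L.val_parityE, L.val_dE, L.val_dE, L.val_parityE,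
      L.der_parityE, map_add, parity_symb, parity_conn, neg_add]

theorem conjE_conjE : conjE H * conjE H = 1 := end_ext (H := H) fun η x L => by
  rw [L.val_mul, L.val_conjE, L.val_conjE, conjF_conjF, L.val_end_one]

theorem conjE_starE : conjE H * starE H = starE H * conjE H := end_ext (H := H) fun η x L => by
  rw [L.val_mul, L.val_mul, L.val_conjE, L.val_starE, L.val_starE, L.val_conjE, conjF_star0]

theorem conjE_parityE : conjE H * parityE H = parityE H * conjE H :=
  end_ext (H := H) fun η x L => by
    rw [L.val_mul, L.val_mul, L.val_conjE, L.val_parityE, L.val_parityE, L.val_conjE, conjF_parity]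

theorem conjE_dE_conjE (i : ℤ) : conjE H * dE H i * conjE H = dE H (1 - i) :=
  end_ext (H := H) fun η x L => by
    rw [L.val_mul, L.val_mul, L.val_conjE, L.val_dE, L.val_dE, L.val_conjE,
      L.der_conjE, map_add, conjF_symb, conjF_conn L.isReal_Γ]
    simp only [conjF_conjF, bar_bar]

theorem conjE_lamE_conjE : conjE H * lamE H * conjE H = -lamE H := end_ext (H := H) fun η x L => by
  rw [L.val_mul, L.val_mul, L.val_conjE, L.val_end_neg, L.val_lamE, L.val_lamE,
    L.val_conjE, conjF_smul, conjF_lam0, conjF_conjF, map_neg, Complex.conj_ofNat, smul_neg]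

theorem typeE_typeE (r s : ℤ) : typeE H r * typeE H s = if r = s then typeE H s else 0 :=
  end_ext (H := H) fun η x L => by
    rw [L.val_mul, L.val_typeE, L.val_typeE, proj_proj]
    split_ifs
    · rw [L.val_typeE]
    · rw [L.val_end_zero]

theorem typeE_dE (r i : ℤ) : typeE H r * dE H i = dE H i * typeE H (r - i) :=
  end_ext (H := H) fun η x L => by
    rw [L.val_mul, L.val_mul, L.val_typeE, L.val_dE, L.val_dE, L.val_typeE, L.der_typeE, map_add,
      proj_symb, proj_conn]

theorem sum_typeE : ∑ r ∈ Finset.range 7, typeE H r = 1 := end_ext (H := H) fun η x L => by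
  rw [L.val_end_sum, L.val_end_one]
  simp only [L.val_typeE]
  ext1 k
  rw [Forms.sum_deg]
  by_cases hk : k ≤ 6
  · rw [← Finset.sum_subset (Finset.range_mono (show k + 1 ≤ 7 by omega))]
    · exact proj_sum _ _
    · intro r _ hr
      refine typePart_of_not _ ?_ _
      rw [Finset.mem_range] at hr
      omega
  · rw [cform_eq_zero (by omega) (L.val η.1 k)]
    exact Finset.sum_eq_zero fun r _ => cform_eq_zero (by omega) _

/-- The components of the de Rham differential `d` add up to `d`, which squares to zero. -/
theorem sum_dE_sq : (∑ i ∈ Finset.Icc (-1 : ℤ) 2, dE H i) * ∑ i ∈ Finset.Icc (-1 : ℤ) 2, dE H i =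
    0 := by
  have h : ∀ η : smoothForms M, ((∑ i ∈ Finset.Icc (-1 : ℤ) 2, dE H i) η).1 = dM η.1 := by
    intro η
    refine ext_val H fun x L => ?_
    rw [L.val_end_sum, L.val_dM η.2, ← sum_symb, ← sum_conn]
    simp only [L.val_dE]
    rw [show Finset.Icc (-1 : ℤ) 2 = {-1, 0, 1, 2} by decide]
    rw [Finset.sum_insert (by decide), Finset.sum_insert (by decide),
      Finset.sum_insert (by decide), Finset.sum_singleton]
    abel
  refine end_ext (H := H) fun η x L => ?_
  rw [L.val_mul, L.val_end_zero, h, h, dM_dM η.2, L.val_zero]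

theorem sum_dE_mul_dE (H : AlmostHermitian M) (m : ℤ) :
    ∑ i ∈ Finset.Icc (-1 : ℤ) 2, ∑ j ∈ Finset.Icc (-1 : ℤ) 2,
      (if i + j = m then dE H i * dE H j else 0) = 0 :=
  sum_mul_eq_zero_of_grading (typeE_typeE (H := H)) (typeE_dE (H := H)) (sum_typeE (H := H))
    (sum_dE_sq (H := H)) m

theorem acE_dE_two_one : acE (dE H 2) (dE H 1) = 0 := by
  have h := sum_dE_mul_dE H 3
  rw [show Finset.Icc (-1 : ℤ) 2 = {-1, 0, 1, 2} by decide] at h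
  simp at h
  rw [acE, add_comm]
  exact h

theorem dE_sq_bidegree_two :
    dE H 2 * dE H 0 + dE H 1 * dE H 1 + dE H 0 * dE H 2 = 0 := by
  have h := sum_dE_mul_dE H 2
  rw [show Finset.Icc (-1 : ℤ) 2 = {-1, 0, 1, 2} by decide] at h
  simp at h
  rw [← h]
  abel

section NearlyKahler

variable {Ω : DForm M 3} {lam : ℝ}

/-- The Kähler identity for `∂`, which holds whenever `d ω` has no component of type `(2, 1)`. -/
theorem lamE_dE_one (hNK : H.IsNearlyKahler Ω lam) :
    lamE H * dE H 1 - dE H 1 * lamE H = adjE (starE H) (dE H 0) := end_ext (H := H) fun η x L => by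
  rw [adjE, L.val_end_neg, L.val_end_sub, L.val_mul, L.val_mul, L.val_mul, L.val_mul,
    L.val_lamE, L.val_dE, L.val_dE, L.val_lamE, L.der_lamE, L.val_starE, L.val_dE, L.val_starE,
    L.der_starE]
  exact lam0_bidegree_one L.isReal_Γ (L.conn_one_kahler hNK) _ _

/-- The commutator of the contraction with `N` on a nearly Kähler manifold. -/
theorem lamE_dE_two (hNK : H.IsNearlyKahler Ω lam) :
    lamE H * dE H 2 - dE H 2 * lamE H =
      adjE (starE H) (dE H (-1)) + adjE (starE H) (dE H (-1)) := end_ext (H := H) fun η x L => by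
  obtain ⟨μ, hμ⟩ := L.exists_torsion hNK
  rw [L.val_end_add, adjE, L.val_end_neg, L.val_end_sub, L.val_mul, L.val_mul,
    L.val_mul, L.val_mul, L.val_lamE, L.val_dE, L.val_dE, L.val_lamE, L.val_starE, L.val_dE,
    L.val_starE, symb_two, symb_two, symb_neg_one, zero_add, zero_add, zero_add,
    lam0_bidegree_two L.isReal_Γ hμ, two_smul]

theorem end_eq_zero_of_three {A : SmoothOp M} (H : AlmostHermitian M)
    (h : A + A + A = 0) : A = 0 := end_ext (H := H) fun η x L => by
  have h1 := congrArg (fun B : SmoothOp M => L.val (B η).1) h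
  simp only [L.val_end_add, L.val_end_zero] at h1
  rw [L.val_end_zero]
  have h2 : (3 : ℂ) • L.val (A η).1 = 0 := by
    rw [← h1]
    module
  exact (smul_eq_zero.1 h2).resolve_left (by norm_num)

theorem dE_identities (hNK : H.IsNearlyKahler Ω lam) :
    (acE (adjE (starE H) (dE H 2)) (dE H 0) = 0 ∧
      acE (adjE (starE H) (dE H (-1))) (dE H 1) = 0 ∧
      acE (dE H 2) (adjE (starE H) (dE H 0)) = 0 ∧
      acE (dE H (-1)) (adjE (starE H) (dE H 1)) = 0) ∧
    (acE (adjE (starE H) (dE H 0)) (dE H 1) = -acE (dE H 2) (adjE (starE H) (dE H 1)) ∧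
      acE (adjE (starE H) (dE H 0)) (dE H 1) = -acE (adjE (starE H) (dE H (-1))) (dE H 0)) ∧
    (acE (adjE (starE H) (dE H 1)) (dE H 0) = -acE (dE H (-1)) (adjE (starE H) (dE H 0)) ∧
      acE (adjE (starE H) (dE H 1)) (dE H 0) = -acE (adjE (starE H) (dE H 2)) (dE H 1)) :=
  acE_identities (fun _ => end_eq_zero_of_three H) starE_starE parityE_parityE parityE_starE
    parityE_dE conjE_conjE conjE_starE conjE_parityE conjE_dE_conjE conjE_lamE_conjE
    (lamE_dE_one hNK) (lamE_dE_two hNK) acE_dE_two_one dE_sq_bidegree_two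

end NearlyKahler

end Operators

end NK

end

theorem mainTheorem9 {M : Type*} [TopologicalSpace M] [ChartedSpace E6 M]
    [IsManifold (𝓡 6) ∞ M] (H : AlmostHermitian M) (Ω : DForm M 3) (lam : ℝ)
    (hNK : H.IsNearlyKahler Ω lam) (η : MForm M) (hη : ∀ k, IsSmoothForm (η k)) :
    (anticomm (H.adj H.N) H.delbar η = 0 ∧
      anticomm (H.adj H.Nbar) H.del η = 0 ∧
      anticomm H.N (H.adj H.delbar) η = 0 ∧
      anticomm H.Nbar (H.adj H.del) η = 0) ∧
    (anticomm (H.adj H.delbar) H.del η = -anticomm H.N (H.adj H.del) η ∧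
      anticomm (H.adj H.delbar) H.del η = -anticomm (H.adj H.Nbar) H.delbar η) ∧
    (anticomm (H.adj H.del) H.delbar η = -anticomm H.Nbar (H.adj H.delbar) η ∧
      anticomm (H.adj H.del) H.delbar η = -anticomm (H.adj H.N) H.del η) := by
  have apply_eq : ∀ {A B : SmoothOp M}, A = B →
      (A ⟨η, hη⟩).1 = (B ⟨η, hη⟩).1 := fun h => by rw [h]
  obtain ⟨⟨h1, h2, h3, h4⟩, ⟨h5, h6⟩, h7, h8⟩ := dE_identities hNK
  exact ⟨⟨apply_eq h1, apply_eq h2, apply_eq h3, apply_eq h4⟩,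
    ⟨apply_eq h5, apply_eq h6⟩, apply_eq h7, apply_eq h8⟩
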